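/- Let $\Bbbk$ be an algebraically closed field of characteristic $0$, let $\Gamma$ be a finite abelian group, and let $g_1,g_2,g_3\in\Gamma$ and characters $\chi_1,\chi_2,\chi_3:\Gamma\to\Bbbk^\times$ be such that the matrix $q_{ij}=\chi_j(g_i)$ is of Cartan type $B_3$: $q_{ij}q_{ji}=q_{ii}^{a_{ij}}$ for all $i,j$, where $$(a_{ij})=\begin{pmatrix}2&-1&0\\-1&2&-1\\0&-2&2\end{pmatrix}.$$ Assume that the order $N$ of $q_{33}$ is odd and greater than $1$. Let $V$ be the corresponding Yetter–Drinfeld module over $\Bbbk\Gamma$, with basis $x_1,x_2,x_3$, $x_i\in V_{g_i}^{\chi_i}$. The positive roots of type $B_3$ are $\alpha_1,\alpha_2,\alpha_3$, $\alpha_{21}=\alpha_1+\alpha_2$, $\alpha_{32}=\alpha_2+\alpha_3$, $\alpha_{31}=\alpha_1+\alpha_2+\alpha_3$, $\alpha_{\tilde32}=\alpha_2+2\alpha_3$, $\alpha_{\tilde31}=\alpha_1+\alpha_2+2\alpha_3$, $\alpha_{\tilde21}=\alpha_1+2\alpha_2+2\alpha_3$. For $\alpha=\sum_i m_i\alpha_i$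 put $g_\alpha=\prod_i g_i^{m_i}$ and $\chi_\alpha=\prod_i\chi_i^{m_i}$; write $g_{ba}=g_{\alpha_{ba}}$, and put $\xi_n=1-q_{33}^{-n}$. Let $\mu=(\mu_\alpha)_{\alpha\in\Phi^+}$ be scalars in $\Bbbk$ such that $\mu_\alpha=0$ whenever $g_\alpha^N=1$ or $\chi_\alpha^N\neq\varepsilon$, where $\varepsilon$ is the trivial character. Let $A(\Gamma,V,\mu)$ be the $\Bbbk$-algebra generated by the group $\Gamma$ and elements $y_\alpha$, $\alpha\in\Phi^+$ (with $y_i=y_{\alpha_i}$, $y_{ba}=y_{\alpha_{ba}}$), subject to the following relations, where $[y_i,y_\beta]_c=y_iy_\beta-\chi_\beta(g_i)\,y_\beta y_i$ and $\operatorname{ad}_c(y_i)(z)=y_iz-\chi(g_i)\,zy_i$ for $z$ of character $\chi$: $$gy_ig^{-1}=\chi_i(g)y_i\quad(g\in\Gamma,\ 1\le i\le 3),$$ $$y_{21}=[y_2,y_1]_c,\quad y_{32}=[y_3,y_2]_c,\quad y_{31}=[y_3,y_{21}]_c,\quad y_{\tilde32}=[y_3,y_{32}]_c,\quad y_{\tilde31}=[y_3,y_{31}]_c,\quad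 y_{\tilde21}=[y_2,y_{\tilde31}]_c,$$ $$\operatorname{ad}_c(y_i)^{1-a_{ij}}(y_j)=0\quad(i\ne j),$$ $$y_i^N=\mu_i(g_i^N-1)\quad(1\le i\le3),$$ $$y_{(i+1)i}^N=\mu_{(i+1)i}(g_{(i+1)i}^N-1)-\xi_2^N\mu_{i+1}\mu_i(g_i^N-1)\quad(i=1,2),$$ $$y_{31}^N=\mu_{31}(g_{31}^N-1)-\xi_2^N\mu_3\mu_{21}(g_{21}^N-1)-\xi_2^N(\mu_{32}-\xi_2^N\mu_3\mu_2)\mu_1(g_1^N-1),$$ $$y_{\tilde32}^N=\mu_{\tilde32}(g_{\tilde32}^N-1)-2\xi_1^N\mu_3\mu_{32}(g_{32}^N-1)+\xi_1^N\xi_2^N\mu_3^2\mu_2(g_2^N-1),$$ $$y_{\tilde31}^N=\mu_{\tilde31}(g_{\tilde31}^N-1)-2\xi_1^N\mu_3\mu_{31}(g_{31}^N-1)+\xi_1^N\xi_2^N\mu_3^2\mu_{21}(g_{21}^N-1)-\xi_2^N(\xi_1^N\xi_2^N\mu_3^2\mu_2-2\xi_1^N\mu_3\mu_{32}+\mu_{\tilde32})\mu_1(g_1^N-1),$$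 $$y_{\tilde21}^N=\mu_{\tilde21}(g_{\tilde21}^N-1)-\xi_2^N\mu_2\mu_{\tilde31}(g_{\tilde31}^N-1)+2\xi_1^N\mu_{32}\mu_{31}(g_{31}^N-1)-\xi_2^N\mu_{\tilde32}\mu_{21}(g_{21}^N-1)+\xi_2^N(\xi_2^N\mu_2\mu_{\tilde32}-\xi_1^N\mu_{32}^2)\mu_1(g_1^N-1).$$ Then the algebra $A(\Gamma,V,\mu)$ has a unique Hopf algebra structure with $$\Delta(g)=g\otimes g,\qquad \Delta(y_i)=y_i\otimes1+g_i\otimes y_i\qquad(g\in\Gamma,\ 1\le i\le3).$$ With this structure it is a pointed Hopf algebra (every simple subcoalgebra is one-dimensional), in which the elements $g\in\Gamma$ are group-like and each $y_i$ is $(g_i,1)$-skew-primitive. -/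

import Mathlib

open scoped TensorProduct

noncomputable section

/-- `D` is a subcoalgebra of `C`: the comultiplication maps `D` into (the image of) `D ⊗ D`. -/
def IsSubcoalgebra (k : Type*) {C : Type*} [Field k] [AddCommGroup C] [Module k C] [Coalgebra k C]
    (D : Submodule k C) : Prop :=
  ∀ d ∈ D, Coalgebra.comul (R := k) d ∈
    LinearMap.range (TensorProduct.map D.subtype D.subtype)

/-- `D` is a simple subcoalgebra of `C`: it is a nonzero subcoalgebra whose only subcoalgebras
are `0` and `D`. -/
def IsSimpleSubcoalgebra (k : Type*) {C : Type*} [Field k] [AddCommGroup C] [Module k C]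
    [Coalgebra k C] (D : Submodule k C) : Prop :=
  IsSubcoalgebra k D ∧ D ≠ ⊥ ∧
    ∀ E : Submodule k C, IsSubcoalgebra k E → E ≤ D → E = ⊥ ∨ E = D

/-- A coalgebra over a field is pointed if all its simple subcoalgebras are one-dimensional. -/
def IsPointedCoalgebra (k C : Type*) [Field k] [AddCommGroup C] [Module k C]
    [Coalgebra k C] : Prop :=
  ∀ D : Submodule k C, IsSimpleSubcoalgebra k D → Module.finrank k D = 1

/-- A Hopf algebra over a field is pointed if its underlying coalgebra is. -/
def IsPointedHopfAlgebra (k H : Type*) [Field k] [Ring H] [HopfAlgebra k H] : Prop :=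
  IsPointedCoalgebra k H

/-- The Cartan matrix of type `B₃`, the third simple root being the short one. The indices
`1, 2, 3` of the simple roots are the elements `0, 1, 2` of `Fin 3`. -/
def cartanB3 : Matrix (Fin 3) (Fin 3) ℤ :=
  !![2, -1, 0; -1, 2, -1; 0, -2, 2]

/-- The nine positive roots of type `B₃`; `r3t2`, `r3t1`, `r2t1` are the roots
`α_{3~2} = 2α₃ + α₂`, `α_{3~1} = 2α₃ + α₂ + α₁`, `α_{2~1} = 2α₃ + 2α₂ + α₁`. -/
inductive PosRoot : Type
  | r1 | r2 | r3 | r21 | r32 | r31 | r3t2 | r3t1 | r2t1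

namespace PosRoot

/-- The coordinates of a positive root in the basis of simple roots. -/
def coeff : PosRoot → Fin 3 → ℕ
  | r1 => ![1, 0, 0]
  | r2 => ![0, 1, 0]
  | r3 => ![0, 0, 1]
  | r21 => ![1, 1, 0]
  | r32 => ![0, 1, 1]
  | r31 => ![1, 1, 1]
  | r3t2 => ![0, 1, 2]
  | r3t1 => ![1, 1, 2]
  | r2t1 => ![1, 2, 2]

/-- The simple roots. -/
def simple : Fin 3 → PosRoot := ![r1, r2, r3]

end PosRoot

/-- A braided vector space `V` of Cartan type `B₃` with basis `x₁, x₂, x₃`, realized as a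
Yetter-Drinfeld module over the abelian group `Γ`: `x_i` has degree `g i` and `Γ` acts on it by
the character `χ i`, so that the braiding matrix is `q_{ij} = χ_j(g_i)`; the order of `q₃₃` is odd
and greater than `1`. -/
structure DatumB3 (k Γ : Type*) [Field k] [CommGroup Γ] where
  g : Fin 3 → Γ
  χ : Fin 3 → (Γ →* kˣ)
  cartan : ∀ i j, χ j (g i) * χ i (g j) = χ i (g i) ^ cartanB3 i j
  odd_order : Odd (orderOf (χ 2 (g 2)))
  one_lt_order : 1 < orderOf (χ 2 (g 2))

namespace DatumB3

open PosRoot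

variable {k Γ : Type*} [Field k] [CommGroup Γ] (V : DatumB3 k Γ)

/-- The order `N` of `q₃₃`. -/
def N : ℕ := orderOf (V.χ 2 (V.g 2))

/-- The braiding matrix. -/
def q (i j : Fin 3) : k := (V.χ j (V.g i) : k)

/-- The scalars `ξ_n = 1 - q₃₃⁻ⁿ`. -/
def ξ (n : ℕ) : k := 1 - (V.q 2 2 ^ n)⁻¹

/-- The group element `g_α` of a positive root `α`. -/
def gRoot (α : PosRoot) : Γ := ∏ i, V.g i ^ α.coeff i

/-- The character `χ_α` of a positive root `α`. -/
def χRoot (α : PosRoot) : Γ →* kˣ := ∏ i, V.χ i ^ α.coeff i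

/-- The condition on the deformation parameters:
`μ_α = 0` if `g_α ^ N = 1` or `χ_α ^ N` is nontrivial. -/
def Admissible (μ : PosRoot → k) : Prop :=
  ∀ α, (V.gRoot α ^ V.N = 1 ∨ V.χRoot α ^ V.N ≠ 1) → μ α = 0

variable (k Γ) in
/-- The free algebra on the generators `g ∈ Γ` and `y_α`, `α` a positive root. -/
abbrev Free : Type _ := FreeAlgebra k (Γ ⊕ PosRoot)

variable (k) in
/-- The generator of the free algebra attached to a group element. -/
def fg (h : Γ) : Free k Γ := FreeAlgebra.ι k (Sum.inl h)

variable (k Γ) in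
/-- The generator `y_α` of the free algebra. -/
def fy (α : PosRoot) : Free k Γ := FreeAlgebra.ι k (Sum.inr α)

/-- The braided commutator `[y_i, y_β]_c = y_i y_β - q_{i,β} y_β y_i`, where
`q_{i,β} = χ_β(g_i)`. -/
def bracket (i : Fin 3) (β : PosRoot) : Free k Γ :=
  fy k Γ (simple i) * fy k Γ β
    - (V.χRoot β (V.g i) : k) • (fy k Γ β * fy k Γ (simple i))

/-- The iterated braided adjoint action `ad_c(y_i)^m (y_j)`. As `ad_c(y_i)^m (y_j)` has degree
`α_j + m α_i`, the next application of `ad_c(y_i)` has the coefficient `q_{ij} q_{ii}^m`. -/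
def adPow (i j : Fin 3) : ℕ → Free k Γ
  | 0 => fy k Γ (simple j)
  | m + 1 => fy k Γ (simple i) * adPow i j m
      - (V.q i j * V.q i i ^ m) • (adPow i j m * fy k Γ (simple i))

/-- The element `g_α ^ N - 1`. -/
def gpow (α : PosRoot) : Free k Γ := fg k (V.gRoot α ^ V.N) - 1

/-- The right-hand sides `u_α(μ)` of the deformed root vector relations `y_α ^ N = u_α(μ)`. -/
def u (μ : PosRoot → k) : PosRoot → Free k Γ
  | r1 => μ r1 • V.gpow r1
  | r2 => μ r2 • V.gpow r2
  | r3 => μ r3 • V.gpow r3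
  | r21 => μ r21 • V.gpow r21 - (V.ξ 2 ^ V.N * μ r2 * μ r1) • V.gpow r1
  | r32 => μ r32 • V.gpow r32 - (V.ξ 2 ^ V.N * μ r3 * μ r2) • V.gpow r2
  | r31 => μ r31 • V.gpow r31
      - (V.ξ 2 ^ V.N * μ r3 * μ r21) • V.gpow r21
      - (V.ξ 2 ^ V.N * (μ r32 - V.ξ 2 ^ V.N * μ r3 * μ r2) * μ r1) • V.gpow r1
  | r3t2 => μ r3t2 • V.gpow r3t2
      - (2 * V.ξ 1 ^ V.N * μ r3 * μ r32) • V.gpow r32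
      + (V.ξ 1 ^ V.N * V.ξ 2 ^ V.N * μ r3 ^ 2 * μ r2) • V.gpow r2
  | r3t1 => μ r3t1 • V.gpow r3t1
      - (2 * V.ξ 1 ^ V.N * μ r3 * μ r31) • V.gpow r31
      + (V.ξ 1 ^ V.N * V.ξ 2 ^ V.N * μ r3 ^ 2 * μ r21) • V.gpow r21
      - (V.ξ 2 ^ V.N * (V.ξ 1 ^ V.N * V.ξ 2 ^ V.N * μ r3 ^ 2 * μ r2
          - 2 * V.ξ 1 ^ V.N * μ r3 * μ r32 + μ r3t2) * μ r1) • V.gpow r1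
  | r2t1 => μ r2t1 • V.gpow r2t1
      - (V.ξ 2 ^ V.N * μ r2 * μ r3t1) • V.gpow r3t1
      + (2 * V.ξ 1 ^ V.N * μ r32 * μ r31) • V.gpow r31
      - (V.ξ 2 ^ V.N * μ r3t2 * μ r21) • V.gpow r21
      + (V.ξ 2 ^ V.N * (V.ξ 2 ^ V.N * μ r2 * μ r3t2 - V.ξ 1 ^ V.N * μ r32 ^ 2) * μ r1) •
          V.gpow r1

/-- The defining relations of the algebra `A(Γ, V, μ)`. -/
inductive Rel (μ : PosRoot → k) : Free k Γ → Free k Γ → Prop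
  -- the relations of the group `Γ`
  | group_one : Rel μ (fg k 1) 1
  | group_mul (h h' : Γ) : Rel μ (fg k (h * h')) (fg k h * fg k h')
  -- the action of the group
  | action (h : Γ) (i : Fin 3) :
      Rel μ (fg k h * fy k Γ (simple i) * fg k h⁻¹) ((V.χ i h : k) • fy k Γ (simple i))
  -- the definition of the root vectors of the non-simple roots
  | root21 : Rel μ (fy k Γ r21) (V.bracket 1 r1)
  | root32 : Rel μ (fy k Γ r32) (V.bracket 2 r2)
  | root31 : Rel μ (fy k Γ r31) (V.bracket 2 r21)
  | root3t2 : Rel μ (fy k Γ r3t2) (V.bracket 2 r32)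
  | root3t1 : Rel μ (fy k Γ r3t1) (V.bracket 2 r31)
  | root2t1 : Rel μ (fy k Γ r2t1) (V.bracket 1 r3t1)
  -- the quantum Serre relations
  | serre (i j : Fin 3) (hij : i ≠ j) : Rel μ (V.adPow i j (1 - cartanB3 i j).toNat) 0
  -- the deformed root vector relations
  | power (α : PosRoot) : Rel μ (fy k Γ α ^ V.N) (V.u μ α)

/-- The algebra `A(Γ, V, μ)`. -/
abbrev A (μ : PosRoot → k) : Type _ := RingQuot (V.Rel μ)

/-- The image of a group element in `A(Γ, V, μ)`. -/
def grp (μ : PosRoot → k) (h : Γ) : V.A μ := RingQuot.mkAlgHom k (V.Rel μ) (fg k h)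

/-- The generator `y_α` of `A(Γ, V, μ)`. -/
def y (μ : PosRoot → k) (α : PosRoot) : V.A μ := RingQuot.mkAlgHom k (V.Rel μ) (fy k Γ α)

/-- In a Hopf algebra `H` with elements `e h` (`h ∈ Γ`) and `x i` (`i = 1, 2, 3`):
`Δ(e h) = e h ⊗ e h` and `Δ(x i) = x i ⊗ 1 + e (g i) ⊗ x i`. -/
def HasCoproduct {H : Type*} [Ring H] [HopfAlgebra k H] (e : Γ → H) (x : Fin 3 → H) : Prop :=
  (∀ h, Coalgebra.comul (R := k) (e h) = e h ⊗ₜ[k] e h) ∧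
    ∀ i, Coalgebra.comul (R := k) (x i) = x i ⊗ₜ[k] 1 + e (V.g i) ⊗ₜ[k] x i

/-- The elements `e h` (`h ∈ Γ`) of the Hopf algebra `H` are group-like. -/
def AreGroupLike (k : Type*) {Γ H : Type*} [Field k] [Ring H] [HopfAlgebra k H] (e : Γ → H) :
    Prop :=
  ∀ h, IsGroupLikeElem k (e h)

/-- `H` is a Hopf algebra structure on the given `k`-algebra `A(Γ, V, μ)` with
`Δ(h) = h ⊗ h` for `h ∈ Γ` and `Δ(y_i) = y_i ⊗ 1 + g_i ⊗ y_i` for `i = 1, 2, 3`. -/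
def IsHopfStructure (μ : PosRoot → k) (H : HopfAlgebra k (V.A μ)) : Prop :=
  H.toAlgebra = (inferInstanceAs (Algebra k (RingQuot (V.Rel μ)))) ∧
    V.HasCoproduct (V.grp μ) (fun i => V.y μ (simple i))

end DatumB3

end

/-!
The algebra `A(Γ, V, μ)` is the last of a chain of quotients that starts with the smash product of
`kΓ` with the free algebra on `y₁, y₂, y₃`. On the latter, Hopf structure maps can be prescribed on
the generators (`DatumB3.baseHopfData`). They descend to a quotient by relations `a = b` for which
`a - b` is skew-primitive (`DatumB3.HopfData.extend`). So it remains to see that, if the relations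
are imposed in a suitable order, each of them is skew-primitive modulo the earlier ones.

The quantum Serre elements come first. The Cartan condition makes the mixed terms in their
coproducts vanish (`braidedAdPow_add`). The power relations follow, by increasing
`DatumB3.level` of the root. In the tensor square, the coproducts of the root vectors are the
root vectors of the sum of two systems of type `B₃`, namely `y_α ⊗ 1` and `g_α ⊗ y_α`, of which the
second is braided past the first (`DatumB3.HopfData.b3Double`). The `N`-th power of such a root
vector is the sum of the powers of the root vectors of the two systems and of mixed terms, which
are products of powers of root vectors of lower level (`B3Double.pow_z21` to `B3Double.pow_z2t1`).
By the earlier relations these lie in the image of the group algebra of `Γ × Γ`. They agree with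
the mixed terms in the coproduct of `u_α(μ)`, by the polynomial identities
`DatumB3.uVal_mul_r21` to `DatumB3.uVal_mul_r2t1`, and so `y_α ^ N - u_α(μ)` is skew-primitive
(`DatumB3.HopfData.isSkewPrimitive_power`). The coproduct of the highest root vector involves the
opposite root vectors `[y₂, y₃]` and `[[y₂, y₃], y₃]`. Their powers are obtained from the antipode,
which maps `y_α` to a multiple of a group element times the opposite root vector
(`DatumB3.HopfData.opposite_r32_pow`, `DatumB3.HopfData.opposite_r3t2_pow`).

The powers in the tensor square are powers of sums of elements that skew-commute up to a correction
term, at a root of unity. Three cases occur: no correction (`add_pow_of_qcomm`), a correction as in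
a quantum Heisenberg algebra (`add_pow_of_heisenberg`), and a correction that is a multiple of a
square (`add_add_pow_of_square`). All of them are cases of one expansion in divided powers
(`add_add_pow_of_primitiveRoot`). They apply to the pairs of root vectors of type `A₂` and `B₂`
inside the system of type `B₃`, and to the highest root after one more skew derivation
(`qcomm_of_derivation`). Admissibility of `μ` enters by `DatumB3.Admissible.u_eq_zero_or`: for the
roots `γ` whose vectors occur in the mixed terms, either the power of `y_γ` vanishes or the `N`-th
powers of all braidings with `y_γ` are trivial, and the power is central in the algebra generated
by the root vectors. For `N = 3` some skew-commutation relations do not follow from the Serre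
relations, since they arise by a division by `1 + q + q²`; the structure `IsA2` isolates the weaker
relations, between a cube and a generator, that suffice.

Pointedness holds for each bialgebra generated by group-like and skew-primitive elements
(`isPointedCoalgebra_of_adjoin_eq_top`): a nonzero element of least filtration degree of a simple
subcoalgebra is a combination of group-like elements, so the subcoalgebra contains a group-like
element. The structure is unique as the coproduct is multiplicative, and as the counit and the
antipode are determined by the coproduct (`HopfAlgebra.eq_of_comul_eq`).
-/

noncomputable section

set_option linter.unusedSimpArgs false

/-! ### Powers of sums of skew-commuting elements -/

section QuantumPower

variable {k S : Type*} [Field k] [Ring S] [Algebra k S]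

/-- The `q`-integer `[m]_p = 1 + p + ⋯ + p ^ (m - 1)`. -/
def qInt (p : k) (m : ℕ) : k := ∑ i ∈ Finset.range m, p ^ i

/-- The `q`-factorial `[1]_p [2]_p ⋯ [m]_p`. -/
def qFac (p : k) (m : ℕ) : k := ∏ i ∈ Finset.range m, qInt p (i + 1)

theorem qInt_add (p : k) (i j : ℕ) : qInt p (i + j) = qInt p i + p ^ i * qInt p j := by
  simp [qInt, Finset.sum_range_add, Finset.mul_sum, pow_add]

@[simp] theorem qInt_zero (p : k) : qInt p 0 = 0 := by simp [qInt]

@[simp] theorem qInt_one (p : k) : qInt p 1 = 1 := by simp [qInt]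

theorem qFac_succ (p : k) (m : ℕ) : qFac p (m + 1) = qFac p m * qInt p (m + 1) := by
  simp [qFac, Finset.prod_range_succ]

@[simp] theorem qFac_zero (p : k) : qFac p 0 = 1 := by simp [qFac]

theorem qInt_mul_sub_one (p : k) (m : ℕ) : qInt p m * (p - 1) = p ^ m - 1 :=
  geom_sum_mul p m

theorem qInt_ne_zero {p : k} {N : ℕ} (hp : IsPrimitiveRoot p N) {m : ℕ} (h0 : 0 < m)
    (hm : m < N) : qInt p m ≠ 0 := by
  intro h
  have := qInt_mul_sub_one p m
  rw [h, zero_mul] at this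
  exact hp.pow_ne_one_of_pos_of_lt h0.ne' hm (by linear_combination -this)

theorem qInt_eq_zero {p : k} {N : ℕ} (hp : IsPrimitiveRoot p N) (hN : 1 < N) :
    qInt p N = 0 := hp.geom_sum_eq_zero hN

theorem qFac_ne_zero {p : k} {N : ℕ} (hp : IsPrimitiveRoot p N) {m : ℕ} (hm : m < N) :
    qFac p m ≠ 0 := by
  rw [qFac, Finset.prod_ne_zero_iff]
  intro i hi
  exact qInt_ne_zero hp (Nat.succ_pos i) (by have := Finset.mem_range.1 hi; omega)

/-- The shift of a sequence by one place, with `0` as its first entry. -/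
def shiftSeq (G : ℕ → S) : ℕ → S
  | 0 => 0
  | j + 1 => G j

/-- The convolution `∑_{i + j = n} a_i G_j` of two sequences. -/
def conv (a G : ℕ → S) (n : ℕ) : S := ∑ x ∈ Finset.HasAntidiagonal.antidiagonal n, a x.1 * G x.2

theorem conv_shift_left (a G : ℕ → S) (n : ℕ) : conv (shiftSeq a) G n = shiftSeq (conv a G) n := by
  cases n with
  | zero => simp [conv, shiftSeq]
  | succ n => simp [conv, Finset.Nat.sum_antidiagonal_succ, shiftSeq]

theorem conv_shift_right (a G : ℕ → S) (n : ℕ) :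
    conv a (shiftSeq G) n = shiftSeq (conv a G) n := by
  cases n with
  | zero => simp [conv, shiftSeq]
  | succ n => simp [conv, Finset.Nat.sum_antidiagonal_succ', shiftSeq]

theorem conv_succ_weight (p : k) (a G : ℕ → S) (n : ℕ) :
    qInt p (n + 1) • conv a G (n + 1) =
      conv (fun i => qInt p (i + 1) • a (i + 1)) G n +
        conv (fun i => p ^ i • a i) (fun j => qInt p (j + 1) • G (j + 1)) n := by
  have h : qInt p (n + 1) • conv a G (n + 1) =
      conv (fun i => qInt p i • a i) G (n + 1) +
        conv (fun i => p ^ i • a i) (fun j => qInt p j • G j) (n + 1) := by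
    simp only [conv, Finset.smul_sum, ← Finset.sum_add_distrib]
    refine Finset.sum_congr rfl fun x hx => ?_
    rw [← Finset.HasAntidiagonal.mem_antidiagonal.1 hx, qInt_add]
    simp only [smul_mul_assoc, mul_smul_comm, add_smul, smul_smul]
    congr 2
    ring
  rw [h]
  congr 1
  · simp [conv, Finset.Nat.sum_antidiagonal_succ]
  · simp [conv, Finset.Nat.sum_antidiagonal_succ']

theorem conv_add_left (a a' G : ℕ → S) (n : ℕ) :
    conv (a + a') G n = conv a G n + conv a' G n := by
  simp [conv, add_mul, Finset.sum_add_distrib]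

theorem conv_add_right (a G G' : ℕ → S) (n : ℕ) :
    conv a (G + G') n = conv a G n + conv a G' n := by
  simp [conv, mul_add, Finset.sum_add_distrib]

/-- Left multiplication by `A + D` on the convolution of two sequences of "divided powers", when
moving `D` to the right of a divided power of `A` creates the factor `W`. The error terms `e`, `T`
measure the failure of `a` and `G` to be divided power sequences. -/
theorem add_mul_conv (p : k) {A D W : S} {a G e T : ℕ → S} (n : ℕ)
    (hA : ∀ i, A * a i = qInt p (i + 1) • a (i + 1) + e i)
    (hD : ∀ i ≤ n, D * a i = p ^ i • (a i * D) + shiftSeq (fun i => p ^ i • a i) i * W)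
    (hG : ∀ j, D * G j + W * shiftSeq G j = qInt p (j + 1) • G (j + 1) + T j) :
    (A + D) * conv a G n = qInt p (n + 1) • conv a G (n + 1) +
      (conv e G n + conv (fun i => p ^ i • a i) T n) := by
  have h1 : A * conv a G n = conv (fun i => qInt p (i + 1) • a (i + 1)) G n + conv e G n := by
    rw [← conv_add_left]
    simp only [conv, Finset.mul_sum, ← mul_assoc, hA]
    rfl
  have h2 : D * conv a G n = conv (fun i => p ^ i • a i) (fun j => D * G j) n +
      conv (shiftSeq (fun i => p ^ i • a i)) (fun j => W * G j) n := by
    simp only [conv, Finset.mul_sum, ← Finset.sum_add_distrib]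
    refine Finset.sum_congr rfl fun x hx => ?_
    have := Finset.HasAntidiagonal.mem_antidiagonal.1 hx
    rw [← mul_assoc, hD _ (by omega)]
    simp only [add_mul, smul_mul_assoc, mul_assoc]
  have h3 : shiftSeq (fun j => W * G j) = fun j => W * shiftSeq G j := by
    funext j; cases j <;> simp [shiftSeq]
  have h4 : conv (fun i => p ^ i • a i) (fun j => D * G j) n +
      conv (fun i => p ^ i • a i) (fun j => W * shiftSeq G j) n =
      conv (fun i => p ^ i • a i) (fun j => qInt p (j + 1) • G (j + 1)) n +
      conv (fun i => p ^ i • a i) T n := by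
    rw [← conv_add_right, ← conv_add_right]
    exact congrArg (fun f => conv _ f n) (funext hG)
  rw [add_mul, h1, h2, conv_shift_left, ← conv_shift_right, h3, conv_succ_weight]
  linear_combination (norm := abel) h4

/-- The convolution of `H` with a sequence `c` of divided powers of `C` satisfies the recursion
required of the sequence `G` in `add_mul_conv`. -/
theorem add_mul_conv_right (p : k) {B C W : S} {H c R e : ℕ → S}
    (hB : ∀ m, B * H m + W * shiftSeq H m = qInt p (m + 1) • H (m + 1) + R m)
    (hC : ∀ m, C * H m = p ^ m • (H m * C))
    (hc : ∀ l, C * c l = qInt p (l + 1) • c (l + 1) + e l) (n : ℕ) :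
    (B + C) * conv H c n + W * shiftSeq (conv H c) n =
      qInt p (n + 1) • conv H c (n + 1) +
        (conv R c n + conv (fun m => p ^ m • H m) e n) := by
  have h1 : B * conv H c n + W * shiftSeq (conv H c) n =
      conv (fun m => qInt p (m + 1) • H (m + 1)) c n + conv R c n := by
    rw [← conv_shift_left, ← conv_add_left]
    simp only [conv, Finset.mul_sum, ← mul_assoc, ← Finset.sum_add_distrib, ← add_mul, hB]
    rfl
  have h2 : C * conv H c n = conv (fun m => p ^ m • H m) (fun l => qInt p (l + 1) • c (l + 1)) n +
      conv (fun m => p ^ m • H m) e n := by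
    rw [← conv_add_right]
    simp only [conv, Finset.mul_sum, ← mul_assoc, hC]
    simp only [smul_mul_assoc, mul_assoc, hc]
    rfl
  rw [add_mul, conv_succ_weight]
  linear_combination (norm := abel) h1 + h2

/-- The divided power `A ^ i / [i]_p!`; it is `0` when the `q`-factorial vanishes. -/
def dpow (p : k) (A : S) (i : ℕ) : S := (qFac p i)⁻¹ • A ^ i

/-- The failure of the identity `A * A ^ (i) = [i + 1]_p A ^ (i + 1)` for divided powers. -/
def dpowErr (p : k) (A : S) (i : ℕ) : S := A * dpow p A i - qInt p (i + 1) • dpow p A (i + 1)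

theorem dpow_mul (p : k) (A : S) (i : ℕ) :
    A * dpow p A i = qInt p (i + 1) • dpow p A (i + 1) + dpowErr p A i := by
  simp [dpowErr]

theorem dpowErr_eq_zero {p : k} {N : ℕ} (hp : IsPrimitiveRoot p N) (A : S) {i : ℕ}
    (hi : i + 1 < N) : dpowErr p A i = 0 := by
  have h := qInt_ne_zero hp (Nat.succ_pos i) hi
  rw [dpowErr, dpow, dpow, qFac_succ, mul_smul_comm, smul_smul, mul_inv, mul_comm (qFac p i)⁻¹,
    ← mul_assoc, mul_inv_cancel₀ h, one_mul, pow_succ', sub_self]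

theorem dpowErr_last {p : k} {N : ℕ} (hp : IsPrimitiveRoot p (N + 1)) (hN : 0 < N) (A : S) :
    dpowErr p A N = (qFac p N)⁻¹ • A ^ (N + 1) := by
  rw [dpowErr, qInt_eq_zero hp (by omega), zero_smul, sub_zero, dpow, mul_smul_comm, pow_succ']

theorem conv_eq_zero_left {e : ℕ → S} {n : ℕ} (h : ∀ i ≤ n, e i = 0) (G : ℕ → S) :
    conv e G n = 0 := by
  refine Finset.sum_eq_zero fun x hx => ?_
  have := Finset.HasAntidiagonal.mem_antidiagonal.1 hx
  rw [h x.1 (by omega), zero_mul]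

theorem conv_eq_zero_right {e : ℕ → S} {n : ℕ} (h : ∀ i ≤ n, e i = 0) (G : ℕ → S) :
    conv G e n = 0 := by
  refine Finset.sum_eq_zero fun x hx => ?_
  have := Finset.HasAntidiagonal.mem_antidiagonal.1 hx
  rw [h x.2 (by omega), mul_zero]

theorem conv_last_left {e : ℕ → S} {n : ℕ} (h : ∀ i < n, e i = 0) (G : ℕ → S) :
    conv e G n = e n * G 0 := by
  cases n with
  | zero => simp [conv]
  | succ n =>
    rw [conv, Finset.Nat.sum_antidiagonal_succ']
    have : conv e (fun j => G (j + 1)) n = 0 := conv_eq_zero_left (fun i hi => h i (by omega)) _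
    simp only [conv] at this
    rw [this, add_zero]

theorem conv_last_right {e : ℕ → S} {n : ℕ} (h : ∀ i < n, e i = 0) (G : ℕ → S) :
    conv G e n = G 0 * e n := by
  cases n with
  | zero => simp [conv]
  | succ n =>
    rw [conv, Finset.Nat.sum_antidiagonal_succ]
    have : conv (fun j => G (j + 1)) e n = 0 := conv_eq_zero_right (fun i hi => h i (by omega)) _
    simp only [conv] at this
    rw [this, add_zero]

theorem mul_pow_of_qcomm {p : k} {A C : S} (h : C * A = p • (A * C)) (i : ℕ) :
    C * A ^ i = p ^ i • (A ^ i * C) := by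
  induction i with
  | zero => simp
  | succ i ih =>
    rw [pow_succ, ← mul_assoc, ih, smul_mul_assoc, mul_assoc, h, mul_smul_comm, smul_smul,
      ← pow_succ, mul_assoc]

theorem mul_pow_of_qcomm_add {p : k} {A D W : S} (hDA : D * A = p • (A * D) + W)
    (hWA : W * A = p ^ 2 • (A * W)) (i : ℕ) :
    D * A ^ (i + 1) = p ^ (i + 1) • (A ^ (i + 1) * D) + (p ^ i * qInt p (i + 1)) • (A ^ i * W) := by
  induction i with
  | zero => simpa using hDA
  | succ i ih =>
    rw [pow_succ A (i + 1), ← mul_assoc, ih, add_mul, smul_mul_assoc, smul_mul_assoc, mul_assoc,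
      hDA, mul_assoc _ W, hWA, mul_add, mul_smul_comm, mul_smul_comm, ← mul_assoc, ← mul_assoc,
      ← pow_succ, smul_add, smul_smul, smul_smul, ← pow_succ, ← pow_succ, add_assoc, ← add_smul,
      show qInt p (i + 1 + 1) = 1 + p * qInt p (i + 1) by
        rw [add_comm (i + 1) 1, qInt_add, qInt_one, pow_one]]
    congr 2
    ring

theorem mul_dpow_of_qcomm_add {p : k} {N : ℕ} (hp : IsPrimitiveRoot p N) {A D W : S}
    (hDA : D * A = p • (A * D) + W) (hWA : W * A = p ^ 2 • (A * W)) {i : ℕ} (hi : i < N) :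
    D * dpow p A i = p ^ i • (dpow p A i * D) + shiftSeq (fun i => p ^ i • dpow p A i) i * W := by
  cases i with
  | zero => simp [dpow, shiftSeq]
  | succ i =>
    have h := qInt_ne_zero hp (Nat.succ_pos i) hi
    have h' := qFac_ne_zero hp (m := i) (by omega)
    simp only [shiftSeq, dpow, mul_smul_comm, smul_mul_assoc, mul_pow_of_qcomm_add hDA hWA,
      smul_add, smul_smul, qFac_succ]
    congr 2
    · ring
    · field_simp

/-- The `N`-th power of `A + B + C` when `p` is a primitive `N`-th root of unity, `C A = p A C + W`
and `B`, `W` skew-commute with `A` and `C`. The sequence `H` collects the monomials in `B` and `W`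
of the expansion: `H_m` is a divided power of "degree" `m`, where `W` has degree `2`. In the
expansion of the power the coefficients that are divisible by `[N]_p = 0` disappear. -/
theorem add_add_pow_of_primitiveRoot {p : k} {N : ℕ} (hp : IsPrimitiveRoot p (N + 2))
    {A B C W : S} (hCA : C * A = p • (A * C) + W) (hBA : B * A = p • (A * B))
    (hWA : W * A = p ^ 2 • (A * W)) {H : ℕ → S} (hH0 : H 0 = 1)
    (hH : ∀ m, m < N + 1 → B * H m + W * shiftSeq H m = qInt p (m + 1) • H (m + 1))
    (hCH : ∀ m, C * H m = p ^ m • (H m * C)) :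
    (A + (B + C)) ^ (N + 2) =
      A ^ (N + 2) + C ^ (N + 2) + qFac p (N + 1) • (B * H (N + 1) + W * H N) := by
  have hDA : (B + C) * A = p • (A * (B + C)) + W := by
    rw [add_mul, hBA, hCA, mul_add, smul_add, add_assoc]
  set R : ℕ → S := fun m => B * H m + W * shiftSeq H m - qInt p (m + 1) • H (m + 1) with hR
  have hR0 : ∀ m, m < N + 1 → R m = 0 := fun m hm => by simp only [hR, hH m hm, sub_self]
  have hRl : R (N + 1) = B * H (N + 1) + W * H N := by
    simp [hR, qInt_eq_zero hp (by omega), shiftSeq]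
  set G := conv H (dpow p C) with hG
  set T : ℕ → S := fun n => conv R (dpow p C) n + conv (fun m => p ^ m • H m) (dpowErr p C) n
    with hT
  have hGr : ∀ j, (B + C) * G j + W * shiftSeq G j = qInt p (j + 1) • G (j + 1) + T j :=
    add_mul_conv_right p (fun m => by simp [hR]) hCH (dpow_mul p C)
  have hT0 : ∀ m, m < N + 1 → T m = 0 := fun m hm => by
    simp only [hT]
    rw [conv_eq_zero_left (fun i hi => hR0 i (by omega)),
      conv_eq_zero_right (fun i hi => dpowErr_eq_zero hp C (by omega)), add_zero]
  have hTl : T (N + 1) = B * H (N + 1) + W * H N + (qFac p (N + 1))⁻¹ • C ^ (N + 2) := by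
    simp only [hT]
    rw [conv_last_left hR0, conv_last_right (fun i hi => dpowErr_eq_zero hp C (by omega)),
      dpowErr_last hp (by omega), hRl, hH0]
    simp [dpow]
  have hG0 : G 0 = 1 := by simp [hG, conv, hH0, dpow]
  have hstep : ∀ n < N + 2, (A + (B + C)) * conv (dpow p A) G n =
      qInt p (n + 1) • conv (dpow p A) G (n + 1) +
      (conv (dpowErr p A) G n + conv (fun i => p ^ i • dpow p A i) T n) := fun n hn =>
    add_mul_conv p n (dpow_mul p A)
      (fun i hi => mul_dpow_of_qcomm_add hp hDA hWA (by omega)) hGr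
  have hpow : ∀ n < N + 2, (A + (B + C)) ^ n = qFac p n • conv (dpow p A) G n := by
    intro n
    induction n with
    | zero => simp [conv, dpow, hG0]
    | succ n ih =>
      intro hn
      rw [pow_succ', ih (by omega), mul_smul_comm, hstep n (by omega),
        conv_eq_zero_left (fun i hi => dpowErr_eq_zero hp A (by omega)),
        conv_eq_zero_right (fun i hi => hT0 i (by omega)), add_zero, add_zero, smul_smul, qFac_succ]
  have hf := qFac_ne_zero hp (Nat.lt_succ_self (N + 1))
  rw [pow_succ', hpow _ (by omega), mul_smul_comm, hstep _ (by omega), qInt_eq_zero hp (by omega),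
    conv_last_left (fun i hi => dpowErr_eq_zero hp A (by omega)), conv_last_right hT0,
    dpowErr_last hp (by omega), hTl, hG0]
  simp only [zero_smul, zero_add, mul_one, pow_zero, one_smul, dpow, qFac_zero, inv_one, one_mul,
    smul_add, smul_smul, mul_inv_cancel₀ hf]
  abel

/-- Powers in a quantum Heisenberg algebra: the commutator term `W` does not contribute to the
`N`-th power as `N` is odd. -/
theorem add_pow_of_heisenberg {p : k} {N : ℕ} (hp : IsPrimitiveRoot p N) (hN1 : 1 < N)
    (hodd : Odd N) {A C W : S} (hCA : C * A = p • (A * C) + W) (hWA : W * A = p ^ 2 • (A * W))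
    (hCW : C * W = p ^ 2 • (W * C)) : (A + C) ^ N = A ^ N + C ^ N := by
  obtain ⟨M, rfl⟩ : ∃ M, N = M + 2 := ⟨N - 2, by omega⟩
  set H : ℕ → S := fun m =>
    if Even m then (∏ i ∈ Finset.range (m / 2), qInt p (2 * i + 2))⁻¹ • W ^ (m / 2) else 0 with hH
  have hM : ¬ Even M := by
    rw [Nat.not_even_iff_odd]
    exact (Nat.odd_add.1 hodd).2 even_two
  have := add_add_pow_of_primitiveRoot hp (B := 0) (H := H) hCA (by simp) hWA (by simp [hH])
    (fun m hm => by
      rcases Nat.even_or_odd' m with ⟨j, rfl | rfl⟩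
      · cases j with
        | zero => simp [hH, shiftSeq]
        | succ j =>
          have h1 : ¬ Even (2 * j + 1) := by simp
          have h2 : ¬ Even (2 * (j + 1) + 1) := by simp
          have h3 : shiftSeq H (2 * (j + 1)) = H (2 * j + 1) := rfl
          rw [zero_mul, zero_add, h3]
          simp only [hH, if_neg h1, if_neg h2, mul_zero, smul_zero]
      · have h1 : Even (2 * j) := by simp
        have h2 : Even (2 * j + 1 + 1) := ⟨j + 1, by ring⟩
        have h3 : (2 * j + 1 + 1) / 2 = j + 1 := by omega
        have h4 : 2 * j / 2 = j := by omega
        have h5 := qInt_ne_zero hp (m := 2 * j + 2) (by omega) (by omega)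
        simp only [shiftSeq, hH, if_pos h1, if_pos h2, h3, h4, Finset.prod_range_succ, zero_mul,
          zero_add, mul_smul_comm, smul_smul, mul_inv, ← pow_succ']
        congr 1
        field_simp)
    (fun m => by
      rcases Nat.even_or_odd' m with ⟨j, rfl | rfl⟩
      · have h4 : 2 * j / 2 = j := by omega
        simp only [hH, even_two_mul, if_true, h4, mul_smul_comm, smul_mul_assoc,
          mul_pow_of_qcomm hCW, ← pow_mul]
        rw [smul_comm]
      · have h1 : ¬ Even (2 * j + 1) := by simp
        simp [hH, if_neg h1])
  simpa [hH, hM] using this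

/-- The quantum binomial theorem at a root of unity. -/
theorem add_pow_of_qcomm {p : k} {N : ℕ} (hp : IsPrimitiveRoot p N) (hN1 : 1 < N)
    {A C : S} (hCA : C * A = p • (A * C)) : (A + C) ^ N = A ^ N + C ^ N := by
  obtain ⟨M, rfl⟩ : ∃ M, N = M + 2 := ⟨N - 2, by omega⟩
  have := add_add_pow_of_primitiveRoot hp (B := (0 : S)) (W := (0 : S))
    (H := fun m => if m = 0 then (1 : S) else 0)
    (by simpa using hCA) (by simp) (by simp) (by simp) (by simp) (fun m => by
      by_cases hm : m = 0 <;> simp [hm])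
  simpa using this

theorem prod_one_add_pow {q : k} {N : ℕ} (hq : IsPrimitiveRoot q N) (hodd : Odd N) :
    ∏ j ∈ Finset.range N, (1 + q ^ (j + 1)) = 2 := by
  have h := congrArg (Polynomial.eval 1) (X_pow_sub_C_eq_prod hq hodd.pos (α := -q) (a := -1)
    (by rw [hodd.neg_pow, hq.pow_eq_one]))
  simp only [Polynomial.eval_sub, Polynomial.eval_pow, Polynomial.eval_X, one_pow,
    Polynomial.eval_C, Polynomial.eval_prod] at h
  calc _ = ∏ i ∈ Finset.range N, (1 - q ^ i * -q) :=
        Finset.prod_congr rfl fun i _ => by ring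
    _ = 2 := by rw [← h]; ring

theorem IsPrimitiveRoot.sq_of_odd {q : k} {N : ℕ} (hq : IsPrimitiveRoot q N) (hodd : Odd N) :
    IsPrimitiveRoot (q ^ 2) N :=
  hq.pow_of_coprime 2 (Nat.coprime_two_left.2 hodd)

theorem one_add_ne_zero_of_odd {q : k} {N : ℕ} (hq : IsPrimitiveRoot q N) (hN1 : 1 < N)
    (hodd : Odd N) : 1 + q ≠ 0 := by
  intro h
  have h2 : q ^ 2 = 1 := by linear_combination (q - 1) * h
  exact (hq.sq_of_odd hodd).ne_one hN1 h2

/-- Powers of `A + B + C` when moving `C` past `A` creates a multiple of `B ^ 2`, with the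
coefficient for which `A + B + C` behaves like the square `(a + b) ^ 2` of a sum of skew-commuting
elements with commutation factor `q`. The coefficients of the powers of `B` are values of
Rogers–Szegő polynomials, which factor at this special point. -/
theorem add_add_pow_of_square {q : k} {N : ℕ} (hq : IsPrimitiveRoot q N) (hN1 : 1 < N)
    (hodd : Odd N) {A B C : S}
    (hBA : B * A = q ^ 2 • (A * B)) (hCB : C * B = q ^ 2 • (B * C))
    (hCA : C * A = q ^ 2 • (A * C) + (q * (q - 1) / (1 + q)) • B ^ 2) :
    (A + B + C) ^ N = A ^ N + (2 / (1 + q) ^ N) • B ^ N + C ^ N := by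
  have hp := hq.sq_of_odd hodd
  have hq1 := one_add_ne_zero_of_odd hq hN1 hodd
  have h2 := prod_one_add_pow hq hodd
  obtain ⟨M, rfl⟩ : ∃ M, N = M + 2 := ⟨N - 2, by omega⟩
  set s : ℕ → k := fun m => (∏ j ∈ Finset.range m, (1 + q ^ (j + 1))) / (1 + q) ^ m with hs
  have hs1 : ∀ m, s (m + 1) + q * (q - 1) / (1 + q) * qInt (q ^ 2) (m + 1) * s m = s (m + 2) := by
    intro m
    have := qInt_mul_sub_one (q ^ 2) (m + 1)
    simp only [hs, Finset.prod_range_succ]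
    field_simp
    linear_combination (∏ j ∈ Finset.range m, (1 + q ^ (j + 1))) * q * (1 + q) ^ (m * 2) *
      (1 + q) ^ 2 * this
  set H : ℕ → S := fun m => ((qFac (q ^ 2) m)⁻¹ * s m) • B ^ m with hH
  have key : ∀ m, m + 1 < M + 2 →
      B * H (m + 1) + ((q * (q - 1) / (1 + q)) • B ^ 2) * H m =
      ((qFac (q ^ 2) (m + 1))⁻¹ * s (m + 2)) • B ^ (m + 2) := by
    intro m hm
    have h3 := qInt_ne_zero hp (Nat.succ_pos m) hm
    have h4 := qFac_ne_zero hp (m := m) (by omega)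
    simp only [hH, mul_smul_comm, smul_mul_assoc, ← pow_succ', ← pow_add, smul_smul]
    rw [add_comm 2 m, ← add_smul, ← hs1, qFac_succ]
    congr 1
    field_simp
  have hBB : ∀ m, C * B ^ m = (q ^ 2) ^ m • (B ^ m * C) := mul_pow_of_qcomm hCB
  have := add_add_pow_of_primitiveRoot hp (A := A) (B := B) (C := C)
    (W := (q * (q - 1) / (1 + q)) • B ^ 2) (H := H) hCA hBA
    (by
      rw [smul_mul_assoc, pow_two, mul_assoc, hBA, mul_smul_comm, ← mul_assoc, hBA]
      simp only [smul_mul_assoc, mul_smul_comm, smul_smul, mul_assoc]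
      congr 1
      ring)
    (by simp [hH, hs])
    (fun m hm => by
      cases m with
      | zero =>
        simp only [shiftSeq, hH, hs]
        simp [qFac, hq1]
      | succ m =>
        have h3 := qInt_ne_zero hp (Nat.succ_pos (m + 1)) (by omega)
        have h4 := qFac_ne_zero hp (m := m + 1) (by omega)
        rw [shiftSeq, key m (by omega), hH]
        simp only [smul_smul]
        rw [qFac_succ _ (m + 1)]
        congr 1
        field_simp)
    (fun m => by
      simp only [hH, mul_smul_comm, smul_mul_assoc, hBB]
      rw [smul_comm])
  rw [add_assoc, this, key M (by omega), smul_smul, ← mul_assoc,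
    mul_inv_cancel₀ (qFac_ne_zero hp (by omega)), one_mul]
  simp only [hs, h2]
  abel

end QuantumPower

/-! ### Pairs of root vectors of type `A₂` -/

section RankTwo

variable {k S : Type*} [Field k] [Ring S] [Algebra k S]

/-- A pair of generators `f`, `y` of type `A₂` with root vector `e = f y - a y f`, where `a` is the
braiding of `f` with `y` and both have the self-braiding `p`. For `N = 3` the second Serre relation
can fail for pairs of root vectors of type `B₃`; only its consequence, that `f ^ 3` skew-commutes
with `y`, is required then. -/
structure IsA2 (p a : k) (N : ℕ) (f y e : S) : Prop where
  def_e : f * y = a • (y * f) + e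
  comm_y : e * y = (a * p) • (y * e)
  comm_f : f * e = (a * p) • (e * f) ∨ (N = 3 ∧ f ^ 3 * y = a ^ 3 • (y * f ^ 3))

/-- The factorization of `A ^ N + B ^ N` for odd `N`, in a commutative algebra. -/
theorem prod_range_add_pow_mul_of_comm {R : Type*} [CommRing R] [Algebra k R] {p : k} {N : ℕ}
    (hp : IsPrimitiveRoot p N) (hodd : Odd N) (A B : R) :
    ∏ i ∈ Finset.range N, (A + p ^ i • B) = A ^ N + B ^ N := by
  have hp' : IsPrimitiveRoot (Polynomial.C p) N := hp.map_of_injective Polynomial.C_injective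
  have h1 := congrArg (Polynomial.eval₂RingHom (Polynomial.eval₂RingHom (algebraMap k R) B) A)
    (X_pow_sub_C_eq_prod (R := Polynomial k) hp' hodd.pos (α := -Polynomial.X)
      (a := -Polynomial.X ^ N) (hodd.neg_pow _))
  simp only [map_sub, map_neg, map_pow, map_mul, map_prod] at h1
  simp only [Polynomial.coe_eval₂RingHom, Polynomial.eval₂_X, Polynomial.eval₂_C,
    sub_neg_eq_add, mul_neg] at h1
  simp only [Algebra.smul_def, map_pow]
  exact h1.symm

theorem prod_range_add_pow_mul {p : k} {N : ℕ} (hp : IsPrimitiveRoot p N) (hodd : Odd N)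
    {A B : S} (h : A * B = B * A) :
    ((List.range N).map fun n => A + p ^ n • B).prod = A ^ N + B ^ N := by
  have hcomm : ∀ x ∈ ({A, B} : Set S), ∀ y ∈ ({A, B} : Set S), x * y = y * x := by
    rintro x (rfl | rfl) y (rfl | rfl) <;> simp [h]
  letI := Algebra.adjoinCommRingOfComm k hcomm
  have hA : A ∈ Algebra.adjoin k ({A, B} : Set S) := Algebra.subset_adjoin (by simp)
  have hB : B ∈ Algebra.adjoin k ({A, B} : Set S) := Algebra.subset_adjoin (by simp)
  have h1 := congrArg (Algebra.adjoin k ({A, B} : Set S)).val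
    (prod_range_add_pow_mul_of_comm hp hodd
      (⟨A, hA⟩ : Algebra.adjoin k ({A, B} : Set S)) ⟨B, hB⟩)
  rw [map_add, map_pow, map_pow] at h1
  refine Eq.trans ?_ h1
  clear h1 hp hodd
  induction N with
  | zero => simp
  | succ n ih =>
    rw [List.range_succ, List.map_append, List.prod_append, ih, Finset.prod_range_succ, map_mul]
    simp

theorem pow_mul_of_qcomm {p : k} {A C : S} (h : C * A = p • (A * C)) (i : ℕ) :
    C ^ i * A = p ^ i • (A * C ^ i) := by
  induction i with
  | zero => simp
  | succ n ih =>
    rw [pow_succ, mul_assoc, h, mul_smul_comm, ← mul_assoc, ih, smul_mul_assoc, smul_smul,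
      mul_assoc, pow_succ, mul_comm p]

/-- The power of a product of two skew-commuting elements. -/
theorem mul_pow_of_qcomm' {p : k} {A C : S} (h : C * A = p • (A * C)) (n : ℕ) :
    (A * C) ^ n = p ^ (∑ i ∈ Finset.range n, i) • (A ^ n * C ^ n) := by
  induction n with
  | zero => simp
  | succ n ih =>
    rw [pow_succ, ih, smul_mul_assoc, mul_assoc, ← mul_assoc (C ^ n), pow_mul_of_qcomm h,
      Finset.sum_range_succ, pow_add, pow_succ A, pow_succ C]
    simp only [smul_mul_assoc, mul_smul_comm, smul_smul, mul_assoc]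

namespace IsA2

variable {p a : k} {N : ℕ} {f y e : S}

/-- For `N = 3`, the defect `w` of the second Serre relation skew-commutes with `f`, `y` and `e`, so
that all words in `f`, `y`, `e` can be put into normal order with the help of `w`. -/
theorem cube_rules (h : IsA2 p a N f y e) (ha : a ≠ 0) (hp3 : 1 + p + p ^ 2 = 0)
    (hf : f ^ 3 * y = a ^ 3 • (y * f ^ 3)) : ∃ w : S, f * e = (a * p) • (e * f) + w ∧
      w * y = (a ^ 2 * p) • (y * w) ∧ f * w = (a * p ^ 2) • (w * f) ∧
      w * e = (a * p ^ 2) • (e * w) := by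
  obtain ⟨w, hw⟩ : ∃ w, f * e = (a * p) • (e * f) + w := ⟨f * e - (a * p) • (e * f), by abel⟩
  have hp2 : p ^ 2 = - 1 - p := by linear_combination hp3
  have hwy : w * y = (a ^ 2 * p) • (y * w) := by
    linear_combination (norm := skip) (-a^2*p) • (h.comm_y * f) + (f * h.comm_y)
      + (a*p) • (h.def_e * e) + (-a*p) • (e * h.def_e) - (hw * y) + (a^2*p) • (y * hw)
    simp only [mul_add, add_mul, mul_sub, sub_mul, smul_mul_assoc, mul_smul_comm, mul_assoc,
      smul_add, smul_sub, smul_smul, neg_mul, mul_neg]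
    module
  have hfw : f * w = (a * p ^ 2) • (w * f) := by
    rw [hp2]
    linear_combination (norm := skip) hf - (f * f) * h.def_e - a • (f * h.def_e * f)
      - a^2 • (h.def_e * (f * f)) - f * hw - (a + a * p) • hw * f
    simp only [mul_add, add_mul, mul_sub, sub_mul, smul_mul_assoc, mul_smul_comm, mul_assoc,
      smul_add, smul_sub, smul_smul, neg_mul, mul_neg, pow_succ, pow_zero, one_mul]
    match_scalars <;> grind
  refine ⟨w, hw, hwy, hfw, ?_⟩
  rw [hp2] at hfw ⊢
  have hp0 : 1 + p ≠ 0 := by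
    intro h0
    have : p = 0 := by grind
    simp [this] at h0
  have key : (1 + p) • (w * e) = (1 + p) • ((a * (-1 - p)) • (e * w)) := by
    linear_combination (norm := skip) ((-1-p)*a) • (hwy * f) + (-1/a) • (f * hwy) + (1/a) •
      (hfw * y) + (-p*a^2) • (y * hfw) + (-p*a) • (h.def_e * w) + ((-1-p)) • (w * h.def_e)
    simp only [mul_add, add_mul, mul_sub, sub_mul, smul_mul_assoc, mul_smul_comm, mul_assoc,
      smul_add, smul_sub, smul_smul, neg_mul, mul_neg]
    match_scalars <;> field_simp <;> grind
  exact smul_right_injective S hp0 key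

/-- A root vector `e` of type `A₂` and its deformation `e + f t`. -/
theorem add_pow (h : IsA2 p a N f y e) (hp : IsPrimitiveRoot p N) (hN1 : 1 < N) {c d : k} {t : S}
    (hcd : c * d * a = 1) (htf : t * f = d • (f * t)) (hty : t * y = c • (y * t)) :
    (e + f * t) ^ N = e ^ N + (f * t) ^ N := by
  have ha : a ≠ 0 := right_ne_zero_of_mul_eq_one hcd
  have hd : d ≠ 0 := by rintro rfl; simp at hcd
  have hc : c = d⁻¹ * a⁻¹ := by field_simp; linear_combination hcd
  have hte : t * e = a⁻¹ • (e * t) := by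
    linear_combination (norm := skip) -t * h.def_e + htf * y + d • f * hty - (a * c) • y * htf
      - a • hty * f + (c * d) • h.def_e * t
    simp only [mul_add, add_mul, mul_sub, sub_mul, smul_mul_assoc, mul_smul_comm, mul_assoc,
      smul_add, smul_sub, smul_smul, neg_mul, mul_neg, hc]
    match_scalars <;> field_simp <;> ring
  rcases h.comm_f with hfe | ⟨rfl, hf⟩
  · refine add_pow_of_qcomm hp hN1 ?_
    rw [mul_assoc, hte, mul_smul_comm, ← mul_assoc, hfe, smul_mul_assoc, smul_smul, mul_assoc]
    congr 1
    field_simp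
  · have hp3 : 1 + p + p ^ 2 = 0 := by
      have := hp.geom_sum_eq_zero hN1
      simpa [Finset.sum_range_succ] using this
    obtain ⟨w, hw, hwy, hfw, hwe⟩ := h.cube_rules ha hp3 hf
    have r1 : ∀ z, t * (f * z) = d • (f * (t * z)) := fun z => by
      rw [← mul_assoc, htf, smul_mul_assoc, mul_assoc]
    have r2 : ∀ z, t * (e * z) = a⁻¹ • (e * (t * z)) := fun z => by
      rw [← mul_assoc, hte, smul_mul_assoc, mul_assoc]
    have r3 : ∀ z, f * (e * z) = (a * p) • (e * (f * z)) + w * z := fun z => by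
      rw [← mul_assoc, hw, add_mul, smul_mul_assoc, mul_assoc]
    have r4 : ∀ z, f * (w * z) = (a * p ^ 2) • (w * (f * z)) := fun z => by
      rw [← mul_assoc, hfw, smul_mul_assoc, mul_assoc]
    have r5 : ∀ z, w * (e * z) = (a * p ^ 2) • (e * (w * z)) := fun z => by
      rw [← mul_assoc, hwe, smul_mul_assoc, mul_assoc]
    simp only [mul_add, add_mul, mul_sub, sub_mul, smul_mul_assoc, mul_smul_comm, mul_assoc,
      smul_add, smul_sub, smul_smul, pow_succ, pow_zero, one_mul, r1, r2, r3, r4, r5, htf, hte,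
      hw, hfw, hwe]
    match_scalars <;> field_simp <;> grind

/-- The product of the `N`-th powers of two root vectors of type `A₂`, by those of the two
root vectors that they generate. -/
theorem pow_mul_pow (h : IsA2 p a N f y e) (hp : IsPrimitiveRoot p N) (hN1 : 1 < N)
    (hodd : Odd N) {α : k} (hα : a * α * p = 1) :
    (a ^ (N * (N - 1) / 2) * (1 - p⁻¹) ^ N) • (y ^ N * f ^ N) =
      (y * f - α • (f * y)) ^ N + α ^ N • e ^ N := by
  have ha : a ≠ 0 := by rintro rfl; simp at hα
  have hp0 : p ≠ 0 := hp.ne_zero (by omega)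
  have hα' : α = a⁻¹ * p⁻¹ := by field_simp; linear_combination hα
  rcases h.comm_f with hfe | ⟨rfl, hf⟩
  · set E := y * f - α • (f * y) with hE
    have hyf : (1 - p⁻¹) • (y * f) = E + α • e := by
      rw [hE, h.def_e, hα']
      match_scalars <;> field_simp <;> ring
    have heE : e * E = E * e := by
      linear_combination (norm := skip) e * hE - hE * e + (1 - α * a) • h.comm_y * f -
        (1 - α * a) • y * hfe - α • e * h.def_e + α • h.def_e * e
      simp only [mul_add, add_mul, mul_sub, sub_mul, smul_mul_assoc, mul_smul_comm, mul_assoc,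
        smul_add, smul_sub, smul_smul, neg_mul, mul_neg, hα']
      match_scalars <;> field_simp <;> ring
    have hfE : f * E = a • (E * f) := by
      linear_combination (norm := skip) f * hE - a • hE * f + h.def_e * f -
        α • f * h.def_e - α • hfe
      simp only [mul_add, add_mul, mul_sub, sub_mul, smul_mul_assoc, mul_smul_comm, mul_assoc,
        smul_add, smul_sub, smul_smul, neg_mul, mul_neg, hα']
      match_scalars <;> field_simp <;> ring
    have main : ∀ n, (a ^ (∑ i ∈ Finset.range n, i) * (1 - p⁻¹) ^ n) • (y ^ n * f ^ n) =
        ((List.range n).map fun i => E + (p⁻¹) ^ i • (α • e)).prod := by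
      intro n
      induction n with
      | zero => simp
      | succ n ih =>
        have h1 : E * f ^ n = (a ^ n)⁻¹ • (f ^ n * E) := by
          rw [eq_inv_smul_iff₀ (pow_ne_zero n ha)]
          exact (pow_mul_of_qcomm hfE n).symm
        have h2 : e * f ^ n = (a ^ n * p ^ n)⁻¹ • (f ^ n * e) := by
          rw [eq_inv_smul_iff₀ (mul_ne_zero (pow_ne_zero n ha) (pow_ne_zero n hp0)), ← mul_pow]
          exact (pow_mul_of_qcomm hfe n).symm
        rw [List.range_succ, List.map_append, List.prod_append, ← ih, Finset.sum_range_succ]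
        simp only [List.map_cons, List.map_nil, List.prod_cons, List.prod_nil, mul_one]
        have h3 : (1 - p⁻¹) • (y ^ (n + 1) * f ^ (n + 1)) =
            y ^ n * ((a ^ n)⁻¹ • (f ^ n * E) + α • (a ^ n * p ^ n)⁻¹ • (f ^ n * e)) := by
          rw [← h1, ← h2, ← smul_mul_assoc α, ← add_mul, ← hyf, pow_succ, pow_succ']
          simp only [mul_assoc, mul_smul_comm, smul_mul_assoc]
        rw [pow_add, pow_succ (1 - p⁻¹), ← mul_assoc, mul_smul, h3]
        simp only [mul_add, mul_smul_comm, smul_mul_assoc, smul_add, smul_smul, mul_assoc,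
          inv_pow]
        match_scalars <;> field_simp
    have := main N
    rw [prod_range_add_pow_mul hp.inv hodd (by simp [heE]), Finset.sum_range_id] at this
    rw [this, smul_pow]
  · have hp3 : 1 + p + p ^ 2 = 0 := by
      have := hp.geom_sum_eq_zero hN1
      simpa [Finset.sum_range_succ] using this
    obtain ⟨w, hw, hwy, hfw, hwe⟩ := h.cube_rules ha hp3 hf
    have r1 : ∀ z, f * (y * z) = a • (y * (f * z)) + e * z := fun z => by
      rw [← mul_assoc, h.def_e, add_mul, smul_mul_assoc, mul_assoc]
    have r2 : ∀ z, e * (y * z) = (a * p) • (y * (e * z)) := fun z => by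
      rw [← mul_assoc, h.comm_y, smul_mul_assoc, mul_assoc]
    have r3 : ∀ z, f * (e * z) = (a * p) • (e * (f * z)) + w * z := fun z => by
      rw [← mul_assoc, hw, add_mul, smul_mul_assoc, mul_assoc]
    have r4 : ∀ z, f * (w * z) = (a * p ^ 2) • (w * (f * z)) := fun z => by
      rw [← mul_assoc, hfw, smul_mul_assoc, mul_assoc]
    have r5 : ∀ z, w * (e * z) = (a * p ^ 2) • (e * (w * z)) := fun z => by
      rw [← mul_assoc, hwe, smul_mul_assoc, mul_assoc]
    have r6 : ∀ z, w * (y * z) = (a ^ 2 * p) • (y * (w * z)) := fun z => by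
      rw [← mul_assoc, hwy, smul_mul_assoc, mul_assoc]
    simp only [mul_add, add_mul, mul_sub, sub_mul, smul_mul_assoc, mul_smul_comm, mul_assoc,
      smul_add, smul_sub, smul_smul, pow_succ, pow_zero, one_mul, r1, r2, r3, r4, r5, r6,
      hw, hfw, hwe, h.def_e, h.comm_y, hwy, hα']
    match_scalars <;> field_simp <;> grind

end IsA2

end RankTwo

/-! ### Pairs of root vectors of type `B₂` -/

section TypeB2

variable {k S : Type*} [Field k] [Ring S] [Algebra k S]

/-- Elements that skew-commute with `u` and `v` skew-commute with a skew commutator of them. -/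
theorem qcomm_right {s t m : k} {y u v w : S} (hu : y * u = s • (u * y)) (hv : y * v = t • (v * y))
    (hw : u * v = m • (v * u) + w) : y * w = (s * t) • (w * y) := by
  linear_combination (norm := skip) hu * v + s • u * hv - m • hv * u - (m * t) • v * hu - y * hw
    + (s * t) • hw * y
  simp only [mul_add, add_mul, mul_sub, sub_mul, smul_mul_assoc, mul_smul_comm, mul_assoc,
    smul_add, smul_sub, smul_smul, neg_mul, mul_neg]
  module

theorem qcomm_left {s t m : k} {x u v w : S} (hu : u * x = s • (x * u)) (hv : v * x = t • (x * v))
    (hw : u * v = m • (v * u) + w) : w * x = (s * t) • (x * w) := by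
  linear_combination (norm := skip) u * hv + t • hu * v - m • v * hu - (m * s) • hv * u - hw * x
    + (s * t) • x * hw
  simp only [mul_add, add_mul, mul_sub, sub_mul, smul_mul_assoc, mul_smul_comm, mul_assoc,
    smul_add, smul_sub, smul_smul, neg_mul, mul_neg]
  module

/-- The relations of a pair of generators of type `B₂`: the short one `X`, with `q = q_{XX}`, and
the long one `Y`, where `a = q_{XY}`. The other two root vectors are `E` and `G`. -/
structure IsB2 (q a : k) (X Y E G : S) : Prop where
  def_E : X * Y = a • (Y * X) + E
  def_G : X * E = (q * a) • (E * X) + G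
  X_G : X * G = (q ^ 2 * a) • (G * X)
  E_Y : E * Y = (q ^ 2 * a) • (Y * E)

/-- The pair `0`, `Y`; a pair that is added to another one of which only the long generator is to
be changed. -/
theorem IsB2.zero_left (q a : k) (Y : S) : IsB2 q a (0 : S) Y 0 0 := by
  constructor <;> simp

namespace IsB2

variable {q a : k} {X Y E G : S}

theorem G_Y (h : IsB2 q a X Y E G) :
    G * Y = (q ^ 2 * a ^ 2) • (Y * G) + (q * (q - 1) * a) • (E * E) := by
  linear_combination (norm := skip) (-q*a^2) • (h.E_Y * X) + (X * h.E_Y) + (q^2*a) •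
    (h.def_E * E) + (-q*a) • (E * h.def_E) - (h.def_G * Y) + (q^2*a^2) • (Y * h.def_G)
  simp only [mul_add, add_mul, mul_sub, sub_mul, smul_mul_assoc, mul_smul_comm, mul_assoc,
    smul_add, smul_sub, smul_smul, neg_mul, mul_neg]
  match_scalars <;> field_simp <;> ring

theorem G_E (h : IsB2 q a X Y E G) (hq : q ≠ 0) (ha : a ≠ 0) :
    G * E = (q ^ 2 * a) • (E * G) := by
  have := h.G_Y
  linear_combination (norm := skip) (-1/(q*a)) • (h.X_G * Y) + (q*a^2) • (Y * h.X_G) + (q*a)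
    • (h.def_E * G) + (-q) • (G * h.def_E) + ((-1+q)) • (h.def_G * E) + ((-q+q^2)*a) • (E *
    h.def_G) + (-q*a) • (this * X) + (1/(q*a)) • (X * this)
  simp only [mul_add, add_mul, mul_sub, sub_mul, smul_mul_assoc, mul_smul_comm, mul_assoc,
    smul_add, smul_sub, smul_smul, neg_mul, mul_neg]
  match_scalars <;> field_simp <;> ring

end IsB2

/-- Two pairs of generators of type `B₂` with the same scalars, the second of which is braided
past the first. -/
structure B2Double (q a : k) (X Y E G X' Y' E' G' : S) : Prop where
  h : IsB2 q a X Y E G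
  h' : IsB2 q a X' Y' E' G'
  XX : X' * X = q • (X * X')
  XY : X' * Y = a • (Y * X')
  YX : Y' * X = (q ^ 2 * a)⁻¹ • (X * Y')
  YY : Y' * Y = q ^ 2 • (Y * Y')

namespace B2Double

variable {q a : k} {X Y E G X' Y' E' G' : S} (b : B2Double q a X Y E G X' Y' E' G')
include b

theorem EX (hq : q ≠ 0) (ha : a ≠ 0) : E' * X = (q * a)⁻¹ • (X * E') := by
  convert qcomm_left b.XX b.YX b.h'.def_E using 2; field_simp

theorem YE (hq : q ≠ 0) (ha : a ≠ 0) : Y' * E = a⁻¹ • (E * Y') := by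
  convert qcomm_right b.YX b.YY b.h.def_E using 2; field_simp

theorem EY : E' * Y = (q ^ 2 * a) • (Y * E') := by
  convert qcomm_left b.XY b.YY b.h'.def_E using 2; ring

theorem EE (hq : q ≠ 0) (ha : a ≠ 0) : E' * E = q • (E * E') := by
  convert qcomm_right (b.EX hq ha) b.EY b.h.def_E using 2; field_simp

theorem EG (hq : q ≠ 0) (ha : a ≠ 0) : E' * G = a⁻¹ • (G * E') := by
  convert qcomm_right (b.EX hq ha) (b.EE hq ha) b.h.def_G using 2; field_simp

theorem GX (hq : q ≠ 0) (ha : a ≠ 0) : G' * X = a⁻¹ • (X * G') := by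
  convert qcomm_left b.XX (b.EX hq ha) b.h'.def_G using 2; field_simp

theorem YG (hq : q ≠ 0) (ha : a ≠ 0) : Y' * G = (q ^ 2 * a ^ 2)⁻¹ • (G * Y') := by
  convert qcomm_right (b.YX) (b.YE hq ha) b.h.def_G using 2; field_simp

theorem XE : X' * E = (q * a) • (E * X') := qcomm_right b.XX b.XY b.h.def_E

theorem GE (hq : q ≠ 0) (ha : a ≠ 0) : G' * E = (q ^ 2 * a) • (E * G') := by
  convert qcomm_left b.XE (b.EE hq ha) b.h'.def_G using 2; ring

theorem GG (hq : q ≠ 0) (ha : a ≠ 0) : G' * G = q ^ 2 • (G * G') := by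
  convert qcomm_right (b.GX hq ha) (b.GE hq ha) b.h.def_G using 2; field_simp

/-- The root vector `E` of the sum of the two pairs. -/
theorem add_E (hq : q ≠ 0) (ha : a ≠ 0) : (X + X') * (Y + Y') =
    a • ((Y + Y') * (X + X')) + (E + (1 - (q ^ 2)⁻¹) • (X * Y') + E') := by
  linear_combination (norm := skip) b.h.def_E + b.h'.def_E + b.XY - a • b.YX
  simp only [mul_add, add_mul, mul_sub, sub_mul, smul_mul_assoc, mul_smul_comm, mul_assoc,
    smul_add, smul_sub, smul_smul, neg_mul, mul_neg]
  match_scalars <;> field_simp <;> ring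

/-- The root vector `G` of the sum of the two pairs. -/
theorem add_G (hq : q ≠ 0) (ha : a ≠ 0) :
    (X + X') * (E + (1 - (q ^ 2)⁻¹) • (X * Y') + E') =
      (q * a) • ((E + (1 - (q ^ 2)⁻¹) • (X * Y') + E') * (X + X')) +
      ((G + ((1 - q⁻¹) * (1 - (q ^ 2)⁻¹)) • (X * X * Y')) +
        (q * (1 - (q ^ 2)⁻¹)) • (X * E') + G') := by
  linear_combination (norm := skip) b.h.def_G + ((1-q^2)*a/(q)) • (X * b.YX) +
    ((-1-q+q^2)*a) • (b.EX hq ha) + ((-1+q^2)*a^2) • (Y' * b.XX) + ((-q+q^3)*a^2) • (b.YX *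
    X') + ((1-q^2)*a) • (X' * b.YX) + ((-1+q^2)*a) • (b.h'.def_E * X) + b.XE + b.h'.def_G
  simp only [mul_add, add_mul, mul_sub, sub_mul, smul_mul_assoc, mul_smul_comm, mul_assoc,
    smul_add, smul_sub, smul_smul, neg_mul, mul_neg]
  match_scalars <;> field_simp <;> ring

variable {N : ℕ}

/-- The power of the root vector `E` of the sum of two pairs. -/
theorem pow_add_E (hq : IsPrimitiveRoot q N) (hN1 : 1 < N) (hodd : Odd N) (ha : a ≠ 0) :
    (E + (1 - (q ^ 2)⁻¹) • (X * Y') + E') ^ N =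
      E ^ N + ((1 - (q ^ 2)⁻¹) • (X * Y')) ^ N + E' ^ N := by
  have hq0 : q ≠ 0 := hq.ne_zero (by omega)
  have hW : ((1 - (q ^ 2)⁻¹) • (X * Y')) * E = q • (E * ((1 - (q ^ 2)⁻¹) • (X * Y'))) +
      ((1 - (q ^ 2)⁻¹) / a) • (G * Y') := by
    linear_combination (norm := skip) ((-1+q^2)/(q^2)) • (X * (b.YE hq0 ha)) +
      ((-1+q^2)/(q^2*a)) • (b.h.def_G * Y')
    simp only [mul_add, add_mul, mul_sub, sub_mul, smul_mul_assoc, mul_smul_comm, mul_assoc,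
      smul_add, smul_sub, smul_smul, neg_mul, mul_neg]
    match_scalars <;> field_simp <;> ring
  rw [add_pow_of_qcomm hq hN1, add_pow_of_heisenberg hq hN1 hodd hW]
  · linear_combination (norm := skip) ((-1+q^2)/(q^2*a^2)) • ((b.h.G_E hq0 ha) * Y') +
      ((-1+q^2)/(q^2*a)) • (G * (b.YE hq0 ha))
    simp only [mul_add, add_mul, mul_sub, sub_mul, smul_mul_assoc, mul_smul_comm, mul_assoc,
      smul_add, smul_sub, smul_smul, neg_mul, mul_neg]
    match_scalars <;> field_simp <;> ring
  · linear_combination (norm := skip) ((1-2*q^2+q^4)/(q^2)) • (Y' * b.h.X_G * Y') +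
      ((-1+2*q^2-q^4)/(q^2)) • (b.YX * G * Y') + ((1-2*q^2+q^4)*a) • ((b.YG hq0 ha) * X * Y')
    simp only [mul_add, add_mul, mul_sub, sub_mul, smul_mul_assoc, mul_smul_comm, mul_assoc,
      smul_add, smul_sub, smul_smul, neg_mul, mul_neg]
    match_scalars <;> field_simp <;> ring
  · have e6 : E' * ((1 - (q ^ 2)⁻¹) • (X * Y')) = q • (((1 - (q ^ 2)⁻¹) • (X * Y')) * E') := by
      linear_combination (norm := skip) ((-1+q^2)/(q^3*a)) • (X * b.h'.E_Y) +
        ((-1+q^2)/(q^2)) • ((b.EX hq0 ha) * Y')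
      simp only [mul_add, add_mul, mul_sub, sub_mul, smul_mul_assoc, mul_smul_comm, mul_assoc,
        smul_add, smul_sub, smul_smul, neg_mul, mul_neg]
      match_scalars <;> field_simp <;> ring
    rw [mul_add, add_mul, e6, b.EE hq0 ha, smul_add]

theorem pow_add_G_left (hq : IsPrimitiveRoot q N) (hN1 : 1 < N) (hodd : Odd N) (ha : a ≠ 0) :
    (G + ((1 - q⁻¹) * (1 - (q ^ 2)⁻¹)) • (X * X * Y')) ^ N =
      G ^ N + (((1 - q⁻¹) * (1 - (q ^ 2)⁻¹)) • (X * X * Y')) ^ N := by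
  have hq0 : q ≠ 0 := hq.ne_zero (by omega)
  refine add_pow_of_qcomm (hq.sq_of_odd hodd) hN1 ?_
  have : X * X * Y' * G = q ^ 2 • (G * (X * X * Y')) := by
    linear_combination (norm := skip) (1/(a)) • (b.h.X_G * X * Y') + (-q^2) • (b.h.X_G * Y'
      * X) + (q^6*a^3) • (Y' * b.h.X_G * X) + (q^4*a^2) • (Y' * X * b.h.X_G) + (-q^4*a^2) •
      (b.YX * X * G) + (-q^2*a) • (X * b.YX * G) + (q^6*a^2) • (G * b.YX * X) + (q^2) • (X * G
      * b.YX) + (q^8*a^4) • ((b.YG hq0 ha) * X * X)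
    simp only [mul_add, add_mul, mul_sub, sub_mul, smul_mul_assoc, mul_smul_comm, mul_assoc,
      smul_add, smul_sub, smul_smul, neg_mul, mul_neg]
    match_scalars <;> field_simp <;> ring
  rw [smul_mul_assoc, this, mul_smul_comm, smul_comm]

theorem sum_G_BA (hq : q ≠ 0) (ha : a ≠ 0) :
    (q * (1 - (q ^ 2)⁻¹)) • (X * E') * (G + ((1 - q⁻¹) * (1 - (q ^ 2)⁻¹)) • (X * X * Y')) =
      q ^ 2 • ((G + ((1 - q⁻¹) * (1 - (q ^ 2)⁻¹)) • (X * X * Y')) *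
        (q * (1 - (q ^ 2)⁻¹)) • (X * E')) := by
  have hET : E' * (X * Y') = q • ((X * Y') * E') := by
    linear_combination (norm := skip) (1/(q*a)) • (X * b.h'.E_Y) + ((b.EX hq ha) * Y')
    simp only [mul_add, add_mul, mul_sub, sub_mul, smul_mul_assoc, mul_smul_comm, mul_assoc,
      smul_add, smul_sub, smul_smul, neg_mul, mul_neg]
    match_scalars <;> field_simp <;> ring
  linear_combination (norm := skip) ((-1+q^2)*a) • (E' * b.h.X_G) + ((1-q^2)*a) • ((b.EX hq
    ha) * G) + ((-q^2+q^4)*a) • (G * (b.EX hq ha)) + ((-q^2+q^4)*a^2) • ((b.EG hq ha) * X) +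
    ((-1+q+2*q^2-2*q^3-q^4+q^5)*a/(q^2)) • (X * hET * X) +
    ((-1+q+2*q^2-2*q^3-q^4+q^5)/(q^5*a)) • (X * X * hET) + ((1-q-2*q^2+2*q^3+q^4-q^5)/(q^3)) •
    (X * X * b.h'.E_Y * X) + ((1-q-2*q^2+2*q^3+q^4-q^5)/(q^2)) • (X * X * b.YX * E') +
    ((-1+q+2*q^2-2*q^3-q^4+q^5)/(q^3)) • (X * X * E' * b.YX) +
    ((1-q-2*q^2+2*q^3+q^4-q^5)*a/(q^2)) • (X * E' * X * b.YX)
  simp only [mul_add, add_mul, mul_sub, sub_mul, smul_mul_assoc, mul_smul_comm, mul_assoc,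
    smul_add, smul_sub, smul_smul, neg_mul, mul_neg]
  match_scalars <;> field_simp <;> ring

theorem sum_G_CB (hq : q ≠ 0) (ha : a ≠ 0) :
    G' * (q * (1 - (q ^ 2)⁻¹)) • (X * E') = q ^ 2 • ((q * (1 - (q ^ 2)⁻¹)) • (X * E') * G') := by
  linear_combination (norm := skip) ((-1+q^2)/(q*a)) • (X * (b.h'.G_E hq ha)) +
    ((-1+q^2)/(q)) • ((b.GX hq ha) * E')
  simp only [mul_add, add_mul, mul_sub, sub_mul, smul_mul_assoc, mul_smul_comm, mul_assoc,
    smul_add, smul_sub, smul_smul, neg_mul, mul_neg]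
  match_scalars <;> field_simp <;> ring

theorem sum_G_CA (hq : q ≠ 0) (ha : a ≠ 0) (hq1 : 1 + q ≠ 0) :
    G' * (G + ((1 - q⁻¹) * (1 - (q ^ 2)⁻¹)) • (X * X * Y')) =
      q ^ 2 • ((G + ((1 - q⁻¹) * (1 - (q ^ 2)⁻¹)) • (X * X * Y')) * G') +
        (q * (q - 1) / (1 + q)) • ((q * (1 - (q ^ 2)⁻¹)) • (X * E')) ^ 2 := by
  linear_combination (norm := skip) (b.GG hq ha) + ((q^3-q^4-q^5+q^6)*a^3) • (b.YX * G' * X)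
    + ((-q+q^2+q^3-q^4)*a^2) • (G' * b.YX * X) + ((q-q^2-q^3+q^4)*a) • (X * b.YX * G') +
    ((-1+q+q^2-q^3)*a/(q)) • (G' * X * b.YX) + ((-q+2*q^2-2*q^4+q^5)*a^2) • ((b.EX hq ha) * E'
    * X) + ((-q^2+2*q^3-2*q^5+q^6)*a^3) • (E' * (b.EX hq ha) * X) + ((-1+2*q-2*q^3+q^4)*a) •
    (X * E' * (b.EX hq ha)) + ((q^3-q^4-q^5+q^6)*a^4) • (Y' * (b.GX hq ha) * X) +
    ((q-q^2-q^3+q^4)*a^2) • (X * Y' * (b.GX hq ha)) + ((q-q^2-q^3+q^4)*a^2) • ((b.h'.G_Y) * X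
    * X)
  simp only [mul_add, add_mul, mul_sub, sub_mul, smul_mul_assoc, mul_smul_comm, mul_assoc,
    smul_add, smul_sub, smul_smul, neg_mul, mul_neg, pow_two]
  match_scalars <;> field_simp <;> ring

/-- The power of the root vector `G` of the sum of two pairs. -/
theorem pow_add_G (hq : IsPrimitiveRoot q N) (hN1 : 1 < N) (hodd : Odd N) (ha : a ≠ 0) :
    ((G + ((1 - q⁻¹) * (1 - (q ^ 2)⁻¹)) • (X * X * Y')) +
        (q * (1 - (q ^ 2)⁻¹)) • (X * E') + G') ^ N =
      (G ^ N + (((1 - q⁻¹) * (1 - (q ^ 2)⁻¹)) • (X * X * Y')) ^ N) +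
        (2 / (1 + q) ^ N) • ((q * (1 - (q ^ 2)⁻¹)) • (X * E')) ^ N + G' ^ N := by
  have hq0 : q ≠ 0 := hq.ne_zero (by omega)
  rw [← b.pow_add_G_left hq hN1 hodd ha]
  exact add_add_pow_of_square hq hN1 hodd (b.sum_G_BA hq0 ha) (b.sum_G_CB hq0 ha)
    (b.sum_G_CA hq0 ha (one_add_ne_zero_of_odd hq hN1 hodd))

end B2Double

end TypeB2

/-! ### Root vectors of type `B₃` -/

section TypeB3

open PosRoot

variable {k S : Type*} [Field k] [Ring S] [Algebra k S]

/-- The defining relations of the root vectors of type `B₃`: their definition as skew commutators,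
and the quantum Serre relations. The parameters are `q = q₃₃`, `a = q₂₁`, `b = q₃₂`, `c = q₃₁`; the
Cartan condition determines the other entries of the braiding matrix.

The names of the relations and of their consequences refer to a root by the word of indices that
defines its root vector, so `332`, `3321` and `221` stand for `r3t2`, `r3t1` and `r2t1`. -/
structure IsB3 (q a b c : k) (x : PosRoot → S) : Prop where
  ne_zero : q ≠ 0 ∧ a ≠ 0 ∧ b ≠ 0 ∧ c ≠ 0 ∧ 1 + q ^ 2 ≠ 0
  r13 : x r3 * x r1 = c • (x r1 * x r3)
  d21 : x r2 * x r1 = a • (x r1 * x r2) + x r21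
  d32 : x r3 * x r2 = b • (x r2 * x r3) + x r32
  d31 : x r3 * x r21 = (b*c) • (x r21 * x r3) + x r31
  d332 : x r3 * x r32 = (q*b) • (x r32 * x r3) + x r3t2
  d3321 : x r3 * x r31 = (q*b*c) • (x r31 * x r3) + x r3t1
  d221 : x r2 * x r3t1 = (a/(q^2*b^2)) • (x r3t1 * x r2) + x r2t1
  s221 : x r2 * x r21 = (q^2*a) • (x r21 * x r2)
  s211 : x r21 * x r1 = (q^2*a) • (x r1 * x r21)
  s3332 : x r3 * x r3t2 = (q^2*b) • (x r3t2 * x r3)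
  s322 : x r32 * x r2 = (q^2*b) • (x r2 * x r32)

namespace IsB3

variable {q a b c : k} {x : PosRoot → S}

/-- `x r31` is also the root vector of the pair `x r32`, `x r1`. -/
theorem d31_of_r32 (h : IsB3 q a b c x) :
    x r32 * x r1 = (a*c) • (x r1 * x r32) + x r31 := by
  obtain ⟨hq, ha, hb, hc, hq2⟩ := h.ne_zero
  linear_combination (norm := skip) h.d31 + (a) • (h.r13 * x r2) + (-b) • (x r2 * h.r13) +
    (-b*c) • (h.d21 * x r3) + (x r3 * h.d21) - (h.d32 * x r1) + (a*c) • (x r1 * h.d32)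
  simp only [mul_add, add_mul, mul_sub, sub_mul, smul_mul_assoc, mul_smul_comm, mul_assoc,
    smul_add, smul_sub, smul_smul, neg_mul, mul_neg]
  match_scalars <;> field_simp <;> ring

theorem comm_31_1 (h : IsB3 q a b c x) :
    x r31 * x r1 = (q^2*a*c) • (x r1 * x r31) := by
  obtain ⟨hq, ha, hb, hc, hq2⟩ := h.ne_zero
  linear_combination (norm := skip) (q^2*a) • (h.r13 * x r21) + (-b*c) • (x r21 * h.r13) +
    (-b*c^2) • (h.s211 * x r3) + (x r3 * h.s211) - (h.d31 * x r1) + (q^2*a*c) • (x r1 * h.d31)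
  simp only [mul_add, add_mul, mul_sub, sub_mul, smul_mul_assoc, mul_smul_comm, mul_assoc,
    smul_add, smul_sub, smul_smul, neg_mul, mul_neg]
  match_scalars <;> field_simp <;> ring

/-- The Serre relations give this relation multiplied by `1 + q ^ 2`, which is nonzero. -/
theorem comm_31_2 (h : IsB3 q a b c x) :
    x r31 * x r2 = (b/(a)) • (x r2 * x r31) := by
  obtain ⟨hq, ha, hb, hc, hq2⟩ := h.ne_zero
  linear_combination (norm := skip) (b^2*c/(a*(1+q^2))) • (h.s221 * x r3) + (-1/(a*(1+q^2)))
    • (x r3 * h.s221) + (1/(a*(1+q^2))) • (h.s322 * x r1) + (-a*c/((1+q^2))) • (x r1 * h.s322)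
    + (q^2*b*c/((1+q^2))) • (h.d21 * x r32) + (-1/(a*(1+q^2))) • (x r32 * h.d21) +
    (1/(a*(1+q^2))) • (h.d32 * x r21) + (-q^2*b*c/((1+q^2))) • (x r21 * h.d32) +
    (-q^2/((1+q^2))) • (h.d31 * x r2) + (b/(a*(1+q^2))) • (x r2 * h.d31) + (-1/((1+q^2))) •
    (h.d31_of_r32 * x r2) + (q^2*b/(a*(1+q^2))) • (x r2 * h.d31_of_r32)
  simp only [mul_add, add_mul, mul_sub, sub_mul, smul_mul_assoc, mul_smul_comm, mul_assoc,
    smul_add, smul_sub, smul_smul, neg_mul, mul_neg]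
  match_scalars <;> field_simp <;> ring

theorem comm_31_21 (h : IsB3 q a b c x) :
    x r31 * x r21 = (q^2*b*c) • (x r21 * x r31) := by
  obtain ⟨hq, ha, hb, hc, hq2⟩ := h.ne_zero
  linear_combination (norm := skip) (-a) • (h.comm_31_1 * x r2) + (b/(a)) • (x r2 *
    h.comm_31_1) + (h.comm_31_2 * x r1) + (-q^2*a^2*c) • (x r1 * h.comm_31_2) + (q^2*b*c) •
    (h.d21 * x r31) - (x r31 * h.d21)
  simp only [mul_add, add_mul, mul_sub, sub_mul, smul_mul_assoc, mul_smul_comm, mul_assoc,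
    smul_add, smul_sub, smul_smul, neg_mul, mul_neg]
  match_scalars <;> field_simp <;> ring

theorem comm_32_21 (h : IsB3 q a b c x) :
    x r32 * x r21 = (q^2*a*b*c) • (x r21 * x r32) + ((-1+q^2)*b) • (x r2 * x r31) := by
  obtain ⟨hq, ha, hb, hc, hq2⟩ := h.ne_zero
  linear_combination (norm := skip) (q^2*a) • h.comm_31_2 + (-b^2*c) • (h.s221 * x r3) + (x
    r3 * h.s221) - (h.d32 * x r21) + (q^2*a*b*c) • (x r21 * h.d32) + (q^2*a) • (h.d31 * x r2)
    + (-b) • (x r2 * h.d31)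
  simp only [mul_add, add_mul, mul_sub, sub_mul, smul_mul_assoc, mul_smul_comm, mul_assoc,
    smul_add, smul_sub, smul_smul, neg_mul, mul_neg]
  match_scalars <;> field_simp <;> ring

/-- `x r3t1` is also the root vector of the pair `x r3t2`, `x r1`. -/
theorem d3321_of_r3t2 (h : IsB3 q a b c x) :
    x r3t2 * x r1 = (a*c^2) • (x r1 * x r3t2) + x r3t1 := by
  obtain ⟨hq, ha, hb, hc, hq2⟩ := h.ne_zero
  linear_combination (norm := skip) h.d3321 + (a*c) • (h.r13 * x r32) + (-q*b) • (x r32 *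
    h.r13) - (h.d332 * x r1) + (a*c^2) • (x r1 * h.d332) + (-q*b*c) • (h.d31_of_r32 * x r3) +
    (x r3 * h.d31_of_r32)
  simp only [mul_add, add_mul, mul_sub, sub_mul, smul_mul_assoc, mul_smul_comm, mul_assoc,
    smul_add, smul_sub, smul_smul, neg_mul, mul_neg]
  match_scalars <;> field_simp <;> ring

theorem comm_3_3321 (h : IsB3 q a b c x) :
    x r3 * x r3t1 = (q^2*b*c) • (x r3t1 * x r3) := by
  obtain ⟨hq, ha, hb, hc, hq2⟩ := h.ne_zero
  linear_combination (norm := skip) (-a*c^2) • (h.r13 * x r3t2) + (q^2*b) • (x r3t2 * h.r13)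
    + (h.s3332 * x r1) + (-a*c^3) • (x r1 * h.s3332) + (q^2*b*c) • (h.d3321_of_r3t2 * x r3) -
    (x r3 * h.d3321_of_r3t2)
  simp only [mul_add, add_mul, mul_sub, sub_mul, smul_mul_assoc, mul_smul_comm, mul_assoc,
    smul_add, smul_sub, smul_smul, neg_mul, mul_neg]
  match_scalars <;> field_simp <;> ring

theorem comm_3321_1 (h : IsB3 q a b c x) :
    x r3t1 * x r1 = (q^2*a*c^2) • (x r1 * x r3t1) := by
  obtain ⟨hq, ha, hb, hc, hq2⟩ := h.ne_zero
  linear_combination (norm := skip) (q^2*a*c) • (h.r13 * x r31) + (-q*b*c) • (x r31 * h.r13)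
    + (-q*b*c^2) • (h.comm_31_1 * x r3) + (x r3 * h.comm_31_1) - (h.d3321 * x r1) +
    (q^2*a*c^2) • (x r1 * h.d3321)
  simp only [mul_add, add_mul, mul_sub, sub_mul, smul_mul_assoc, mul_smul_comm, mul_assoc,
    smul_add, smul_sub, smul_smul, neg_mul, mul_neg]
  match_scalars <;> field_simp <;> ring

theorem comm_332_32 (h : IsB3 q a b c x) :
    x r3t2 * x r32 = (q^2*b) • (x r32 * x r3t2) := by
  obtain ⟨hq, ha, hb, hc, hq2⟩ := h.ne_zero
  linear_combination (norm := skip) (-1/(q*b)) • (h.s3332 * x r2) + (q*b^2) • (x r2 *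
    h.s3332) + (-q) • (x r3t2 * h.d32) + ((-1+q)) • (h.d332 * x r32) + (q^2*b) • (x r32 *
    h.d332) + (q^2*b^3) • (h.s322 * x r3 * x r3) + ((-1-q)*b) • (x r3 * h.s322 * x r3) +
    (1/(q*b)) • (x r3 * x r3 * h.s322) + (q*b) • (h.d32 * x r3 * x r32) + ((-q^2-q^3)*b^2) •
    (h.d32 * x r32 * x r3) + (q) • (x r3 * h.d32 * x r32) + (q^2*b^2) • (x r32 * h.d32 * x r3)
    - (x r3 * x r32 * h.d32) + (q*b) • (h.d332 * x r2 * x r3) + (-1/(q*b)) • (x r3 * h.d332 *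
    x r2) + (-q^3*b^3) • (x r2 * h.d332 * x r3) + (q*b^2) • (x r2 * x r3 * h.d332)
  simp only [mul_add, add_mul, mul_sub, sub_mul, smul_mul_assoc, mul_smul_comm, mul_assoc,
    smul_add, smul_sub, smul_smul, neg_mul, mul_neg]
  match_scalars <;> field_simp <;> ring

theorem comm_332_2 (h : IsB3 q a b c x) :
    x r3t2 * x r2 = (q^2*b^2) • (x r2 * x r3t2) + ((-q+q^2)*b) • (x r32 * x r32) := by
  obtain ⟨hq, ha, hb, hc, hq2⟩ := h.ne_zero
  linear_combination (norm := skip) (-q*b^2) • (h.s322 * x r3) + (x r3 * h.s322) + (q^2*b) •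
    (h.d32 * x r32) + (-q*b) • (x r32 * h.d32) - (h.d332 * x r2) + (q^2*b^2) • (x r2 * h.d332)
  simp only [mul_add, add_mul, mul_sub, sub_mul, smul_mul_assoc, mul_smul_comm, mul_assoc,
    smul_add, smul_sub, smul_smul, neg_mul, mul_neg]
  match_scalars <;> field_simp <;> ring

theorem comm_3321_31 (h : IsB3 q a b c x) :
    x r3t1 * x r31 = (q^2*b*c) • (x r31 * x r3t1) := by
  obtain ⟨hq, ha, hb, hc, hq2⟩ := h.ne_zero
  linear_combination (norm := skip) (-1/(q*b*c)) • (h.comm_3_3321 * x r21) + (q*b^2*c^2) •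
    (x r21 * h.comm_3_3321) + (q*b*c) • (h.d31 * x r3t1) - (h.d3321 * x r31) + ((-q+q^2)*b*c)
    • (x r31 * h.d3321) + (q^2*b^3*c^3) • (h.comm_31_21 * x r3 * x r3) + ((-1-q)*b*c) • (x r3
    * h.comm_31_21 * x r3) + (1/(q*b*c)) • (x r3 * x r3 * h.comm_31_21) + (-q^3*b^2*c^2) •
    (h.d31 * x r31 * x r3) + (q) • (x r3 * h.d31 * x r31) + (q^2*b^2*c^2) • (x r31 * h.d31 * x
    r3) + ((-1-q)) • (x r3 * x r31 * h.d31) + (q^2*b*c) • (x r31 * x r3 * h.d31) + (q) •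
    (h.d3321 * x r3 * x r21) + (-1/(q*b*c)) • (x r3 * h.d3321 * x r21) + (-q^3*b^3*c^3) • (x
    r21 * h.d3321 * x r3) + (q*b*c) • (x r3 * x r21 * h.d3321)
  simp only [mul_add, add_mul, mul_sub, sub_mul, smul_mul_assoc, mul_smul_comm, mul_assoc,
    smul_add, smul_sub, smul_smul, neg_mul, mul_neg]
  match_scalars <;> field_simp <;> ring

theorem comm_3321_21 (h : IsB3 q a b c x) :
    x r3t1 * x r21 = (q^2*b^2*c^2) • (x r21 * x r3t1) + ((-q+q^2)*b*c) • (x r31 * x r31) := by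
  obtain ⟨hq, ha, hb, hc, hq2⟩ := h.ne_zero
  linear_combination (norm := skip) (-q*b^2*c^2) • (h.comm_31_21 * x r3) + (x r3 *
    h.comm_31_21) + (q^2*b*c) • (h.d31 * x r31) + (-q*b*c) • (x r31 * h.d31) - (h.d3321 * x
    r21) + (q^2*b^2*c^2) • (x r21 * h.d3321)
  simp only [mul_add, add_mul, mul_sub, sub_mul, smul_mul_assoc, mul_smul_comm, mul_assoc,
    smul_add, smul_sub, smul_smul, neg_mul, mul_neg]
  match_scalars <;> field_simp <;> ring

theorem comm_3321_2 (h : IsB3 q a b c x) :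
    x r3t1 * x r2 = (b^2/(a)) • (x r2 * x r3t1) + (b/(a)) • (x r32 * x r31) +
      (-q*b*c) • (x r31 * x r32) := by
  obtain ⟨hq, ha, hb, hc, hq2⟩ := h.ne_zero
  linear_combination (norm := skip) (-q*b^2*c) • (h.comm_31_2 * x r3) + (x r3 * h.comm_31_2)
    + (b/(a)) • (h.d32 * x r31) + (-q*b*c) • (x r31 * h.d32) - (h.d3321 * x r2) + (b^2/(a)) •
    (x r2 * h.d3321)
  simp only [mul_add, add_mul, mul_sub, sub_mul, smul_mul_assoc, mul_smul_comm, mul_assoc,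
    smul_add, smul_sub, smul_smul, neg_mul, mul_neg]
  match_scalars <;> field_simp <;> ring

theorem comm_332_31 (h : IsB3 q a b c x) :
    x r3t2 * x r31 = (q^2*a*b*c^2) • (x r31 * x r3t2) + (-a*c) • (x r3t1 * x r32) +
      (q^2*b) • (x r32 * x r3t1) := by
  obtain ⟨hq, ha, hb, hc, hq2⟩ := h.ne_zero
  linear_combination (norm := skip) (h.comm_332_32 * x r1) + (-a^2*c^3) • (x r1 *
    h.comm_332_32) + (q^2*a*b*c^2) • (h.d31_of_r32 * x r3t2) - (x r3t2 * h.d31_of_r32) +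
    (-a*c) • (h.d3321_of_r3t2 * x r32) + (q^2*b) • (x r32 * h.d3321_of_r3t2)
  simp only [mul_add, add_mul, mul_sub, sub_mul, smul_mul_assoc, mul_smul_comm, mul_assoc,
    smul_add, smul_sub, smul_smul, neg_mul, mul_neg]
  match_scalars <;> field_simp <;> ring

/-- The Serre relation of the short generator in the pair `x r32`, `x r1` of type `B₂`. -/
theorem comm_32_f (h : IsB3 q a b c x) :
    x r32 * (x r32 * x r31 - (q*a*c) • (x r31 * x r32)) =
      (q^2*a*c) • ((x r32 * x r31 - (q*a*c) • (x r31 * x r32)) * x r32) := by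
  obtain ⟨hq, ha, hb, hc, hq2⟩ := h.ne_zero
  linear_combination (norm := skip) (-q*b) • (h.s322 * x r3t1) + (a^2*c/(q*b^2)) • (x r3t1 *
    h.s322) + (-q^3*a^2*b*c^2) • (h.comm_31_2 * x r3t2) + (a/(q*b^2)) • (x r3t2 * h.comm_31_2)
    + (1/(q*b)) • (h.comm_332_2 * x r31) + (-q*a^2*c^2/(b)) • (x r31 * h.comm_332_2) +
    (q*a^2*c/(b)) • (h.comm_3321_2 * x r32) + (-q*a/(b)) • (x r32 * h.comm_3321_2) +
    (-a/(q*b^2)) • (h.comm_332_31 * x r2) + (q*b) • (x r2 * h.comm_332_31)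
  simp only [mul_add, add_mul, mul_sub, sub_mul, smul_mul_assoc, mul_smul_comm, mul_assoc,
    smul_add, smul_sub, smul_smul, neg_mul, mul_neg]
  match_scalars <;> field_simp <;> ring

/-- If `q` is a primitive cube root of unity, then `x r3t1` and `x r32` need not skew-commute in the
presence of the Serre relations alone. -/
theorem comm_3321_32 (h : IsB3 q a b c x) (h3 : 1 + q + q ^ 2 ≠ 0) :
    x r3t1 * x r32 = (b/(a*c)) • (x r32 * x r3t1) := by
  obtain ⟨hq, ha, hb, hc, hq2⟩ := h.ne_zero
  linear_combination (norm := skip) (1/(a*c*(1+q+q^2))) • h.comm_332_31 +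
    (-1/(b*c*(1+q+q^2))) • (h.comm_3_3321 * x r2) + (b^2/(a*c*(1+q+q^2))) • (x r2 *
    h.comm_3_3321) + (b/(a*c*(1+q+q^2))) • (h.d32 * x r3t1) + (-q^2/((1+q+q^2))) • (x r3t1 *
    h.d32) + (1/(a*c*(1+q+q^2))) • (h.d332 * x r31) + (-q^2*b*c/((1+q+q^2))) • (x r31 *
    h.d332) + (-q/((1+q+q^2))) • (h.d3321 * x r32) + (q*b/(a*c*(1+q+q^2))) • (x r32 * h.d3321)
    + (-q^2*b/((1+q+q^2))) • (h.comm_3321_2 * x r3) + (1/(b*c*(1+q+q^2))) • (x r3 *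
    h.comm_3321_2)
  simp only [mul_add, add_mul, mul_sub, sub_mul, smul_mul_assoc, mul_smul_comm, mul_assoc,
    smul_add, smul_sub, smul_smul, neg_mul, mul_neg]
  match_scalars <;> field_simp <;> ring

theorem comm_332_3321 (h : IsB3 q a b c x) (h3 : 1 + q + q ^ 2 ≠ 0) :
    x r3t2 * x r3t1 = (q^2*a*c^2) • (x r3t1 * x r3t2) := by
  obtain ⟨hq, ha, hb, hc, hq2⟩ := h.ne_zero
  linear_combination (norm := skip) (a*c/(b)) • (h.comm_3_3321 * x r32) + (-q*b) • (x r32 *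
    h.comm_3_3321) + (q^3*a*b*c^2) • ((h.comm_3321_32 h3) * x r3) + (-a*c/(b)) • (x r3 *
    (h.comm_3321_32 h3)) - (h.d332 * x r3t1) + (q^2*a*c^2) • (x r3t1 * h.d332)
  simp only [mul_add, add_mul, mul_sub, sub_mul, smul_mul_assoc, mul_smul_comm, mul_assoc,
    smul_add, smul_sub, smul_smul, neg_mul, mul_neg]
  match_scalars <;> field_simp <;> ring

theorem comm_f_2 (h : IsB3 q a b c x) :
    (x r32 * x r31 - (q*a*c) • (x r31 * x r32)) * x r2 =
      (q^2*b^2/(a)) • (x r2 * (x r32 * x r31 - (q*a*c) • (x r31 * x r32))) := by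
  obtain ⟨hq, ha, hb, hc, hq2⟩ := h.ne_zero
  linear_combination (norm := skip) (b/(a)) • (h.s322 * x r31) + (-q*a*c) • (x r31 * h.s322)
    + (-q^3*a*b*c) • (h.comm_31_2 * x r32) + (x r32 * h.comm_31_2)
  simp only [mul_add, add_mul, mul_sub, sub_mul, smul_mul_assoc, mul_smul_comm, mul_assoc,
    smul_add, smul_sub, smul_smul, neg_mul, mul_neg]
  match_scalars <;> field_simp <;> ring

theorem comm_2_221 (h : IsB3 q a b c x) :
    x r2 * x r2t1 = (a/(b^2)) • (x r2t1 * x r2) := by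
  obtain ⟨hq, ha, hb, hc, hq2⟩ := h.ne_zero
  linear_combination (norm := skip) (1/(q^2*b^2)) • (h.s322 * x r31) + (-a^2*c/(q*b^3)) • (x
    r31 * h.s322) + (-q*a^2*c/(b^2)) • (h.comm_31_2 * x r32) + (a/(q^2*b^3)) • (x r32 *
    h.comm_31_2) + (a/(b^2)) • (h.d221 * x r2) - (x r2 * h.d221) + (a^2/(q^2*b^4)) •
    (h.comm_3321_2 * x r2) + (-a/(b^2)) • (x r2 * h.comm_3321_2)
  simp only [mul_add, add_mul, mul_sub, sub_mul, smul_mul_assoc, mul_smul_comm, mul_assoc,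
    smul_add, smul_sub, smul_smul, neg_mul, mul_neg]
  match_scalars <;> field_simp <;> ring

theorem comm_221_21 (h : IsB3 q a b c x) :
    x r2t1 * x r21 = (q^4*a*b^2*c^2) • (x r21 * x r2t1) := by
  obtain ⟨hq, ha, hb, hc, hq2⟩ := h.ne_zero
  linear_combination (norm := skip) (q^2*b^2*c^2) • (h.s221 * x r3t1) + (-a/(q^2*b^2)) • (x
    r3t1 * h.s221) + ((q-q^2)*a*c) • (h.comm_31_2 * x r31) + ((q-q^2)*a^2*c/(b)) • (x r31 *
    h.comm_31_2) - (h.d221 * x r21) + (q^4*a*b^2*c^2) • (x r21 * h.d221) + (-a^2/(b^2)) •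
    (h.comm_3321_21 * x r2) + (x r2 * h.comm_3321_21)
  simp only [mul_add, add_mul, mul_sub, sub_mul, smul_mul_assoc, mul_smul_comm, mul_assoc,
    smul_add, smul_sub, smul_smul, neg_mul, mul_neg]
  match_scalars <;> field_simp <;> ring

theorem comm_221_3321 (h : IsB3 q a b c x) (h3 : 1 + q + q ^ 2 ≠ 0) :
    x r2t1 * x r3t1 = (a/(b^2)) • (x r3t1 * x r2t1) := by
  obtain ⟨hq, ha, hb, hc, hq2⟩ := h.ne_zero
  linear_combination (norm := skip) (-a^2*c/(q*b^3)) • (h.comm_3321_31 * x r32) +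
    (1/(q^2*b^2*c)) • (x r32 * h.comm_3321_31) + (a/(q^2*b^3)) • ((h.comm_3321_32 h3) * x r31)
    + (-q*a^2*c^2/(b^2)) • (x r31 * (h.comm_3321_32 h3)) - (h.d221 * x r3t1) + (a/(b^2)) • (x
    r3t1 * h.d221) + (-a/(b^2)) • (h.comm_3321_2 * x r3t1) + (a^2/(q^2*b^4)) • (x r3t1 *
    h.comm_3321_2)
  simp only [mul_add, add_mul, mul_sub, sub_mul, smul_mul_assoc, mul_smul_comm, mul_assoc,
    smul_add, smul_sub, smul_smul, neg_mul, mul_neg]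
  match_scalars <;> field_simp <;> ring

theorem comm_3_221 (h : IsB3 q a b c x) (h3 : 1 + q + q ^ 2 ≠ 0) :
    x r3 * x r2t1 = (q^2*b^2*c) • (x r2t1 * x r3) := by
  obtain ⟨hq, ha, hb, hc, hq2⟩ := h.ne_zero
  linear_combination (norm := skip) (-a*c/(b)) • (h.comm_3321_32 h3) + (-a/(q^2*b^2)) •
    (h.comm_3_3321 * x r2) + (b) • (x r2 * h.comm_3_3321) + (h.d32 * x r3t1) + (-a*c/(b)) • (x
    r3t1 * h.d32) + (q^2*b^2*c) • (h.d221 * x r3) - (x r3 * h.d221)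
  simp only [mul_add, add_mul, mul_sub, sub_mul, smul_mul_assoc, mul_smul_comm, mul_assoc,
    smul_add, smul_sub, smul_smul, neg_mul, mul_neg]
  match_scalars <;> field_simp <;> ring

end IsB3

end TypeB3

/-! ### Adding a skew-commuting element to the first generator -/

section TypeB3

open PosRoot

variable {k S : Type*} [Field k] [Ring S] [Algebra k S] {q a b c : k} {x : PosRoot → S}

/-- The root vectors of the triple obtained from a triple `x` by adding to its first generator a
further one, `t`, that skew-commutes with the generators in the same way. -/
def addFirst (q b : k) (x : PosRoot → S) (t : S) : PosRoot → S
  | r1 => x r1 + t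
  | r2 => x r2
  | r3 => x r3
  | r21 => x r21 + (1 - (q ^ 2)⁻¹) • (x r2 * t)
  | r32 => x r32
  | r31 => x r31 + (1 - (q ^ 2)⁻¹) • (x r32 * t)
  | r3t2 => x r3t2
  | r3t1 => x r3t1 + (1 - (q ^ 2)⁻¹) • (x r3t2 * t)
  | r2t1 => x r2t1 + (1 - (q ^ 2)⁻¹) • ((x r2 * x r3t2 - (q ^ 4 * b ^ 2)⁻¹ • (x r3t2 * x r2)) * t)

theorem IsB3.addFirst (h : IsB3 q a b c x) {t : S} (t1 : t * x r1 = q ^ 2 • (x r1 * t))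
    (t2 : t * x r2 = (q ^ 2 * a)⁻¹ • (x r2 * t)) (t3 : t * x r3 = c⁻¹ • (x r3 * t)) :
    IsB3 q a b c (addFirst q b x t) := by
  obtain ⟨hq, ha, hb, hc, hq2⟩ := h.ne_zero
  have t21 := qcomm_right t2 t1 h.d21
  have t32 := qcomm_right t3 t2 h.d32
  have t31 := qcomm_right t3 t21 h.d31
  have t332 := qcomm_right t3 t32 h.d332
  have t3321 := qcomm_right t3 t31 h.d3321
  have t221 := qcomm_right t2 t3321 h.d221
  constructor
  case ne_zero => exact ⟨hq, ha, hb, hc, hq2⟩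
  case r13 =>
    simp only [_root_.addFirst]
    linear_combination (norm := skip) h.r13 + (-c) • t3
    simp only [mul_add, add_mul, mul_sub, sub_mul, smul_mul_assoc, mul_smul_comm, mul_assoc,
      smul_add, smul_sub, smul_smul, neg_mul, mul_neg]
    match_scalars <;> field_simp <;> ring
  case d21 =>
    simp only [_root_.addFirst]
    linear_combination (norm := skip) h.d21 + (-a) • t2
    simp only [mul_add, add_mul, mul_sub, sub_mul, smul_mul_assoc, mul_smul_comm, mul_assoc,
      smul_add, smul_sub, smul_smul, neg_mul, mul_neg]
    match_scalars <;> field_simp <;> ring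
  case d32 => exact h.d32
  case d31 =>
    simp only [_root_.addFirst]
    linear_combination (norm := skip) h.d31 + ((1-q^2)*b*c/(q^2)) • (x r2 * t3) +
      ((-1+q^2)/(q^2)) • (h.d32 * t)
    simp only [mul_add, add_mul, mul_sub, sub_mul, smul_mul_assoc, mul_smul_comm, mul_assoc,
      smul_add, smul_sub, smul_smul, neg_mul, mul_neg]
    match_scalars <;> field_simp <;> ring
  case d332 => exact h.d332
  case d3321 =>
    simp only [_root_.addFirst]
    linear_combination (norm := skip) h.d3321 + ((1-q^2)*b*c/(q)) • (x r32 * t3) +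
      ((-1+q^2)/(q^2)) • (h.d332 * t)
    simp only [mul_add, add_mul, mul_sub, sub_mul, smul_mul_assoc, mul_smul_comm, mul_assoc,
      smul_add, smul_sub, smul_smul, neg_mul, mul_neg]
    match_scalars <;> field_simp <;> ring
  case d221 =>
    simp only [_root_.addFirst]
    linear_combination (norm := skip) h.d221 + ((1-q^2)*a/(q^4*b^2)) • (x r3t2 * t2)
    simp only [mul_add, add_mul, mul_sub, sub_mul, smul_mul_assoc, mul_smul_comm, mul_assoc,
      smul_add, smul_sub, smul_smul, neg_mul, mul_neg]
    match_scalars <;> field_simp <;> ring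
  case s221 =>
    simp only [_root_.addFirst]
    linear_combination (norm := skip) h.s221 + ((1-q^2)*a) • (x r2 * t2)
    simp only [mul_add, add_mul, mul_sub, sub_mul, smul_mul_assoc, mul_smul_comm, mul_assoc,
      smul_add, smul_sub, smul_smul, neg_mul, mul_neg]
    match_scalars <;> field_simp <;> ring
  case s211 =>
    simp only [_root_.addFirst]
    linear_combination (norm := skip) h.s211 + (-q^2*a) • t21 + ((-1+q^2)/(q^2)) • (x r2 *
      t1) + ((-1+q^2)) • (h.d21 * t) + ((1-q^2)*a) • (t2 * t)
    simp only [mul_add, add_mul, mul_sub, sub_mul, smul_mul_assoc, mul_smul_comm, mul_assoc,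
      smul_add, smul_sub, smul_smul, neg_mul, mul_neg]
    match_scalars <;> field_simp <;> ring
  case s3332 => exact h.s3332
  case s322 => exact h.s322

end TypeB3

/-! ### Opposite root vectors of type `B₃` -/

section TypeB3

open PosRoot

variable {k S : Type*} [Field k] [Ring S] [Algebra k S] {q a b c : k} {x : PosRoot → S}

/-- The skew commutator of `x₂` and `x₃`, in the order opposite to the one in `x r32`. -/
def oppositeR32 (q b : k) (x : PosRoot → S) : S := x r2 * x r3 - (q ^ 2 * b)⁻¹ • (x r3 * x r2)

/-- The iterated skew commutator of `x₂`, `x₃`, `x₃`, in the order opposite to the one in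
`x r3t2`. -/
def oppositeR3t2 (q b : k) (x : PosRoot → S) : S :=
  oppositeR32 q b x * x r3 - (q * b)⁻¹ • (x r3 * oppositeR32 q b x)

namespace IsB3

/-- `x r2t1` is also the root vector of the pair of `oppositeR3t2 q b x` and `x r21`. -/
theorem opposite_r3t2_r21 (h : IsB3 q a b c x) :
    oppositeR3t2 q b x * x r21 = (q^2*a*b^2*c^2) • (x r21 * oppositeR3t2 q b x) + x r2t1 := by
  obtain ⟨hq, ha, hb, hc, hq2⟩ := h.ne_zero
  unfold oppositeR3t2 oppositeR32
  linear_combination (norm := skip) h.d221 + (a/(b^2)) • h.comm_3321_2 + ((-1+q^2)*a*c) •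
    (h.comm_31_2 * x r3) + ((1+q-2*q^2-q^3+q^4)*a/(q^2*b^2)) • (x r3 * h.comm_31_2) +
    ((-1+q^2)*a*c/(q*b)) • (x r31 * h.d32) + (a*c/(q*b)) • (h.d31 * x r32) + (-1/(b)) • (x r32
    * h.d31) + ((-1+q^2)*a/(q^2*b^2)) • (h.d3321 * x r2) + (-c) • (h.comm_32_21 * x r3) +
    ((1+q-q^2)/(q^2*b^2)) • (x r3 * h.comm_32_21) + ((1-q-q^2+q^3)/(q^3*b^2)) • (x r3 * x r3 *
    h.s221) + (-1/(b)) • (h.d32 * x r3 * x r21) + ((1+q-q^2)/(q^2*b^2)) • (x r3 * h.d32 * x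
    r21) + (q^2*a*b*c^2) • (x r21 * h.d32 * x r3) + ((1-q-q^2+q^3)*a*c/(q*b)) • (x r3 * x r21
    * h.d32) + (-a*c^2/(q)) • (x r21 * x r3 * h.d32) + ((1-q-q^2+q^3)*a*c/(q)) • (h.d31 * x r2
    * x r3) + ((1-q-q^2+q^3)*a/(q*b^2)) • (x r3 * h.d31 * x r2)
  simp only [mul_add, add_mul, mul_sub, sub_mul, smul_mul_assoc, mul_smul_comm, mul_assoc,
    smul_add, smul_sub, smul_smul, neg_mul, mul_neg]
  match_scalars <;> field_simp <;> ring

theorem comm_opposite_r3t2_r2t1 (h : IsB3 q a b c x) (h3 : 1 + q + q ^ 2 ≠ 0) :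
    oppositeR3t2 q b x * x r2t1 = (q^4*a*b^2*c^2) • (x r2t1 * oppositeR3t2 q b x) := by
  obtain ⟨hq, ha, hb, hc, hq2⟩ := h.ne_zero
  unfold oppositeR3t2 oppositeR32
  linear_combination (norm := skip) (q^4*b^4*c^2) • (h.comm_2_221 * x r3 * x r3) +
    ((-1-q)*b*c) • (x r3 * h.comm_2_221 * x r3) + (1/(q^3*b^2)) • (x r3 * x r3 * h.comm_2_221)
    + ((-1-q)*a*c/(b)) • ((h.comm_3_221 h3) * x r2 * x r3) + (a*c/(q*b^2)) • ((h.comm_3_221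
    h3) * x r3 * x r2) + (a/(q^3*b^4)) • (x r3 * (h.comm_3_221 h3) * x r2) + (q^2*b^2*c) • (x
    r2 * (h.comm_3_221 h3) * x r3) + (x r2 * x r3 * (h.comm_3_221 h3)) + ((-1-q)/(q^2*b)) • (x
    r3 * x r2 * (h.comm_3_221 h3))
  simp only [mul_add, add_mul, mul_sub, sub_mul, smul_mul_assoc, mul_smul_comm, mul_assoc,
    smul_add, smul_sub, smul_smul, neg_mul, mul_neg]
  match_scalars <;> field_simp <;> ring

end IsB3

theorem one_add_add_sq_ne_zero {q : k} {N : ℕ} (hq : IsPrimitiveRoot q N) (hN1 : 1 < N)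
    (h3 : N ≠ 3) : 1 + q + q ^ 2 ≠ 0 := by
  intro h
  have h1 : q ^ 3 = 1 := by linear_combination (q - 1) * h
  have h2 := (Nat.dvd_prime Nat.prime_three).1 (hq.dvd_of_pow_eq_one 3 h1)
  omega

section Derivation

variable {A₀ B₀ C₀ A B C u : S} {s κ : k}

/-- Applying twice the skew derivation `[u, -]`, whose square vanishes on both factors, to a
skew-commutation relation. -/
theorem qcomm_of_derivation (hq : q ≠ 0) (hs : s ≠ 0) (hq2 : 1 + q ^ 2 ≠ 0)
    (hA₀ : u * A₀ = s • (A₀ * u) + A) (hB₀ : u * B₀ = s • (B₀ * u) + B)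
    (hA : u * A = (s * q ^ 2) • (A * u)) (hB : u * B = (s * q ^ 2) • (B * u))
    (hBA : B₀ * A₀ = q ^ 2 • (A₀ * B₀)) : B * A = q ^ 2 • (A * B) := by
  linear_combination (norm := skip) (q^2/(s*(1+q^2))) • (hA * B₀) + (-s/((1+q^2))) • (B₀ *
    hA) + (-1/(s*(1+q^2))) • (hB * A₀) + (q^2*s/((1+q^2))) • (A₀ * hB) + (q^2/((1+q^2))) •
    (hA₀ * B) - (hB₀ * A) + (q^4/((1+q^2))) • (A * hB₀) + (q^2*s^3/((1+q^2))) • (hBA * u * u)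
    + (-s) • (u * hBA * u) + (1/(s*(1+q^2))) • (u * u * hBA) + (-q^4*s/((1+q^2))) • (hA₀ * B₀
    * u) + (q^2*s^2/((1+q^2))) • (B₀ * hA₀ * u) + (q^2/(s*(1+q^2))) • (u * hA₀ * B₀) - (u * B₀
    * hA₀) + (q^2*s/((1+q^2))) • (B₀ * u * hA₀) + (q^2/((1+q^2))) • (hB₀ * u * A₀) +
    (-q^4*s^2/((1+q^2))) • (A₀ * hB₀ * u) + (-1/(s*(1+q^2))) • (u * hB₀ * A₀) +
    (q^2/((1+q^2))) • (u * A₀ * hB₀)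
  simp only [mul_add, add_mul, mul_sub, sub_mul, smul_mul_assoc, mul_smul_comm, mul_assoc,
    smul_add, smul_sub, smul_smul, neg_mul, mul_neg]
  match_scalars <;> field_simp <;> ring

/-- The version of `qcomm_of_derivation` for a relation that involves a square. -/
theorem qcomm_add_sq_of_derivation (hq : q ≠ 0) (hs : s ≠ 0) (hq2 : 1 + q ^ 2 ≠ 0)
    (hA₀ : u * A₀ = s • (A₀ * u) + A) (hB₀ : u * B₀ = s • (B₀ * u) + B)
    (hC₀ : u * C₀ = s • (C₀ * u) + C) (hA : u * A = (s * q ^ 2) • (A * u))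
    (hB : u * B = (s * q ^ 2) • (B * u)) (hC : u * C = (s * q ^ 2) • (C * u))
    (hCA : C₀ * A₀ = q ^ 2 • (A₀ * C₀) + κ • B₀ ^ 2) : C * A = q ^ 2 • (A * C) + κ • B ^ 2 := by
  linear_combination (norm := skip) (q^2/(s*(1+q^2))) • (hA * C₀) + (-s/((1+q^2))) • (C₀ *
    hA) + (κ/(s*(1+q^2))) • (hB * B₀) + (κ*s/((1+q^2))) • (B₀ * hB) + (-1/(s*(1+q^2))) • (hC *
    A₀) + (q^2*s/((1+q^2))) • (A₀ * hC) + (q^2/((1+q^2))) • (hA₀ * C) + (κ/((1+q^2))) • (hB₀ *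
    B) + (q^2*κ/((1+q^2))) • (B * hB₀) - (hC₀ * A) + (q^4/((1+q^2))) • (A * hC₀) +
    (-q^4*s/((1+q^2))) • (hA₀ * C₀ * u) + (q^2*s^2/((1+q^2))) • (C₀ * hA₀ * u) +
    (q^2/(s*(1+q^2))) • (u * hA₀ * C₀) - (u * C₀ * hA₀) + (q^2*s/((1+q^2))) • (C₀ * u * hA₀) +
    (-q^2*κ*s/((1+q^2))) • (hB₀ * B₀ * u) + (-q^2*κ*s^2/((1+q^2))) • (B₀ * hB₀ * u) +
    (κ/(s*(1+q^2))) • (u * hB₀ * B₀) + (κ/((1+q^2))) • (u * B₀ * hB₀) + (q^2/((1+q^2))) • (hC₀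
    * u * A₀) + (-q^4*s^2/((1+q^2))) • (A₀ * hC₀ * u) + (-1/(s*(1+q^2))) • (u * hC₀ * A₀) +
    (q^2/((1+q^2))) • (u * A₀ * hC₀) + (q^2*s^3/((1+q^2))) • (hCA * u * u) + (-s) • (u * hCA *
    u) + (1/(s*(1+q^2))) • (u * u * hCA)
  simp only [mul_add, add_mul, mul_sub, sub_mul, smul_mul_assoc, mul_smul_comm, mul_assoc,
    smul_add, smul_sub, smul_smul, neg_mul, mul_neg, pow_two]
  match_scalars <;> field_simp <;> ring

end Derivation

namespace IsB3

/-- The pair `α₃~₂`, `α₁`. The relation of the `N`-th power of `x r3t2` is used if `N = 3`, when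
`x r3t2` and `x r3t1` need not skew-commute. -/
theorem isA2_r3t2_r1 {N : ℕ} (h : IsB3 q a b c x) (hq : IsPrimitiveRoot q N)
    (hN1 : 1 < N) (hc : x r3t2 ^ N * x r1 = (a * c ^ 2) ^ N • (x r1 * x r3t2 ^ N)) :
    IsA2 (q ^ 2) (a * c ^ 2) N (x r3t2) (x r1) (x r3t1) where
  def_e := h.d3321_of_r3t2
  comm_y := by convert h.comm_3321_1 using 2; ring
  comm_f := by
    rcases eq_or_ne N 3 with rfl | h3
    · exact .inr ⟨rfl, hc⟩
    · left
      convert h.comm_332_3321 (one_add_add_sq_ne_zero hq hN1 h3) using 2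
      ring

/-- The pair `x r3t1`, `x r2`. Its root vector has the degree of `α₂~₁`, but it is the skew
commutator in the order opposite to the one in `x r2t1`. -/
theorem isA2_r3t1_r2 {N : ℕ} (h : IsB3 q a b c x) (hq : IsPrimitiveRoot q N)
    (hN1 : 1 < N) (hc : x r3t1 ^ N * x r2 = (b ^ 2 / a) ^ N • (x r2 * x r3t1 ^ N)) :
    IsA2 (q ^ 2) (b ^ 2 / a) N (x r3t1) (x r2)
      ((b / a) • (x r32 * x r31 - (q * a * c) • (x r31 * x r32))) where
  def_e := by
    obtain ⟨hq, ha, hb, hc, hq2⟩ := h.ne_zero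
    rw [h.comm_3321_2]
    match_scalars <;> field_simp
  comm_y := by
    rw [smul_mul_assoc, h.comm_f_2, mul_smul_comm, smul_smul, smul_smul]
    congr 1
    obtain ⟨hq, ha, hb, hc, hq2⟩ := h.ne_zero
    field_simp
  comm_f := by
    rcases eq_or_ne N 3 with rfl | h3
    · exact .inr ⟨rfl, hc⟩
    · left
      have e1 := h.comm_3321_32 (one_add_add_sq_ne_zero hq hN1 h3)
      have e2 := h.comm_3321_31
      have e3 := qcomm_right e1 e2
        (add_sub_cancel ((q * a * c) • (x r31 * x r32)) (x r32 * x r31)).symm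
      obtain ⟨hq, ha, hb, hc, hq2⟩ := h.ne_zero
      rw [mul_smul_comm, e3, smul_mul_assoc, smul_smul, smul_smul]
      congr 1
      field_simp

/-- The pair of the opposite root vector of `α₃~₂` and of `x r21`. -/
theorem isA2_opposite_r3t2_r21 {N : ℕ} (h : IsB3 q a b c x) (hq : IsPrimitiveRoot q N)
    (hN1 : 1 < N) (hc : oppositeR3t2 q b x ^ N * x r21 =
      (q ^ 2 * a * b ^ 2 * c ^ 2) ^ N • (x r21 * oppositeR3t2 q b x ^ N)) :
    IsA2 (q ^ 2) (q ^ 2 * a * b ^ 2 * c ^ 2) N (oppositeR3t2 q b x) (x r21) (x r2t1) where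
  def_e := h.opposite_r3t2_r21
  comm_y := by
    convert h.comm_221_21 using 2; ring
  comm_f := by
    rcases eq_or_ne N 3 with rfl | h3
    · exact .inr ⟨rfl, hc⟩
    · left
      convert h.comm_opposite_r3t2_r2t1 (one_add_add_sq_ne_zero hq hN1 h3) using 2
      ring

theorem isB2_r3_r2 (h : IsB3 q a b c x) : IsB2 q b (x r3) (x r2) (x r32) (x r3t2) where
  def_E := h.d32
  def_G := h.d332
  X_G := h.s3332
  E_Y := h.s322

theorem isB2_r3_r21 (h : IsB3 q a b c x) : IsB2 q (b * c) (x r3) (x r21) (x r31) (x r3t1) where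
  def_E := h.d31
  def_G := by convert h.d3321 using 3; ring
  X_G := by convert h.comm_3_3321 using 2; ring
  E_Y := by convert h.comm_31_21 using 2; ring

theorem isB2_r32_r1 (h : IsB3 q a b c x) : IsB2 q (a * c) (x r32) (x r1) (x r31)
    (x r32 * x r31 - (q * a * c) • (x r31 * x r32)) where
  def_E := h.d31_of_r32
  def_G := by rw [← mul_assoc q a c, add_sub_cancel]
  X_G := by convert h.comm_32_f using 2; ring
  E_Y := by convert h.comm_31_1 using 2; ring

end IsB3

end TypeB3

/-! ### Sums of braided triples of type `B₃` -/

section TypeB3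

open PosRoot

variable {k S : Type*} [Field k] [Ring S] [Algebra k S]

/-- The braiding matrix of type `B₃` with the parameters of `IsB3`. -/
def braidMatrix (q a b c : k) : Matrix (Fin 3) (Fin 3) k :=
  !![q ^ 2, (q ^ 2 * a)⁻¹, c⁻¹; a, q ^ 2, (q ^ 2 * b)⁻¹; c, b, q]

/-- The value of the bicharacter with matrix `braidMatrix q a b c` at two positive roots. -/
def braidScalar (q a b c : k) (β γ : PosRoot) : k :=
  ∏ i, ∏ j, braidMatrix q a b c i j ^ (β.coeff i * γ.coeff j)

/-- Two systems `x` and `y` of root vectors of type `B₃`, the second braided past the first one,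
and the system `z` of root vectors generated by the sums `x i + y i`. -/
structure B3Double (q a b c : k) (x y z : PosRoot → S) : Prop where
  h : IsB3 q a b c x
  h' : IsB3 q a b c y
  hz : IsB3 q a b c z
  braid : ∀ β γ, y β * x γ = braidScalar q a b c β γ • (x γ * y β)
  z1 : z r1 = x r1 + y r1
  z2 : z r2 = x r2 + y r2
  z3 : z r3 = x r3 + y r3

namespace B3Double

variable {q a b c : k} {x y z : PosRoot → S} (D : B3Double q a b c x y z)
include D

theorem ne_zero : q ≠ 0 ∧ a ≠ 0 ∧ b ≠ 0 ∧ c ≠ 0 ∧ 1 + q ^ 2 ≠ 0 := D.h.ne_zero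

theorem braid_eq (β γ : PosRoot) {s : k}
    (hs : q ≠ 0 → a ≠ 0 → b ≠ 0 → c ≠ 0 → braidScalar q a b c β γ = s) :
    y β * x γ = s • (x γ * y β) := by
  obtain ⟨hq, ha, hb, hc, -⟩ := D.ne_zero
  rw [D.braid, hs hq ha hb hc]

theorem br_1_1 : y r1 * x r1 = (q^2) • (x r1 * y r1) := D.braid_eq r1 r1 <| by
  intro hq ha hb hc
  simp [braidScalar, braidMatrix, coeff, Fin.prod_univ_three]
  try field_simp

theorem br_1_2 : y r1 * x r2 = (1/(q^2*a)) • (x r2 * y r1) := D.braid_eq r1 r2 <| by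
  intro hq ha hb hc
  simp [braidScalar, braidMatrix, coeff, Fin.prod_univ_three]
  try field_simp

theorem br_1_3 : y r1 * x r3 = (1/(c)) • (x r3 * y r1) := D.braid_eq r1 r3 <| by
  intro hq ha hb hc
  simp [braidScalar, braidMatrix, coeff, Fin.prod_univ_three]
  try field_simp

theorem br_2_1 : y r2 * x r1 = (a) • (x r1 * y r2) := D.braid_eq r2 r1 <| by
  intro hq ha hb hc
  simp [braidScalar, braidMatrix, coeff, Fin.prod_univ_three]
  try field_simp

theorem br_2_2 : y r2 * x r2 = (q^2) • (x r2 * y r2) := D.braid_eq r2 r2 <| by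
  intro hq ha hb hc
  simp [braidScalar, braidMatrix, coeff, Fin.prod_univ_three]
  try field_simp

theorem br_2_3 : y r2 * x r3 = (1/(q^2*b)) • (x r3 * y r2) := D.braid_eq r2 r3 <| by
  intro hq ha hb hc
  simp [braidScalar, braidMatrix, coeff, Fin.prod_univ_three]
  try field_simp

theorem br_3_2 : y r3 * x r2 = (b) • (x r2 * y r3) := D.braid_eq r3 r2 <| by
  intro hq ha hb hc
  simp [braidScalar, braidMatrix, coeff, Fin.prod_univ_three]
  try field_simp

theorem br_3_3 : y r3 * x r3 = (q) • (x r3 * y r3) := D.braid_eq r3 r3 <| by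
  intro hq ha hb hc
  simp [braidScalar, braidMatrix, coeff, Fin.prod_univ_three]
  try field_simp

theorem br_1_32 : y r1 * x r32 = (1/(q^2*a*c)) • (x r32 * y r1) := D.braid_eq r1 r32 <| by
  intro hq ha hb hc
  simp [braidScalar, braidMatrix, coeff, Fin.prod_univ_three]
  try field_simp

theorem br_21_2 : y r21 * x r2 = (1/(a)) • (x r2 * y r21) := D.braid_eq r21 r2 <| by
  intro hq ha hb hc
  simp [braidScalar, braidMatrix, coeff, Fin.prod_univ_three]
  try field_simp

theorem br_21_3 : y r21 * x r3 = (1/(q^2*b*c)) • (x r3 * y r21) := D.braid_eq r21 r3 <| by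
  intro hq ha hb hc
  simp [braidScalar, braidMatrix, coeff, Fin.prod_univ_three]
  try field_simp

theorem br_2_32 : y r2 * x r32 = (1/(b)) • (x r32 * y r2) := D.braid_eq r2 r32 <| by
  intro hq ha hb hc
  simp [braidScalar, braidMatrix, coeff, Fin.prod_univ_three]
  try field_simp

theorem br_31_2 : y r31 * x r2 = (b/(a)) • (x r2 * y r31) := D.braid_eq r31 r2 <| by
  intro hq ha hb hc
  simp [braidScalar, braidMatrix, coeff, Fin.prod_univ_three]
  try field_simp

theorem br_3_21 : y r3 * x r21 = (b*c) • (x r21 * y r3) := D.braid_eq r3 r21 <| by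
  intro hq ha hb hc
  simp [braidScalar, braidMatrix, coeff, Fin.prod_univ_three]
  try field_simp

theorem br_1_332 : y r1 * x r3t2 = (1/(q^2*a*c^2)) • (x r3t2 * y r1) := D.braid_eq r1 r3t2 <| by
  intro hq ha hb hc
  simp [braidScalar, braidMatrix, coeff, Fin.prod_univ_three]
  try field_simp

theorem br_21_21 : y r21 * x r21 = (q^2) • (x r21 * y r21) := D.braid_eq r21 r21 <| by
  intro hq ha hb hc
  simp [braidScalar, braidMatrix, coeff, Fin.prod_univ_three]
  try field_simp

theorem br_21_32 : y r21 * x r32 = (1/(q^2*a*b*c)) • (x r32 * y r21) := D.braid_eq r21 r32 <| by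
  intro hq ha hb hc
  simp [braidScalar, braidMatrix, coeff, Fin.prod_univ_three]
  try field_simp

theorem br_221_2 : y r2t1 * x r2 = (q^2*b^2/(a)) • (x r2 * y r2t1) := D.braid_eq r2t1 r2 <| by
  intro hq ha hb hc
  simp [braidScalar, braidMatrix, coeff, Fin.prod_univ_three]
  try field_simp

theorem br_2_221 : y r2 * x r2t1 = (a/(b^2)) • (x r2t1 * y r2) := D.braid_eq r2 r2t1 <| by
  intro hq ha hb hc
  simp [braidScalar, braidMatrix, coeff, Fin.prod_univ_three]
  try field_simp

theorem br_2_332 : y r2 * x r3t2 = (1/(q^2*b^2)) • (x r3t2 * y r2) := D.braid_eq r2 r3t2 <| by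
  intro hq ha hb hc
  simp [braidScalar, braidMatrix, coeff, Fin.prod_univ_three]
  try field_simp

theorem br_21_332 : y r21 * x r3t2 = (1/(q^4*a*b^2*c^2)) • (x r3t2 * y r21) :=
  D.braid_eq r21 r3t2 <| by
  intro hq ha hb hc
  simp [braidScalar, braidMatrix, coeff, Fin.prod_univ_three]
  try field_simp

theorem br_2_3321 : y r2 * x r3t1 = (a/(q^2*b^2)) • (x r3t1 * y r2) := D.braid_eq r2 r3t1 <| by
  intro hq ha hb hc
  simp [braidScalar, braidMatrix, coeff, Fin.prod_univ_three]
  try field_simp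

theorem br_3321_2 : y r3t1 * x r2 = (b^2/(a)) • (x r2 * y r3t1) := D.braid_eq r3t1 r2 <| by
  intro hq ha hb hc
  simp [braidScalar, braidMatrix, coeff, Fin.prod_univ_three]
  try field_simp

/-- The system of root vectors generated by `x₁ + y₁`, `x₂`, `x₃`. -/
theorem isB3_addFirst : IsB3 q a b c (addFirst q b x (y r1)) :=
  D.h.addFirst D.br_1_1 (by simpa [one_div] using D.br_1_2) (by simpa [one_div] using D.br_1_3)

theorem b2_r3_r2 :
    B2Double q b (x r3) (x r2) (x r32) (x r3t2) (y r3) (y r2) (y r32) (y r3t2) where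
  h := D.h.isB2_r3_r2
  h' := D.h'.isB2_r3_r2
  XX := D.br_3_3
  XY := D.br_3_2
  YX := by simpa [one_div] using D.br_2_3
  YY := D.br_2_2

/-- The pair `x r32`, `x r1`, to the second generator of which `y r1` is added. -/
theorem b2_r32_r1 : B2Double q (a * c) (x r32) (x r1) (x r31)
    (x r32 * x r31 - (q * a * c) • (x r31 * x r32)) 0 (y r1) 0 0 where
  h := D.h.isB2_r32_r1
  h' := IsB2.zero_left _ _ _
  XX := by simp
  XY := by simp
  YX := by convert D.br_1_32 using 2; simp; ring
  YY := D.br_1_1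

/-- The pairs `α₃`, `α₂₁` of the triples `x₁ + y₁, x₂, x₃` and `y₁, y₂, y₃`; their sum is the pair
`z r3`, `z r21`. -/
theorem b2_r3_r21 : B2Double q (b * c) (x r3) (addFirst q b x (y r1) r21)
    (addFirst q b x (y r1) r31) (addFirst q b x (y r1) r3t1) (y r3) (y r21) (y r31) (y r3t1) where
  h := D.isB3_addFirst.isB2_r3_r21
  h' := D.h'.isB2_r3_r21
  XX := D.br_3_3
  XY := by
    obtain ⟨hq, ha, hb, hc, -⟩ := D.ne_zero
    simp only [addFirst]
    linear_combination (norm := skip) D.br_3_21 + (1 - (q ^ 2)⁻¹) • D.br_3_2 * y r1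
      + ((1 - (q ^ 2)⁻¹) * b) • x r2 * D.h'.r13
    simp only [mul_add, add_mul, mul_sub, sub_mul, smul_mul_assoc, mul_smul_comm, mul_assoc,
      smul_add, smul_sub, smul_smul, neg_mul, mul_neg]
    match_scalars <;> field_simp <;> ring
  YX := by
    obtain ⟨hq, ha, hb, hc, -⟩ := D.ne_zero
    rw [D.br_21_3]
    congr 1
    field_simp
  YY := by
    obtain ⟨hq, ha, hb, hc, -⟩ := D.ne_zero
    simp only [addFirst]
    linear_combination (norm := skip) D.br_21_21 + (1 - (q ^ 2)⁻¹) • D.br_21_2 * y r1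
      + ((1 - (q ^ 2)⁻¹) * a⁻¹) • x r2 * D.h'.s211
    simp only [mul_add, add_mul, mul_sub, sub_mul, smul_mul_assoc, mul_smul_comm, mul_assoc,
      smul_add, smul_sub, smul_smul, neg_mul, mul_neg]
    match_scalars <;> field_simp <;> ring

theorem z21 : z r21 = addFirst q b x (y r1) r21 + y r21 := by
  obtain ⟨hq, ha, hb, hc, -⟩ := D.ne_zero
  have h1 := D.hz.d21
  rw [D.z1, D.z2] at h1
  simp only [addFirst]
  linear_combination (norm := skip) D.h.d21 + D.h'.d21 - h1 + D.br_2_1 - a • D.br_1_2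
  simp only [mul_add, add_mul, mul_sub, sub_mul, smul_mul_assoc, mul_smul_comm, mul_assoc,
    smul_add, smul_sub, smul_smul, neg_mul, mul_neg]
  match_scalars <;> field_simp <;> ring

theorem z32 : z r32 = x r32 + (1 - (q ^ 2)⁻¹) • (x r3 * y r2) + y r32 := by
  obtain ⟨hq, ha, hb, hc, -⟩ := D.ne_zero
  have h1 := D.hz.d32
  rw [D.z3, D.z2, D.b2_r3_r2.add_E hq hb] at h1
  exact (add_left_cancel h1).symm

theorem z3t2 : z r3t2 = (x r3t2 + ((1 - q⁻¹) * (1 - (q ^ 2)⁻¹)) • (x r3 * x r3 * y r2)) +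
    (q * (1 - (q ^ 2)⁻¹)) • (x r3 * y r32) + y r3t2 := by
  obtain ⟨hq, ha, hb, hc, -⟩ := D.ne_zero
  have h1 := D.hz.d332
  rw [D.z32, D.z3, D.b2_r3_r2.add_G hq hb] at h1
  exact (add_left_cancel h1).symm

theorem z31 : z r31 = addFirst q b x (y r1) r31 + (1 - (q ^ 2)⁻¹) • (x r3 * y r21) + y r31 := by
  obtain ⟨hq, ha, hb, hc, -⟩ := D.ne_zero
  have h1 := D.hz.d31
  rw [D.z3, D.z21, D.b2_r3_r21.add_E hq (mul_ne_zero hb hc)] at h1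
  exact (add_left_cancel h1).symm

theorem z3t1 : z r3t1 = (addFirst q b x (y r1) r3t1 +
      ((1 - q⁻¹) * (1 - (q ^ 2)⁻¹)) • (x r3 * x r3 * y r21)) +
    (q * (1 - (q ^ 2)⁻¹)) • (x r3 * y r31) + y r3t1 := by
  obtain ⟨hq, ha, hb, hc, -⟩ := D.ne_zero
  have h1 := D.hz.d3321
  rw [D.z31, D.z3, D.b2_r3_r21.add_G hq (mul_ne_zero hb hc), mul_assoc q b c] at h1
  exact (add_left_cancel h1).symm

/-- The skew commutator of `z r2` with the first of the three summands of `z r3t1`; the next two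
lemmas treat the other summands. -/
theorem bracket_z2_left : (x r2 + y r2) * (addFirst q b x (y r1) r3t1 +
      ((1 - q⁻¹) * (1 - (q ^ 2)⁻¹)) • (x r3 * x r3 * y r21)) =
    (a / (q ^ 2 * b ^ 2)) • ((addFirst q b x (y r1) r3t1 +
      ((1 - q⁻¹) * (1 - (q ^ 2)⁻¹)) • (x r3 * x r3 * y r21)) * (x r2 + y r2)) +
    (addFirst q b x (y r1) r2t1 + (1 - (q ^ 2)⁻¹) • (oppositeR3t2 q b x * y r21)) := by
  obtain ⟨hq, ha, hb, hc, -⟩ := D.ne_zero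
  simp only [addFirst, oppositeR3t2, oppositeR32]
  linear_combination (norm := skip) D.h.d221 + ((-1+q^2)*a*c^2) • D.br_21_332 +
    ((-1+q^2)*a^2*c^2/(q^2*b^2)) • (D.br_1_332 * y r2) + ((1-q^2)*a*c^2) • (y r2 * D.br_1_332)
    + ((-1+q^2)*a^2*c^2) • (y r1 * D.br_2_332) + ((1-q^2)/(q^4*b^2)) • (D.h.d332 * y r21) +
    ((-1+q^2)*a*c^2) • (D.h'.d21 * x r3t2) + ((-1+q+q^2-q^3)*a/(q^5*b^2)) • (x r3 * x r3 *
    D.br_21_2) + ((-1+q^2)/(q^3*b)) • (D.h.d32 * x r3 * y r21) + ((1-q^2)/(q^4*b^2)) • (x r3 *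
    D.h.d32 * y r21) + D.br_2_3321 + ((1-q-q^2+q^3)/(q^7*b^2)) • (x r3 * x r3 * D.h'.s221) +
    ((1-q-q^2+q^3)/(q^3)) • (D.br_2_3 * x r3 * y r21) + ((1-q-q^2+q^3)/(q^5*b)) • (x r3 *
    D.br_2_3 * y r21) + ((1-q^2)*a/(q^4*b^2)) • (x r3t2 * D.br_1_2)
  simp only [mul_add, add_mul, mul_sub, sub_mul, smul_mul_assoc, mul_smul_comm, mul_assoc,
    smul_add, smul_sub, smul_smul, neg_mul, mul_neg]
  match_scalars <;> field_simp <;> ring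

theorem bracket_z2_mid : (x r2 + y r2) * (q * (1 - (q ^ 2)⁻¹)) • (x r3 * y r31) =
    (a / (q ^ 2 * b ^ 2)) • ((q * (1 - (q ^ 2)⁻¹)) • (x r3 * y r31) * (x r2 + y r2)) +
    (q * (1 - (q ^ 2)⁻¹)) • (oppositeR32 q b x * y r31) := by
  obtain ⟨hq, ha, hb, hc, -⟩ := D.ne_zero
  simp only [oppositeR32]
  linear_combination (norm := skip) ((1-q^2)*a/(q^3*b^2)) • (x r3 * D.h'.comm_31_2) +
    ((-1+q^2)/(q)) • (D.br_2_3 * y r31) + ((1-q^2)*a/(q^3*b^2)) • (x r3 * D.br_31_2)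
  simp only [mul_add, add_mul, mul_sub, sub_mul, smul_mul_assoc, mul_smul_comm, mul_assoc,
    smul_add, smul_sub, smul_smul, neg_mul, mul_neg]
  match_scalars <;> field_simp <;> ring

theorem bracket_z2_right : (x r2 + y r2) * y r3t1 =
    (a / (q ^ 2 * b ^ 2)) • (y r3t1 * (x r2 + y r2)) +
    ((1 - (q ^ 2)⁻¹) • (x r2 * y r3t1) + y r2t1) := by
  obtain ⟨hq, ha, hb, hc, -⟩ := D.ne_zero
  linear_combination (norm := skip) (-a/(q^2*b^2)) • D.br_3321_2 + D.h'.d221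
  simp only [mul_add, add_mul, mul_sub, sub_mul, smul_mul_assoc, mul_smul_comm, mul_assoc,
    smul_add, smul_sub, smul_smul, neg_mul, mul_neg]
  match_scalars <;> field_simp <;> ring

/-- The skew derivation `[z r2, -]` has square zero on the first summand of `z r3t1`; the next two
lemmas treat the other summands. -/
theorem comm_z2_left : (x r2 + y r2) *
      (addFirst q b x (y r1) r2t1 + (1 - (q ^ 2)⁻¹) • (oppositeR3t2 q b x * y r21)) =
    (a / (q ^ 2 * b ^ 2) * q ^ 2) • ((addFirst q b x (y r1) r2t1 +
      (1 - (q ^ 2)⁻¹) • (oppositeR3t2 q b x * y r21)) * (x r2 + y r2)) := by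
  obtain ⟨hq, ha, hb, hc, -⟩ := D.ne_zero
  simp only [addFirst, oppositeR3t2, oppositeR32]
  linear_combination (norm := skip) D.h.comm_2_221 + ((1-q-q^2+q^3)/(q^5*b^2)) • (D.h.s322 *
    x r32 * y r1) + ((1-q-q^2+q^3)/(q^7*b^3)) • (x r32 * D.h.s322 * y r1) +
    ((1-q^2)*a/(q^2*b^2)) • (x r2 * x r3t2 * D.br_1_2) + ((-1+q^2)*a/(q^6*b^4)) • (x r3t2 * x
    r2 * D.br_1_2) + ((-1+q^2)/(q^8*b^4)) • (D.h.comm_332_2 * x r2 * y r1) +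
    ((1-q^2)/(q^4*b^2)) • (x r2 * D.h.comm_332_2 * y r1) + ((1-2*q^2+q^4)*a^2*c^2) •
    (D.br_21_2 * x r3t2) + ((-1+q+q^2-q^3)*a^2*c^2/(q*b)) • (D.br_21_32 * x r32) +
    ((-1+q+q^2-q^3)*a*c/(q^3*b^2)) • (x r32 * D.br_21_32) + ((1-2*q^2+q^4)*a*c^2) • (x r2 *
    D.br_21_332) + ((-1+2*q^2-q^4)/(q^6*b^4)) • (D.h.comm_332_2 * y r21) +
    ((-1+q^2)/(q^4*b^2)) • (D.h.s322 * x r3 * y r21) + ((1+q-2*q^2-q^3+q^4)/(q^6*b^4)) • (x r3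
    * D.h.s322 * y r21) + ((q^2-2*q^4+q^6)*a^3*c^2) • (D.br_1_2 * y r2 * x r3t2) +
    ((-1+2*q^2-q^4)*a^2*c^2) • (y r2 * D.br_1_2 * x r3t2) + ((-1+q+q^2-q^3)*a^3*c^2/(q*b^2)) •
    (D.br_1_32 * y r2 * x r32) + ((1-q-q^2+q^3)*a^2*c^2/(q*b)) • (y r2 * D.br_1_32 * x r32) +
    ((-1+q+q^2-q^3)*a^2*c/(q^3*b^3)) • (x r32 * D.br_1_32 * y r2) +
    ((1-q-q^2+q^3)*a*c/(q^3*b)) • (y r2 * x r32 * D.br_1_32) +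
    ((1-2*q^2+q^4)*a^2*c^2/(q^2*b^2)) • (x r2 * D.br_1_332 * y r2) +
    ((-1+2*q^2-q^4)*a*c^2/(q^2)) • (y r2 * x r2 * D.br_1_332) + ((-1+q^2)/(q^4)) • (D.br_2_2 *
    x r3t2 * y r1) + ((1-2*q^2+q^4)*a^3*c^2) • (y r1 * D.br_2_2 * x r3t2) +
    ((1-q^2)/(q^8*b^4)) • (x r3t2 * D.br_2_2 * y r1) + ((1-q-q^2+q^3)/(q^5*b)) • (D.br_2_32 *
    x r32 * y r1) + ((-1+q+q^2-q^3)*a^3*c^2/(q*b)) • (y r1 * D.br_2_32 * x r32) +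
    ((1-q-q^2+q^3)/(q^5*b^2)) • (x r32 * D.br_2_32 * y r1) + ((-1+q+q^2-q^3)*a^2*c/(q^3*b^2))
    • (x r32 * y r1 * D.br_2_32) + ((1-q^2)/(q^6*b^2)) • (D.br_2_332 * x r2 * y r1) +
    ((-1+q^2)/(q^2)) • (x r2 * D.br_2_332 * y r1) + ((1-2*q^2+q^4)*a^2*c^2) • (x r2 * y r1 *
    D.br_2_332) + ((1+q-2*q^2-q^3+q^4)/(q^4*b^3)) • (D.h.d32 * x r32 * y r21) +
    ((-1+q^2)/(q^4*b^3)) • (x r32 * D.h.d32 * y r21) + ((-1+2*q^2-q^4)/(q^6*b^4)) • (D.h.d332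
    * x r2 * y r21) + ((-1+q^2)*a/(q^6*b^4)) • (D.h.comm_332_2 * y r1 * y r2) +
    ((1-q^2)/(q^6*b^4)) • (D.h.comm_332_2 * y r2 * y r1) + ((1-2*q^2+q^4)*a^2*c^2) • (D.h'.d21
    * x r2 * x r3t2) + ((-1+q+q^2-q^3)*a^2*c^2/(q*b)) • (D.h'.d21 * x r32 * x r32) +
    ((1-q^2)*a/(q^2*b^2)) • (x r2 * x r3 * x r3 * D.br_21_2) + ((-1-q+q^2+q^3)*a/(q^4*b^3)) •
    (x r3 * x r2 * x r3 * D.br_21_2) + ((1-q^2)*a/(q^5*b^4)) • (x r3 * x r3 * x r2 *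
    D.br_21_2) + ((1-q-2*q^2+q^3+q^4)/(q^5*b^3)) • (D.h.d32 * x r3 * x r2 * y r21) +
    ((1-q^2)/(q^5*b^4)) • (x r3 * D.h.d32 * x r2 * y r21) + ((1-q^2)/(q^2*b)) • (x r2 *
    D.h.d32 * x r3 * y r21) + ((-1-q+2*q^2+q^3-q^4)/(q^4*b^2)) • (x r2 * x r3 * D.h.d32 * y
    r21) + D.br_2_221 + ((-1+q^2)/(q^4*b^2)) • (x r2 * x r3 * x r3 * D.h'.s221) +
    ((1+q-q^2-q^3)/(q^6*b^3)) • (x r3 * x r2 * x r3 * D.h'.s221) + ((-1+q^2)/(q^7*b^4)) • (x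
    r3 * x r3 * x r2 * D.h'.s221) + ((-1+q^2)/(q^2)) • (D.br_2_2 * x r3 * x r3 * y r21) +
    ((1+q-q^2-q^3)/(q^6*b^2)) • (x r3 * D.br_2_2 * x r3 * y r21) + ((-1+q^2)/(q^9*b^4)) • (x
    r3 * x r3 * D.br_2_2 * y r21) + ((1+q-q^2-q^3)/(q^4*b)) • (D.br_2_3 * x r2 * x r3 * y r21)
    + ((-1+q^2)/(q^5*b^2)) • (D.br_2_3 * x r3 * x r2 * y r21) + ((-1+q^2)/(q^7*b^3)) • (x r3 *
    D.br_2_3 * x r2 * y r21) + ((-1+q^2)) • (x r2 * D.br_2_3 * x r3 * y r21) +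
    ((-1+q^2)/(q^2*b)) • (x r2 * x r3 * D.br_2_3 * y r21) + ((1+q-q^2-q^3)/(q^4*b^2)) • (x r3
    * x r2 * D.br_2_3 * y r21)
  simp only [mul_add, add_mul, mul_sub, sub_mul, smul_mul_assoc, mul_smul_comm, mul_assoc,
    smul_add, smul_sub, smul_smul, neg_mul, mul_neg]
  match_scalars <;> field_simp <;> ring

theorem comm_z2_mid : (x r2 + y r2) * (q * (1 - (q ^ 2)⁻¹)) • (oppositeR32 q b x * y r31) =
    (a / (q ^ 2 * b ^ 2) * q ^ 2) •
      ((q * (1 - (q ^ 2)⁻¹)) • (oppositeR32 q b x * y r31) * (x r2 + y r2)) := by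
  obtain ⟨hq, ha, hb, hc, -⟩ := D.ne_zero
  simp only [oppositeR32]
  linear_combination (norm := skip) ((-1+q^2)/(q^3*b^2)) • (D.h.s322 * y r31) +
    ((1-q^2)*a/(q*b^2)) • (x r2 * x r3 * D.br_31_2) + ((-1+q^2)*a/(q^3*b^3)) • (x r3 * x r2 *
    D.br_31_2) + ((-1+q^2)/(q^3*b^2)) • (D.h.d32 * x r2 * y r31) + ((1-q^2)/(q*b)) • (x r2 *
    D.h.d32 * y r31) + ((1-q^2)*a/(q*b^2)) • (x r2 * x r3 * D.h'.comm_31_2) +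
    ((-1+q^2)*a/(q^3*b^3)) • (x r3 * x r2 * D.h'.comm_31_2) + ((-1+q^2)/(q)) • (D.br_2_2 * x
    r3 * y r31) + ((1-q^2)/(q^5*b^2)) • (x r3 * D.br_2_2 * y r31) + ((1-q^2)/(q^3*b)) •
    (D.br_2_3 * x r2 * y r31) + ((-q+q^3)) • (x r2 * D.br_2_3 * y r31)
  simp only [mul_add, add_mul, mul_sub, sub_mul, smul_mul_assoc, mul_smul_comm, mul_assoc,
    smul_add, smul_sub, smul_smul, neg_mul, mul_neg]
  match_scalars <;> field_simp <;> ring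

theorem comm_z2_right : (x r2 + y r2) * ((1 - (q ^ 2)⁻¹) • (x r2 * y r3t1) + y r2t1) =
    (a / (q ^ 2 * b ^ 2) * q ^ 2) •
      (((1 - (q ^ 2)⁻¹) • (x r2 * y r3t1) + y r2t1) * (x r2 + y r2)) := by
  obtain ⟨hq, ha, hb, hc, -⟩ := D.ne_zero
  linear_combination (norm := skip) ((1-q^2)*a/(q^2*b^2)) • (x r2 * D.br_3321_2) +
    (-a/(q^2*b^2)) • D.br_221_2 + ((-1+q^2)*a^2/(q^4*b^4)) • (y r3t1 * D.br_2_2) +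
    ((-1+q^2)*a^2/(q^2*b^4)) • (D.br_3321_2 * y r2) + ((1-q^2)*a/(q^2*b^2)) • (y r2 *
    D.br_3321_2) + ((-1+q^2)*a/(q^2*b^2)) • (D.h'.d221 * x r2) + D.h'.comm_2_221
  simp only [mul_add, add_mul, mul_sub, sub_mul, smul_mul_assoc, mul_smul_comm, mul_assoc,
    smul_add, smul_sub, smul_smul, neg_mul, mul_neg]
  match_scalars <;> field_simp <;> ring

theorem z2t1 : z r2t1 =
    (addFirst q b x (y r1) r2t1 + (1 - (q ^ 2)⁻¹) • (oppositeR3t2 q b x * y r21)) +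
    (q * (1 - (q ^ 2)⁻¹)) • (oppositeR32 q b x * y r31) +
    ((1 - (q ^ 2)⁻¹) • (x r2 * y r3t1) + y r2t1) := by
  have h1 := D.hz.d221
  rw [D.z3t1, D.z2, mul_add, mul_add, D.bracket_z2_left, D.bracket_z2_mid,
    D.bracket_z2_right] at h1
  simp only [add_mul, smul_add] at h1 ⊢
  linear_combination (norm := abel) -h1

end B3Double

end TypeB3

/-! ### Powers of the root vectors of a sum of triples -/

section TypeB3

open PosRoot

variable {k S : Type*} [Field k] [Ring S] [Algebra k S]

theorem pow_sum_range_eq_one {p : k} {N : ℕ} (hodd : Odd N) (hp : p ^ N = 1) :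
    p ^ (∑ i ∈ Finset.range N, i) = 1 := by
  obtain ⟨m, rfl⟩ := hodd
  rw [Finset.sum_range_id, Nat.add_sub_cancel, mul_left_comm, Nat.mul_div_cancel_left _ two_pos,
    pow_mul, hp, one_pow]

/-- The power of a product of skew-commuting elements, when the scalar that arises is trivial. -/
theorem mul_pow_of_qcomm_of_trivial {p : k} {N : ℕ} {A C : S} (hodd : Odd N)
    (h : C * A = p • (A * C)) (hp : A ^ N = 0 ∨ p ^ N = 1) : (A * C) ^ N = A ^ N * C ^ N := by
  rw [mul_pow_of_qcomm' h]
  rcases hp with hA | hp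
  · rw [hA, zero_mul, smul_zero]
  · rw [pow_sum_range_eq_one hodd hp, one_smul]

/-- The form in which `N`-th powers of braidings turn out to be trivial: `B` is a braiding with
trivial `N`-th power, and `s` its inverse up to a power of `q`. -/
theorem pow_eq_one_of_mul_eq_one {B q s : k} {N : ℕ} (m : ℕ) (hB : B ^ N = 1) (hq : q ^ N = 1)
    (h : B * (q ^ m * s) = 1) : s ^ N = 1 := by
  have := congrArg (· ^ N) h
  simpa [mul_pow, hB, ← pow_mul, mul_comm m N, pow_mul q N, hq] using this

/-- The `N`-th power of the root vector `x γ` commutes with all root vectors, and it vanishes unless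
the `N`-th powers of the scalars by which the other root vectors skew-commute with it are trivial.
This holds in the algebras below because the power is a combination of the elements `g ^ N - 1`. -/
structure PowerCentral (N : ℕ) (q a b c : k) (x : PosRoot → S) (γ : PosRoot) : Prop where
  eq_zero_or : x γ ^ N = 0 ∨ ∀ δ, braidScalar q a b c δ γ ^ N = 1
  comm : ∀ δ, x γ ^ N * x δ = x δ * x γ ^ N

namespace PowerCentral

variable {N : ℕ} {q a b c : k} {x : PosRoot → S} {γ : PosRoot}

theorem comm_smul (h : PowerCentral N q a b c x γ) (δ : PosRoot) {s : k}
    (hs : (∀ δ, braidScalar q a b c δ γ ^ N = 1) → s ^ N = 1) :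
    x γ ^ N * x δ = s ^ N • (x δ * x γ ^ N) := by
  rcases h.eq_zero_or with h0 | h1
  · simp [h0]
  · rw [hs h1, one_smul, h.comm]

end PowerCentral

namespace B3Double

variable {q a b c : k} {x y z : PosRoot → S} (D : B3Double q a b c x y z)
  {N : ℕ} (hq : IsPrimitiveRoot q N) (hN1 : 1 < N) (hodd : Odd N)
include D

theorem mul_pow (hodd : Odd N) {γ : PosRoot} (h : PowerCentral N q a b c x γ) (δ : PosRoot) :
    (x γ * y δ) ^ N = x γ ^ N * y δ ^ N :=
  mul_pow_of_qcomm_of_trivial hodd (D.braid δ γ) (h.eq_zero_or.imp_right fun h => h δ)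

theorem mul_self_mul_pow (hodd : Odd N) {γ : PosRoot} (h : PowerCentral N q a b c x γ)
    (δ : PosRoot) : (x γ * x γ * y δ) ^ N = x γ ^ N * x γ ^ N * y δ ^ N := by
  have h1 : y δ * (x γ * x γ) = (braidScalar q a b c δ γ * braidScalar q a b c δ γ) •
      (x γ * x γ * y δ) := by
    rw [← mul_assoc, D.braid, smul_mul_assoc, mul_assoc, D.braid, mul_smul_comm, smul_smul,
      mul_assoc]
  rw [mul_pow_of_qcomm_of_trivial hodd h1, (Commute.refl (x γ)).mul_pow]
  rcases h.eq_zero_or with h0 | h1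
  · simp [(Commute.refl (x γ)).mul_pow, h0]
  · right
    rw [_root_.mul_pow, h1, one_mul]

include hq hN1 hodd

theorem pow_z21 (h2 : PowerCentral N q a b c x r2) :
    z r21 ^ N = x r21 ^ N + (1 - (q ^ 2)⁻¹) ^ N • (x r2 ^ N * y r1 ^ N) + y r21 ^ N := by
  obtain ⟨hq0, ha, hb, hc, -⟩ := D.ne_zero
  have hp := hq.sq_of_odd hodd
  have hA : IsA2 (q ^ 2) a N (x r2) (x r1) (x r21) :=
    ⟨D.h.d21, by rw [D.h.s211, mul_comm a], .inl (by rw [D.h.s221, mul_comm a])⟩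
  have e1 := hA.add_pow hp hN1 (c := q ^ 2) (d := (q ^ 2 * a)⁻¹)
    (t := (1 - (q ^ 2)⁻¹) • y r1) (by field_simp)
    (by rw [smul_mul_assoc, D.br_1_2, mul_smul_comm, one_div, smul_comm])
    (by rw [smul_mul_assoc, D.br_1_1, mul_smul_comm, smul_comm])
  rw [D.z21, add_pow_of_qcomm hp hN1 D.b2_r3_r21.YY]
  simp only [addFirst]
  rw [← mul_smul_comm, e1, mul_smul_comm, smul_pow, D.mul_pow hodd h2]

theorem pow_z32 (h3 : PowerCentral N q a b c x r3) :
    z r32 ^ N = x r32 ^ N + (1 - (q ^ 2)⁻¹) ^ N • (x r3 ^ N * y r2 ^ N) + y r32 ^ N := by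
  obtain ⟨hq0, ha, hb, hc, -⟩ := D.ne_zero
  rw [D.z32, D.b2_r3_r2.pow_add_E hq hN1 hodd hb, smul_pow, D.mul_pow hodd h3]

/-- The factor `2` in the root vector relations comes from `add_add_pow_of_square`. -/
theorem xi_pow : (2 : k) / (1 + q) ^ N * (q * (1 - (q ^ 2)⁻¹)) ^ N = 2 * (1 - q⁻¹) ^ N := by
  obtain ⟨hq0, ha, hb, hc, -⟩ := D.ne_zero
  have hq1 := one_add_ne_zero_of_odd hq hN1 hodd
  have : q * (1 - (q ^ 2)⁻¹) = (1 + q) * (1 - q⁻¹) := by field_simp; ring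
  rw [this, _root_.mul_pow]
  field_simp

theorem pow_z3t2 (h3 : PowerCentral N q a b c x r3) :
    z r3t2 ^ N = x r3t2 ^ N +
      ((1 - q⁻¹) ^ N * (1 - (q ^ 2)⁻¹) ^ N) • (x r3 ^ N * x r3 ^ N * y r2 ^ N) +
      (2 * (1 - q⁻¹) ^ N) • (x r3 ^ N * y r32 ^ N) + y r3t2 ^ N := by
  obtain ⟨hq0, ha, hb, hc, -⟩ := D.ne_zero
  rw [D.z3t2, D.b2_r3_r2.pow_add_G hq hN1 hodd hb, smul_pow, smul_pow, D.mul_pow hodd h3,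
    D.mul_self_mul_pow hodd h3, smul_smul, D.xi_pow hq hN1 hodd, _root_.mul_pow]

theorem pow_z31 (h3 : PowerCentral N q a b c x r3) (h32 : PowerCentral N q a b c x r32) :
    z r31 ^ N = x r31 ^ N + (1 - (q ^ 2)⁻¹) ^ N • (x r32 ^ N * y r1 ^ N) +
      (1 - (q ^ 2)⁻¹) ^ N • (x r3 ^ N * y r21 ^ N) + y r31 ^ N := by
  obtain ⟨hq0, ha, hb, hc, -⟩ := D.ne_zero
  have e1 := D.b2_r32_r1.pow_add_E hq hN1 hodd (mul_ne_zero ha hc)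
  rw [zero_pow (by omega), add_zero, add_zero] at e1
  rw [D.z31, D.b2_r3_r21.pow_add_E hq hN1 hodd (mul_ne_zero hb hc)]
  simp only [addFirst]
  rw [e1, smul_pow, smul_pow, D.mul_pow hodd h3, D.mul_pow hodd h32]

/-- `x r3t1` and its deformation by `y r1`, by `IsA2.add_pow` for the pair `x r3t2`, `x r1`. -/
theorem pow_addFirst_r3t1 (h332 : PowerCentral N q a b c x r3t2) :
    addFirst q b x (y r1) r3t1 ^ N =
      x r3t1 ^ N + (1 - (q ^ 2)⁻¹) ^ N • (x r3t2 ^ N * y r1 ^ N) := by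
  obtain ⟨hq0, ha, hb, hc, -⟩ := D.ne_zero
  have hA := D.h.isA2_r3t2_r1 hq hN1 (h332.comm_smul r1 fun h =>
    pow_eq_one_of_mul_eq_one 2 (h r1) hq.pow_eq_one (by
      simp [braidScalar, braidMatrix, coeff, Fin.prod_univ_three]
      field_simp))
  have e1 := hA.add_pow (hq.sq_of_odd hodd) hN1 (c := q ^ 2) (d := (q ^ 2 * a * c ^ 2)⁻¹)
    (t := (1 - (q ^ 2)⁻¹) • y r1) (by field_simp)
    (by rw [smul_mul_assoc, D.br_1_332, mul_smul_comm, one_div, smul_comm])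
    (by rw [smul_mul_assoc, D.br_1_1, mul_smul_comm, smul_comm])
  simp only [addFirst]
  rw [← mul_smul_comm, e1, mul_smul_comm, smul_pow, D.mul_pow hodd h332]

theorem pow_z3t1 (h3 : PowerCentral N q a b c x r3) (h332 : PowerCentral N q a b c x r3t2) :
    z r3t1 ^ N = x r3t1 ^ N + (1 - (q ^ 2)⁻¹) ^ N • (x r3t2 ^ N * y r1 ^ N) +
      ((1 - q⁻¹) ^ N * (1 - (q ^ 2)⁻¹) ^ N) • (x r3 ^ N * x r3 ^ N * y r21 ^ N) +
      (2 * (1 - q⁻¹) ^ N) • (x r3 ^ N * y r31 ^ N) + y r3t1 ^ N := by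
  obtain ⟨hq0, ha, hb, hc, -⟩ := D.ne_zero
  rw [D.z3t1, D.b2_r3_r21.pow_add_G hq hN1 hodd (mul_ne_zero hb hc),
    D.pow_addFirst_r3t1 hq hN1 hodd h332, smul_pow, smul_pow, D.mul_pow hodd h3,
    D.mul_self_mul_pow hodd h3, smul_smul, D.xi_pow hq hN1 hodd, _root_.mul_pow]

/-- The third summand of `z2t1`. The element `x r2` stands on the left of `y r3t1`, so
`IsA2.add_pow` is applied in the opposite ring. -/
theorem add_pow_right (hq0 : q ≠ 0) (h2 : PowerCentral N q a b c y r3t1) :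
    ((1 - (q ^ 2)⁻¹) • (x r2 * y r3t1) + y r2t1) ^ N =
      ((1 - (q ^ 2)⁻¹) • (x r2 * y r3t1)) ^ N + y r2t1 ^ N := by
  obtain ⟨-, ha, hb, hc, -⟩ := D.ne_zero
  have hA : IsA2 (q ^ 2) (a / (q ^ 2 * b ^ 2)) N (MulOpposite.op (y r3t1)) (MulOpposite.op (y r2))
      (MulOpposite.op (y r2t1)) := by
    refine ⟨?_, ?_, ?_⟩
    · rw [← MulOpposite.op_mul, D.h'.d221]
      rfl
    · rw [← MulOpposite.op_mul, D.h'.comm_2_221, ← MulOpposite.op_mul, ← MulOpposite.op_smul]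
      congr 2
      field_simp
    · rcases eq_or_ne N 3 with rfl | h3
      · right
        refine ⟨rfl, ?_⟩
        rw [← MulOpposite.op_pow, ← MulOpposite.op_mul, ← MulOpposite.op_mul,
          ← MulOpposite.op_smul]
        congr 1
        rcases h2.eq_zero_or with h0 | h0
        · simp [h0]
        · have h1 : braidScalar q a b c r2 r3t1 = a / (q ^ 2 * b ^ 2) := by
            simp [braidScalar, braidMatrix, coeff, Fin.prod_univ_three]
            field_simp
          rw [← h2.comm, ← h1, h0, one_smul]
      · left
        rw [← MulOpposite.op_mul, D.h'.comm_221_3321 (one_add_add_sq_ne_zero hq hN1 h3),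
          ← MulOpposite.op_mul, ← MulOpposite.op_smul]
        congr 2
        field_simp
  have e1 := hA.add_pow (hq.sq_of_odd hodd) hN1 (c := q ^ 2) (d := b ^ 2 / a)
    (t := MulOpposite.op ((1 - (q ^ 2)⁻¹) • x r2)) (by field_simp)
    (by
      rw [← MulOpposite.op_mul, ← MulOpposite.op_mul, ← MulOpposite.op_smul, mul_smul_comm,
        D.br_3321_2, smul_mul_assoc, smul_comm])
    (by
      rw [← MulOpposite.op_mul, ← MulOpposite.op_mul, ← MulOpposite.op_smul, mul_smul_comm,
        D.br_2_2, smul_mul_assoc, smul_comm])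
  have e2 := congrArg MulOpposite.unop e1
  simp only [MulOpposite.unop_pow, MulOpposite.unop_add, MulOpposite.unop_mul,
    MulOpposite.unop_op, smul_mul_assoc] at e2
  rw [add_comm, e2, add_comm]

/-- `x r2t1` and its deformation by `y r1`. The identity `IsA2.pow_mul_pow` expresses the power of
`x r2t1` through powers of `x r2`, `x r3t1` and of the other root vector of this pair; it is applied
to the triples `x₁, x₂, x₃` and `x₁ + y₁, x₂, x₃`, and the results are subtracted. -/
theorem pow_addFirst_r2t1 (h2 : PowerCentral N q a b c x r2) (h32 : PowerCentral N q a b c x r32)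
    (h332 : PowerCentral N q a b c x r3t2) (h3321 : PowerCentral N q a b c x r3t1) :
    addFirst q b x (y r1) r2t1 ^ N = x r2t1 ^ N +
      ((1 - (q ^ 2)⁻¹) ^ N * (1 - (q ^ 2)⁻¹) ^ N) • (x r2 ^ N * (x r3t2 ^ N * y r1 ^ N)) -
      ((1 - q⁻¹) ^ N * (1 - (q ^ 2)⁻¹) ^ N) • (x r32 ^ N * x r32 ^ N * y r1 ^ N) := by
  obtain ⟨hq0, ha, hb, hc, -⟩ := D.ne_zero
  have hp := hq.sq_of_odd hodd
  have hc1 : x r3t1 ^ N * x r2 = (b ^ 2 / a) ^ N • (x r2 * x r3t1 ^ N) :=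
    h3321.comm_smul r2 fun h => pow_eq_one_of_mul_eq_one 2 (h r2) hq.pow_eq_one (by
      simp [braidScalar, braidMatrix, coeff, Fin.prod_univ_three]
      field_simp)
  have hs2 : x r2 ^ N = 0 ∨ (b ^ 2 / a) ^ N = 1 := by
    refine h2.eq_zero_or.imp_right fun h => ?_
    rw [← h r3t1]
    congr 1
    simp [braidScalar, braidMatrix, coeff, Fin.prod_univ_three]
    field_simp
  have e1 := (D.h.isA2_r3t1_r2 hq hN1 hc1).pow_mul_pow hp hN1 hodd
    (α := a / (q ^ 2 * b ^ 2)) (by field_simp)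
  have hc2 : addFirst q b x (y r1) r3t1 ^ N * x r2 =
      (b ^ 2 / a) ^ N • (x r2 * addFirst q b x (y r1) r3t1 ^ N) := by
    have h1 : x r3t2 ^ N * y r1 ^ N * x r2 =
        (b ^ 2 / a) ^ N • (x r2 * (x r3t2 ^ N * y r1 ^ N)) := by
      rcases h332.eq_zero_or with h0 | h0
      · simp [h0]
      · have hb2 : (b ^ 2) ^ N = 1 :=
          pow_eq_one_of_mul_eq_one 2 (h0 r2) hq.pow_eq_one (by
            simp [braidScalar, braidMatrix, coeff, Fin.prod_univ_three]
            field_simp)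
        rw [mul_assoc, pow_mul_of_qcomm D.br_1_2, mul_smul_comm, ← mul_assoc, h332.comm,
          mul_assoc, div_pow, div_pow, hb2, _root_.mul_pow, ← pow_mul, mul_comm 2 N, pow_mul,
          hq.pow_eq_one, one_pow, one_pow, one_mul]
    rw [D.pow_addFirst_r3t1 hq hN1 hodd h332]
    change (_ + _) * x r2 = _ • (x r2 * (_ + _))
    rw [add_mul, hc1, smul_mul_assoc, h1, mul_add, mul_smul_comm, smul_add, smul_comm]
  have e2 := (D.isB3_addFirst.isA2_r3t1_r2 hq hN1 hc2).pow_mul_pow hp hN1 hodd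
    (α := a / (q ^ 2 * b ^ 2)) (by field_simp)
  have hx : x r2 * x r3t1 - (a / (q ^ 2 * b ^ 2)) • (x r3t1 * x r2) = x r2t1 :=
    sub_eq_of_eq_add' D.h.d221
  have hX : addFirst q b x (y r1) r2 * addFirst q b x (y r1) r3t1 -
      (a / (q ^ 2 * b ^ 2)) • (addFirst q b x (y r1) r3t1 * addFirst q b x (y r1) r2) =
      addFirst q b x (y r1) r2t1 :=
    sub_eq_of_eq_add' D.isB3_addFirst.d221
  have hf : addFirst q b x (y r1) r32 * addFirst q b x (y r1) r31 -
      (q * a * c) • (addFirst q b x (y r1) r31 * addFirst q b x (y r1) r32) =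
      (x r32 * x r31 - (q * a * c) • (x r31 * x r32)) +
        ((1 - q⁻¹) * (1 - (q ^ 2)⁻¹)) • (x r32 * x r32 * y r1) := by
    have := D.b2_r32_r1.add_G hq0 (mul_ne_zero ha hc)
    simp only [add_zero, mul_zero, smul_zero] at this
    simp only [addFirst]
    rw [this, mul_assoc q a c, add_sub_cancel_left]
  have h32b : x r32 ^ N = 0 ∨ b ^ N = 1 := by
    refine h32.eq_zero_or.imp_right fun h => ?_
    have h1 := h r3
    simp only [braidScalar, braidMatrix, coeff, Fin.prod_univ_three] at h1
    simpa [_root_.mul_pow, hq.pow_eq_one] using h1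
  -- The scalar of `IsA2.pow_mul_pow` has no effect next to `x r2 ^ N`, and similarly for `hk`.
  have hs : ∀ (e : k) (w : S), ((b ^ 2 / a) ^ (N * (N - 1) / 2) * e) • (x r2 ^ N * w) =
      e • (x r2 ^ N * w) := by
    intro e w
    rcases hs2 with h0 | h0
    · simp [h0]
    · rw [← Finset.sum_range_id, pow_sum_range_eq_one hodd h0, one_mul]
  rw [hx, smul_pow, hs] at e1
  rw [hX, hf, smul_pow, D.b2_r32_r1.pow_add_G_left hq hN1 hodd (mul_ne_zero ha hc),
    D.pow_addFirst_r3t1 hq hN1 hodd h332, smul_pow, D.mul_self_mul_pow hodd h32] at e2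
  change (_ * _) • (x r2 ^ N * _) = _ at e2
  rw [hs, mul_add, smul_add, e1] at e2
  have hk : ∀ (e : k) (w : S), (a / (q ^ 2 * b ^ 2)) ^ N • (b / a) ^ N • e •
      (x r32 ^ N * x r32 ^ N * w) = e • (x r32 ^ N * x r32 ^ N * w) := by
    intro e w
    rcases h32b with h0 | h0
    · simp [h0]
    · have h1 : a / (q ^ 2 * b ^ 2) * (b / a) = (q ^ 2 * b)⁻¹ := by field_simp
      rw [smul_smul, ← _root_.mul_pow, h1, smul_smul, inv_pow, _root_.mul_pow, h0, ← pow_mul,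
        mul_comm 2 N, pow_mul, hq.pow_eq_one, one_pow, one_mul, inv_one, one_mul]
  rw [smul_add, smul_add, hk, _root_.mul_pow, mul_smul_comm] at e2
  linear_combination (norm := module) -e2

/-- The power of `z r2t1`. The relations between the three summands of `z r3t1` are carried over to
those of `z r2t1` by the skew derivation `[z r2, -]`, so that `add_add_pow_of_square` applies. -/
theorem pow_z2t1 (hx2 : PowerCentral N q a b c x r2) (hx32 : PowerCentral N q a b c x r32)
    (hx332 : PowerCentral N q a b c x r3t2) (hx3321 : PowerCentral N q a b c x r3t1)
    (hy3321 : PowerCentral N q a b c y r3t1)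
    (hZ : oppositeR32 q b x ^ N = 0 ∨ ∀ δ, braidScalar q a b c δ r32 ^ N = 1)
    (hW : oppositeR3t2 q b x ^ N = 0 ∨ ∀ δ, braidScalar q a b c δ r3t2 ^ N = 1)
    (hWc : ∀ δ, oppositeR3t2 q b x ^ N * x δ = x δ * oppositeR3t2 q b x ^ N) :
    z r2t1 ^ N = x r2t1 ^ N +
      ((1 - (q ^ 2)⁻¹) ^ N * (1 - (q ^ 2)⁻¹) ^ N) • (x r2 ^ N * (x r3t2 ^ N * y r1 ^ N)) -
      ((1 - q⁻¹) ^ N * (1 - (q ^ 2)⁻¹) ^ N) • (x r32 ^ N * x r32 ^ N * y r1 ^ N) +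
      (1 - (q ^ 2)⁻¹) ^ N • (oppositeR3t2 q b x ^ N * y r21 ^ N) +
      (2 * (1 - q⁻¹) ^ N) • (oppositeR32 q b x ^ N * y r31 ^ N) +
      (1 - (q ^ 2)⁻¹) ^ N • (x r2 ^ N * y r3t1 ^ N) + y r2t1 ^ N := by
  obtain ⟨hq0, ha, hb, hc, hq2⟩ := D.ne_zero
  have hp := hq.sq_of_odd hodd
  have hq1 := one_add_ne_zero_of_odd hq hN1 hodd
  have b21 := D.b2_r3_r21
  have hbc := mul_ne_zero hb hc
  have hs : a / (q ^ 2 * b ^ 2) ≠ 0 := by positivity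
  have hBA := qcomm_of_derivation hq0 hs hq2 D.bracket_z2_left D.bracket_z2_mid D.comm_z2_left
    D.comm_z2_mid (b21.sum_G_BA hq0 hbc)
  have hCB := qcomm_of_derivation hq0 hs hq2 D.bracket_z2_mid D.bracket_z2_right D.comm_z2_mid
    D.comm_z2_right (b21.sum_G_CB hq0 hbc)
  have hCA := qcomm_add_sq_of_derivation hq0 hs hq2 D.bracket_z2_left D.bracket_z2_mid
    D.bracket_z2_right D.comm_z2_left D.comm_z2_mid D.comm_z2_right (b21.sum_G_CA hq0 hbc hq1)
  have bZ : ∀ δ, y δ * oppositeR32 q b x =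
      braidScalar q a b c δ r32 • (oppositeR32 q b x * y δ) := by
    intro δ
    have h1 := qcomm_right (D.braid δ r2) (D.braid δ r3)
      (w := oppositeR32 q b x) (add_sub_cancel _ _).symm
    rw [h1]
    congr 1
    cases δ <;> simp [braidScalar, braidMatrix, coeff, Fin.prod_univ_three] <;> field_simp
  have bW : ∀ δ, y δ * oppositeR3t2 q b x =
      braidScalar q a b c δ r3t2 • (oppositeR3t2 q b x * y δ) := by
    intro δ
    have h1 := qcomm_right (bZ δ) (D.braid δ r3)
      (w := oppositeR3t2 q b x) (add_sub_cancel _ _).symm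
    rw [h1]
    congr 1
    cases δ <;> simp [braidScalar, braidMatrix, coeff, Fin.prod_univ_three] <;> field_simp
  have hWH : oppositeR3t2 q b x ^ N * addFirst q b x (y r1) r21 =
      (q ^ 2 * a * b ^ 2 * c ^ 2) ^ N • (addFirst q b x (y r1) r21 * oppositeR3t2 q b x ^ N) := by
    rcases hW with h0 | h0
    · simp [h0]
    · have h1 := mul_pow_of_qcomm (bW r1) N
      rw [h0, one_smul] at h1
      rw [pow_eq_one_of_mul_eq_one 2 (h0 r21) hq.pow_eq_one (by
        simp [braidScalar, braidMatrix, coeff, Fin.prod_univ_three]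
        field_simp), one_smul]
      simp only [addFirst]
      rw [mul_add, add_mul, hWc, mul_smul_comm, smul_mul_assoc, ← mul_assoc, hWc, mul_assoc, ← h1,
        mul_assoc]
  have hA := (D.isB3_addFirst.isA2_opposite_r3t2_r21 hq hN1 hWH).add_pow hp hN1
    (t := (1 - (q ^ 2)⁻¹) • y r21) (c := q ^ 2) (d := braidScalar q a b c r21 r3t2)
    (by
      simp [braidScalar, braidMatrix, coeff, Fin.prod_univ_three]
      field_simp)
    (by
      change _ * oppositeR3t2 q b x = _ • (oppositeR3t2 q b x * _)
      rw [smul_mul_assoc, bW, mul_smul_comm, smul_comm])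
    (by rw [smul_mul_assoc, b21.YY, mul_smul_comm, smul_comm])
  change (_ + oppositeR3t2 q b x * _) ^ N = _ + (oppositeR3t2 q b x * _) ^ N at hA
  rw [mul_smul_comm] at hA
  rw [D.z2t1, add_add_pow_of_square hq hN1 hodd hBA hCB hCA, hA,
    D.pow_addFirst_r2t1 hq hN1 hodd hx2 hx32 hx332 hx3321, D.add_pow_right hq hN1 hodd hq0 hy3321,
    smul_pow, smul_pow, smul_pow, D.mul_pow hodd hx2, smul_smul, D.xi_pow hq hN1 hodd,
    mul_pow_of_qcomm_of_trivial hodd (bZ r31) (hZ.imp_right fun h => h r31),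
    mul_pow_of_qcomm_of_trivial hodd (bW r21) (hW.imp_right fun h => h r21)]
  abel

end B3Double

end TypeB3

/-! ### Hopf structure maps on quotients of the free algebra -/

namespace DatumB3

open PosRoot MulOpposite

variable {k Γ : Type*} [Field k] [CommGroup Γ] (V : DatumB3 k Γ)

/-- The relations of `A(Γ, V, μ)` apart from the quantum Serre relations and the root vector
relations; they present the smash product of `kΓ` with the free algebra on `y₁, y₂, y₃`. -/
inductive BaseRel : Free k Γ → Free k Γ → Prop
  | group_one : BaseRel (fg k 1) 1
  | group_mul (h h' : Γ) : BaseRel (fg k (h * h')) (fg k h * fg k h')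
  | action (h : Γ) (i : Fin 3) :
      BaseRel (fg k h * fy k Γ (simple i) * fg k h⁻¹) ((V.χ i h : k) • fy k Γ (simple i))
  | root21 : BaseRel (fy k Γ r21) (V.bracket 1 r1)
  | root32 : BaseRel (fy k Γ r32) (V.bracket 2 r2)
  | root31 : BaseRel (fy k Γ r31) (V.bracket 2 r21)
  | root3t2 : BaseRel (fy k Γ r3t2) (V.bracket 2 r32)
  | root3t1 : BaseRel (fy k Γ r3t1) (V.bracket 2 r31)
  | root2t1 : BaseRel (fy k Γ r2t1) (V.bracket 1 r3t1)

section Realization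

variable {A : Type*} [Ring A] [Algebra k A]

/-- A quotient `π` of the free algebra in which the relations `BaseRel` hold. -/
structure IsRealization (π : Free k Γ →ₐ[k] A) : Prop where
  surjective : Function.Surjective π
  base : ∀ a b, V.BaseRel a b → π a = π b

variable {V} {π : Free k Γ →ₐ[k] A}

namespace IsRealization

lemma fg_one (H : V.IsRealization π) : π (fg k 1) = 1 := by
  rw [H.base _ _ .group_one, map_one]

lemma fg_mul (H : V.IsRealization π) (h h' : Γ) : π (fg k (h * h')) = π (fg k h) * π (fg k h') := by
  rw [H.base _ _ (.group_mul h h'), map_mul]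

/-- The group `Γ` in a realization. -/
def grpHom (H : V.IsRealization π) : Γ →* A where
  toFun h := π (fg k h)
  map_one' := H.fg_one
  map_mul' := H.fg_mul

lemma fg_mul_inv (H : V.IsRealization π) (h : Γ) : π (fg k h) * π (fg k h⁻¹) = 1 := by
  rw [← H.fg_mul, mul_inv_cancel, H.fg_one]

lemma fg_inv_mul (H : V.IsRealization π) (h : Γ) : π (fg k h⁻¹) * π (fg k h) = 1 := by
  rw [← H.fg_mul, inv_mul_cancel, H.fg_one]

lemma fg_mul_simple (H : V.IsRealization π) (h : Γ) (i : Fin 3) :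
    π (fg k h) * π (fy k Γ (simple i)) =
      (V.χ i h : k) • (π (fy k Γ (simple i)) * π (fg k h)) := by
  have := H.base _ _ (.action h i)
  rw [map_mul, map_mul, map_smul] at this
  rw [← smul_mul_assoc, ← this, mul_assoc, H.fg_inv_mul, mul_one]

/-- A realization is generated by the group and the three simple root vectors. -/
lemma mem_of_generators (H : V.IsRealization π) (B : Subalgebra k A)
    (hg : ∀ h, π (fg k h) ∈ B) (hs : ∀ i, π (fy k Γ (simple i)) ∈ B) (a : A) : a ∈ B := by
  have h1 : π (fy k Γ r1) ∈ B := hs 0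
  have h2 : π (fy k Γ r2) ∈ B := hs 1
  have h3 : π (fy k Γ r3) ∈ B := hs 2
  have hb : ∀ i β, π (fy k Γ β) ∈ B → π (V.bracket i β) ∈ B := by
    intro i β hβ
    rw [bracket, map_sub, map_smul, map_mul, map_mul]
    exact B.sub_mem (B.mul_mem (hs i) hβ) (B.smul_mem (B.mul_mem hβ (hs i)) _)
  have h21 : π (fy k Γ r21) ∈ B := by rw [H.base _ _ .root21]; exact hb _ _ h1
  have h32 : π (fy k Γ r32) ∈ B := by rw [H.base _ _ .root32]; exact hb _ _ h2
  have h31 : π (fy k Γ r31) ∈ B := by rw [H.base _ _ .root31]; exact hb _ _ h21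
  have h3t2 : π (fy k Γ r3t2) ∈ B := by rw [H.base _ _ .root3t2]; exact hb _ _ h32
  have h3t1 : π (fy k Γ r3t1) ∈ B := by rw [H.base _ _ .root3t1]; exact hb _ _ h31
  have h2t1 : π (fy k Γ r2t1) ∈ B := by rw [H.base _ _ .root2t1]; exact hb _ _ h3t1
  obtain ⟨f, rfl⟩ := H.surjective a
  induction f using FreeAlgebra.induction with
  | grade0 r => rw [AlgHom.commutes]; exact B.algebraMap_mem r
  | grade1 x =>
    rcases x with h | β
    · exact hg h
    · cases β <;> assumption
  | mul a b ha hb => rw [map_mul]; exact B.mul_mem ha hb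
  | add a b ha hb => rw [map_add]; exact B.add_mem ha hb

lemma algHom_ext (H : V.IsRealization π) {B : Type*} [Semiring B] [Algebra k B] {f f' : A →ₐ[k] B}
    (hg : ∀ h, f (π (fg k h)) = f' (π (fg k h)))
    (hs : ∀ i, f (π (fy k Γ (simple i))) = f' (π (fy k Γ (simple i)))) : f = f' :=
  AlgHom.ext fun a => H.mem_of_generators (AlgHom.equalizer f f') hg hs a

end IsRealization

variable (V) in
/-- The structure maps of a Hopf algebra on a realization, with the prescribed values on the
generators. The Hopf algebra axioms follow, see `HopfData.toHopfAlgebra`. -/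
structure HopfData (π : Free k Γ →ₐ[k] A) extends V.IsRealization π where
  comul : A →ₐ[k] A ⊗[k] A
  counit : A →ₐ[k] k
  antipode : A →ₐ[k] Aᵐᵒᵖ
  comul_grp : ∀ h, comul (π (fg k h)) = π (fg k h) ⊗ₜ[k] π (fg k h)
  comul_simple : ∀ i, comul (π (fy k Γ (simple i))) =
    π (fy k Γ (simple i)) ⊗ₜ[k] 1 + π (fg k (V.g i)) ⊗ₜ[k] π (fy k Γ (simple i))
  counit_grp : ∀ h, counit (π (fg k h)) = 1
  counit_simple : ∀ i, counit (π (fy k Γ (simple i))) = 0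
  antipode_grp : ∀ h, antipode (π (fg k h)) = op (π (fg k h⁻¹))
  antipode_simple : ∀ i, antipode (π (fy k Γ (simple i))) =
    op (-(π (fg k (V.g i)⁻¹) * π (fy k Γ (simple i))))

namespace HopfData

/-- The antipode as a linear endomorphism. -/
def antipodeLinear (D : V.HopfData π) : A →ₗ[k] A :=
  (opLinearEquiv k).symm.toLinearMap ∘ₗ D.antipode.toLinearMap

lemma antipodeLinear_apply (D : V.HopfData π) (a : A) :
    D.antipodeLinear a = unop (D.antipode a) := rfl

lemma antipodeLinear_mul (D : V.HopfData π) (a b : A) :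
    D.antipodeLinear (a * b) = D.antipodeLinear b * D.antipodeLinear a := by
  simp [antipodeLinear_apply]

lemma coassoc (D : V.HopfData π) :
    (Algebra.TensorProduct.assoc k k k A A A).toAlgHom.comp
      ((Algebra.TensorProduct.map D.comul (.id k A)).comp D.comul) =
    (Algebra.TensorProduct.map (.id k A) D.comul).comp D.comul := by
  apply D.toIsRealization.algHom_ext
  · intro h
    simp [D.comul_grp]
  · intro i
    simp [D.comul_grp, D.comul_simple, TensorProduct.add_tmul, TensorProduct.tmul_add,
      Algebra.TensorProduct.one_def, add_assoc]

lemma rTensor_counit (D : V.HopfData π) :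
    (Algebra.TensorProduct.map D.counit (.id k A)).comp D.comul =
      (Algebra.TensorProduct.lid k A).symm := by
  apply D.toIsRealization.algHom_ext
  · intro h
    simp [D.comul_grp, D.counit_grp]
  · intro i
    simp [D.comul_grp, D.comul_simple, D.counit_grp, D.counit_simple]

lemma lTensor_counit (D : V.HopfData π) :
    (Algebra.TensorProduct.map (.id k A) D.counit).comp D.comul =
      (Algebra.TensorProduct.rid k k A).symm := by
  apply D.toIsRealization.algHom_ext
  · intro h
    simp [D.comul_grp, D.counit_grp]
  · intro i
    simp [D.comul_grp, D.comul_simple, D.counit_grp, D.counit_simple]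

/-- The convolution `S * id`, evaluated on a tensor. -/
def mulAntipodeLeft (D : V.HopfData π) : A ⊗[k] A →ₗ[k] A :=
  LinearMap.mul' k A ∘ₗ D.antipodeLinear.rTensor A

/-- The convolution `id * S`, evaluated on a tensor. -/
def mulAntipodeRight (D : V.HopfData π) : A ⊗[k] A →ₗ[k] A :=
  LinearMap.mul' k A ∘ₗ D.antipodeLinear.lTensor A

@[simp] lemma mulAntipodeLeft_tmul (D : V.HopfData π) (a b : A) :
    D.mulAntipodeLeft (a ⊗ₜ b) = D.antipodeLinear a * b := rfl

@[simp] lemma mulAntipodeRight_tmul (D : V.HopfData π) (a b : A) :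
    D.mulAntipodeRight (a ⊗ₜ b) = a * D.antipodeLinear b := rfl

lemma mulAntipodeLeft_mul_tmul (D : V.HopfData π) (t : A ⊗[k] A) (x y : A) :
    D.mulAntipodeLeft (t * x ⊗ₜ y) = D.antipodeLinear x * D.mulAntipodeLeft t * y := by
  induction t with
  | zero => simp
  | tmul a b => simp [antipodeLinear_mul, mul_assoc]
  | add s t hs ht => rw [add_mul, map_add, hs, ht, map_add, mul_add, add_mul]

lemma mulAntipodeRight_tmul_mul (D : V.HopfData π) (t : A ⊗[k] A) (x y : A) :
    D.mulAntipodeRight (x ⊗ₜ y * t) = x * D.mulAntipodeRight t * D.antipodeLinear y := by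
  induction t with
  | zero => simp
  | tmul a b => simp [antipodeLinear_mul, mul_assoc]
  | add s t hs ht => rw [mul_add, map_add, hs, ht, map_add, mul_add, add_mul]

lemma mulAntipodeLeft_mul (D : V.HopfData π) {s : A ⊗[k] A} {r : k}
    (h : D.mulAntipodeLeft s = algebraMap k A r) (t : A ⊗[k] A) :
    D.mulAntipodeLeft (s * t) = r • D.mulAntipodeLeft t := by
  induction t with
  | zero => simp
  | tmul a b =>
    rw [mulAntipodeLeft_mul_tmul, h, mulAntipodeLeft_tmul, ← Algebra.commutes, mul_assoc,
      Algebra.smul_def]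
  | add s t hs ht => rw [mul_add, map_add, hs, ht, map_add, smul_add]

lemma mulAntipodeRight_mul (D : V.HopfData π) {s : A ⊗[k] A} {r : k}
    (h : D.mulAntipodeRight s = algebraMap k A r) (t : A ⊗[k] A) :
    D.mulAntipodeRight (t * s) = r • D.mulAntipodeRight t := by
  induction t with
  | zero => simp
  | tmul a b =>
    rw [mulAntipodeRight_tmul_mul, h, mulAntipodeRight_tmul, ← Algebra.commutes, mul_assoc,
      Algebra.smul_def]
  | add s t hs ht => rw [add_mul, map_add, hs, ht, map_add, smul_add]

lemma mulAntipodeLeft_comul (D : V.HopfData π) (a : A) :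
    D.mulAntipodeLeft (D.comul a) = algebraMap k A (D.counit a) := by
  let B : Subalgebra k A :=
    { carrier := {a | D.mulAntipodeLeft (D.comul a) = algebraMap k A (D.counit a)}
      mul_mem' := by
        intro a b ha hb
        simp only [Set.mem_ofPred_eq] at ha hb ⊢
        rw [map_mul, D.mulAntipodeLeft_mul ha, hb, map_mul, map_mul, Algebra.smul_def]
      add_mem' := by
        intro a b ha hb
        simp only [Set.mem_ofPred_eq] at ha hb ⊢
        rw [map_add, map_add, ha, hb, map_add, map_add]
      algebraMap_mem' := by
        intro r
        simp [Algebra.TensorProduct.algebraMap_apply, antipodeLinear_apply] }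
  refine D.toIsRealization.mem_of_generators B (fun h => ?_) (fun i => ?_) a
  · change D.mulAntipodeLeft _ = _
    rw [D.comul_grp, mulAntipodeLeft_tmul, antipodeLinear_apply, D.antipode_grp, unop_op,
      D.toIsRealization.fg_inv_mul, D.counit_grp, map_one]
  · change D.mulAntipodeLeft _ = _
    rw [D.comul_simple, map_add, mulAntipodeLeft_tmul, mulAntipodeLeft_tmul, antipodeLinear_apply,
      antipodeLinear_apply, D.antipode_grp, D.antipode_simple, unop_op, D.counit_simple, map_zero,
      unop_op, mul_one, neg_add_cancel]

lemma mulAntipodeRight_comul (D : V.HopfData π) (a : A) :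
    D.mulAntipodeRight (D.comul a) = algebraMap k A (D.counit a) := by
  let B : Subalgebra k A :=
    { carrier := {a | D.mulAntipodeRight (D.comul a) = algebraMap k A (D.counit a)}
      mul_mem' := by
        intro a b ha hb
        simp only [Set.mem_ofPred_eq] at ha hb ⊢
        rw [map_mul, D.mulAntipodeRight_mul hb, ha, map_mul, map_mul, Algebra.smul_def,
          Algebra.commutes]
      add_mem' := by
        intro a b ha hb
        simp only [Set.mem_ofPred_eq] at ha hb ⊢
        rw [map_add, map_add, ha, hb, map_add, map_add]
      algebraMap_mem' := by
        intro r
        simp [Algebra.TensorProduct.algebraMap_apply, antipodeLinear_apply] }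
  refine D.toIsRealization.mem_of_generators B (fun h => ?_) (fun i => ?_) a
  · change D.mulAntipodeRight _ = _
    rw [D.comul_grp, mulAntipodeRight_tmul, antipodeLinear_apply, D.antipode_grp, unop_op,
      D.toIsRealization.fg_mul_inv, D.counit_grp, map_one]
  · change D.mulAntipodeRight _ = _
    rw [D.comul_simple, map_add, mulAntipodeRight_tmul, mulAntipodeRight_tmul,
      antipodeLinear_apply, antipodeLinear_apply, D.antipode_simple, unop_op,
      D.counit_simple, map_zero, map_one, unop_one, mul_one, mul_neg, ← mul_assoc,
      D.toIsRealization.fg_mul_inv, one_mul, add_neg_cancel]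

/-- The Hopf algebra attached to structure maps with the prescribed values on generators. -/
@[reducible] def toHopfAlgebra (D : V.HopfData π) : HopfAlgebra k A :=
  letI := Bialgebra.ofAlgHom D.comul D.counit D.coassoc D.rTensor_counit D.lTensor_counit
  { antipode := D.antipodeLinear
    mul_antipode_rTensor_comul := LinearMap.ext D.mulAntipodeLeft_comul
    mul_antipode_lTensor_comul := LinearMap.ext D.mulAntipodeRight_comul }

end HopfData

end Realization

end DatumB3

/-! ### Quotients by skew-primitive elements -/

namespace DatumB3

open PosRoot MulOpposite

variable {k Γ : Type*} [Field k] [CommGroup Γ] (V : DatumB3 k Γ)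

section Extension

variable {V} {R R' : Free k Γ → Free k Γ → Prop}

/-- The projection from a quotient of the free algebra to a quotient by more relations. -/
def ringQuotMap (hle : ∀ a b, R a b → R' a b) : RingQuot R →ₐ[k] RingQuot R' :=
  RingQuot.liftAlgHom k ⟨RingQuot.mkAlgHom k R', fun _ _ h => RingQuot.mkAlgHom_rel k (hle _ _ h)⟩

lemma ringQuotMap_mk (hle : ∀ a b, R a b → R' a b) (a : Free k Γ) :
    ringQuotMap hle (RingQuot.mkAlgHom k R a) = RingQuot.mkAlgHom k R' a :=
  RingQuot.liftAlgHom_mkAlgHom_apply k _ _ _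

namespace HopfData

variable {A : Type*} [Ring A] [Algebra k A] {π : Free k Γ →ₐ[k] A}

/-- `d` is `(g_h, 1)`-skew-primitive for some `h`. -/
def IsSkewPrimitive (D : V.HopfData π) (d : A) : Prop :=
  ∃ h, D.comul d = d ⊗ₜ[k] 1 + π (fg k h) ⊗ₜ[k] d

lemma IsSkewPrimitive.counit_eq_zero {D : V.HopfData π} {d : A} (hd : D.IsSkewPrimitive d) :
    D.counit d = 0 := by
  obtain ⟨h, hd⟩ := hd
  have h1 := congrArg (fun f : A →ₐ[k] k ⊗[k] A => Algebra.TensorProduct.lid k A (f d))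
    D.rTensor_counit
  simp only [AlgHom.comp_apply, hd, map_add, Algebra.TensorProduct.map_tmul, D.counit_grp,
    AlgHom.id_apply, Algebra.TensorProduct.lid_tmul, one_smul, AlgHom.coe_coe,
    AlgEquiv.apply_symm_apply, add_eq_right] at h1
  have h2 := congrArg D.counit h1
  simpa using h2

lemma IsSkewPrimitive.antipode_eq {D : V.HopfData π} {d : A} (hd : D.IsSkewPrimitive d) :
    ∃ h, D.antipode d = op (-(π (fg k h) * d)) := by
  have h0 := hd.counit_eq_zero
  obtain ⟨h, hd⟩ := hd
  refine ⟨h⁻¹, ?_⟩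
  have h1 := D.mulAntipodeLeft_comul d
  rw [hd, map_add, mulAntipodeLeft_tmul, mulAntipodeLeft_tmul, h0, map_zero, mul_one,
    D.antipodeLinear_apply, D.antipodeLinear_apply, D.antipode_grp, unop_op] at h1
  rw [← eq_neg_iff_add_eq_zero] at h1
  rw [← h1, op_unop]

/-- Hopf structure maps descend to the quotient by skew-primitive relations. -/
def extend (D : V.HopfData (RingQuot.mkAlgHom k R)) (hle : ∀ a b, R a b → R' a b)
    (hnew : ∀ a b, R' a b → R a b ∨
      D.IsSkewPrimitive (RingQuot.mkAlgHom k R a - RingQuot.mkAlgHom k R b)) :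
    V.HopfData (RingQuot.mkAlgHom k R') :=
  have hzero : ∀ a b, R' a b →
      ringQuotMap hle (RingQuot.mkAlgHom k R a - RingQuot.mkAlgHom k R b) = 0 := fun a b h => by
    rw [map_sub, ringQuotMap_mk, ringQuotMap_mk, RingQuot.mkAlgHom_rel k h, sub_self]
  { surjective := RingQuot.mkAlgHom_surjective k R'
    base := fun a b h => by
      rw [← ringQuotMap_mk hle, ← ringQuotMap_mk hle, D.base a b h]
    comul := RingQuot.liftAlgHom k
      ⟨((Algebra.TensorProduct.map (ringQuotMap hle) (ringQuotMap hle)).comp D.comul).comp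
        (RingQuot.mkAlgHom k R), by
        intro a b h
        rcases hnew a b h with h' | ⟨g, h'⟩
        · rw [AlgHom.comp_apply, AlgHom.comp_apply _ _ b, RingQuot.mkAlgHom_rel k h']
        · rw [← sub_eq_zero, ← map_sub, AlgHom.comp_apply, map_sub, AlgHom.comp_apply, h', map_add,
            Algebra.TensorProduct.map_tmul, Algebra.TensorProduct.map_tmul, hzero a b h]
          simp⟩
    counit := RingQuot.liftAlgHom k ⟨D.counit.comp (RingQuot.mkAlgHom k R), by
        intro a b h
        rcases hnew a b h with h' | h'
        · rw [AlgHom.comp_apply, AlgHom.comp_apply _ _ b, RingQuot.mkAlgHom_rel k h']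
        · rw [← sub_eq_zero, ← map_sub, AlgHom.comp_apply, map_sub, h'.counit_eq_zero]⟩
    antipode := RingQuot.liftAlgHom k
      ⟨((AlgHom.op (ringQuotMap hle)).comp D.antipode).comp (RingQuot.mkAlgHom k R), by
        intro a b h
        rcases hnew a b h with h' | h'
        · rw [AlgHom.comp_apply, AlgHom.comp_apply _ _ b, RingQuot.mkAlgHom_rel k h']
        · obtain ⟨g, h'⟩ := h'.antipode_eq
          rw [← sub_eq_zero, ← map_sub, AlgHom.comp_apply, map_sub, AlgHom.comp_apply, h',
            AlgHom.op_apply_apply, unop_op, map_neg, map_mul, hzero a b h, mul_zero, neg_zero,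
            op_zero]⟩
    comul_grp := fun h => by
      rw [RingQuot.liftAlgHom_mkAlgHom_apply]
      simp [D.comul_grp, ringQuotMap_mk]
    comul_simple := fun h => by
      rw [RingQuot.liftAlgHom_mkAlgHom_apply]
      simp [D.comul_simple, ringQuotMap_mk]
    counit_grp := fun h => by
      rw [RingQuot.liftAlgHom_mkAlgHom_apply]
      simp [D.counit_grp]
    counit_simple := fun h => by
      rw [RingQuot.liftAlgHom_mkAlgHom_apply]
      simp [D.counit_simple]
    antipode_grp := fun h => by
      rw [RingQuot.liftAlgHom_mkAlgHom_apply]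
      simp [D.antipode_grp, ringQuotMap_mk]
    antipode_simple := fun h => by
      rw [RingQuot.liftAlgHom_mkAlgHom_apply]
      simp [D.antipode_simple, ringQuotMap_mk] }

end HopfData

end Extension

section Base

variable {B : Type*} [Ring B] [Algebra k B]

/-- The nine root vectors built by braided commutators from three elements. -/
def rootVector (T : Fin 3 → B) : PosRoot → B :=
  let br (i : Fin 3) (β : PosRoot) (b : B) : B := T i * b - (V.χRoot β (V.g i) : k) • (b * T i)
  fun
  | r1 => T 0
  | r2 => T 1
  | r3 => T 2
  | r21 => br 1 r1 (T 0)
  | r32 => br 2 r2 (T 1)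
  | r31 => br 2 r21 (br 1 r1 (T 0))
  | r3t2 => br 2 r32 (br 2 r2 (T 1))
  | r3t1 => br 2 r31 (br 2 r21 (br 1 r1 (T 0)))
  | r2t1 => br 1 r3t1 (br 2 r31 (br 2 r21 (br 1 r1 (T 0))))

/-- The homomorphism from the algebra presented by `BaseRel` attached to images of the group and
of the simple root vectors. -/
def baseLift (E : Γ →* B) (T : Fin 3 → B)
    (hT : ∀ h i, E h * T i * E h⁻¹ = (V.χ i h : k) • T i) : RingQuot V.BaseRel →ₐ[k] B :=
  RingQuot.liftAlgHom k ⟨FreeAlgebra.lift k (Sum.elim E (V.rootVector T)), by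
    have hs : ∀ i, V.rootVector T (simple i) = T i := by
      intro i; fin_cases i <;> rfl
    intro a b h
    cases h
    case action h i => simp [fg, fy, hs, hT]
    all_goals simp [fg, fy, bracket, rootVector, simple]⟩

lemma baseLift_fg (E : Γ →* B) (T : Fin 3 → B)
    (hT : ∀ h i, E h * T i * E h⁻¹ = (V.χ i h : k) • T i) (h : Γ) :
    V.baseLift E T hT (RingQuot.mkAlgHom k V.BaseRel (fg k h)) = E h := by
  rw [baseLift, RingQuot.liftAlgHom_mkAlgHom_apply]
  simp [fg]

lemma baseLift_simple (E : Γ →* B) (T : Fin 3 → B)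
    (hT : ∀ h i, E h * T i * E h⁻¹ = (V.χ i h : k) • T i) (i : Fin 3) :
    V.baseLift E T hT (RingQuot.mkAlgHom k V.BaseRel (fy k Γ (simple i))) = T i := by
  rw [baseLift, RingQuot.liftAlgHom_mkAlgHom_apply]
  fin_cases i <;> simp [fy, simple, rootVector]

lemma isRealization_baseRel : V.IsRealization (RingQuot.mkAlgHom k V.BaseRel) where
  surjective := RingQuot.mkAlgHom_surjective k _
  base _ _ h := RingQuot.mkAlgHom_rel k h

variable {V} in
lemma IsRealization.antipode_action {A : Type*} [Ring A] [Algebra k A] {π : Free k Γ →ₐ[k] A}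
    (H : V.IsRealization π) (h : Γ) (i : Fin 3) :
    op (π (fg k h⁻¹)) * op (-(π (fg k (V.g i)⁻¹) * π (fy k Γ (simple i)))) * op (π (fg k h⁻¹⁻¹)) =
      (V.χ i h : k) • op (-(π (fg k (V.g i)⁻¹) * π (fy k Γ (simple i)))) := by
  rw [← op_mul, ← op_mul, ← op_smul, inv_inv]
  congr 1
  rw [← mul_assoc, mul_neg, neg_mul, smul_neg, ← mul_assoc (π (fg k h)), ← H.fg_mul, mul_comm h,
    H.fg_mul, mul_assoc (π (fg k (V.g i)⁻¹)), H.fg_mul_simple, mul_smul_comm, smul_mul_assoc,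
    mul_assoc, mul_assoc, H.fg_mul_inv, mul_one]

/-- The Hopf structure maps on the algebra presented by `BaseRel`. -/
def baseHopfData : V.HopfData (RingQuot.mkAlgHom k V.BaseRel) :=
  let π := RingQuot.mkAlgHom k V.BaseRel
  have H := V.isRealization_baseRel
  have hcomm : ∀ h h', π (fg k h) * π (fg k h') = π (fg k h') * π (fg k h) := fun h h' => by
    rw [← H.fg_mul, mul_comm, H.fg_mul]
  have hact : ∀ h i, π (fg k h) * π (fy k Γ (simple i)) * π (fg k h⁻¹) =
      (V.χ i h : k) • π (fy k Γ (simple i)) := fun h i => by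
    rw [H.fg_mul_simple, smul_mul_assoc, mul_assoc, H.fg_mul_inv, mul_one]
  let E₂ : Γ →* RingQuot V.BaseRel ⊗[k] RingQuot V.BaseRel :=
    { toFun := fun h => π (fg k h) ⊗ₜ π (fg k h)
      map_one' := by rw [H.fg_one]; rfl
      map_mul' := fun h h' => by rw [H.fg_mul, Algebra.TensorProduct.tmul_mul_tmul] }
  let Eop : Γ →* (RingQuot V.BaseRel)ᵐᵒᵖ :=
    { toFun := fun h => op (π (fg k h⁻¹))
      map_one' := by rw [inv_one, H.fg_one, op_one]
      map_mul' := fun h h' => by rw [← op_mul, ← H.fg_mul, mul_inv_rev] }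
  let T₂ : Fin 3 → RingQuot V.BaseRel ⊗[k] RingQuot V.BaseRel := fun i =>
    π (fy k Γ (simple i)) ⊗ₜ 1 + π (fg k (V.g i)) ⊗ₜ π (fy k Γ (simple i))
  let Top : Fin 3 → (RingQuot V.BaseRel)ᵐᵒᵖ := fun i =>
    op (-(π (fg k (V.g i)⁻¹) * π (fy k Γ (simple i))))
  { toIsRealization := H
    comul := V.baseLift E₂ T₂ fun h i => by
      change π (fg k h) ⊗ₜ π (fg k h) * (π (fy k Γ (simple i)) ⊗ₜ 1 +
          π (fg k (V.g i)) ⊗ₜ π (fy k Γ (simple i))) * (π (fg k h⁻¹) ⊗ₜ π (fg k h⁻¹)) =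
        (V.χ i h : k) • (π (fy k Γ (simple i)) ⊗ₜ 1 +
          π (fg k (V.g i)) ⊗ₜ π (fy k Γ (simple i)))
      rw [mul_add, add_mul, Algebra.TensorProduct.tmul_mul_tmul,
        Algebra.TensorProduct.tmul_mul_tmul, Algebra.TensorProduct.tmul_mul_tmul,
        Algebra.TensorProduct.tmul_mul_tmul, hact, mul_one, H.fg_mul_inv, hcomm h (V.g i),
        mul_assoc (π (fg k (V.g i))), H.fg_mul_inv, mul_one, smul_add, TensorProduct.smul_tmul',
        TensorProduct.tmul_smul]
    counit := V.baseLift 1 0 fun h i => by simp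
    antipode := V.baseLift Eop Top fun h i => by
      exact H.antipode_action h i
    comul_grp := fun h => V.baseLift_fg _ _ _ h
    comul_simple := fun i => V.baseLift_simple _ _ _ i
    counit_grp := fun h => V.baseLift_fg _ _ _ h
    counit_simple := fun i => V.baseLift_simple _ _ _ i
    antipode_grp := fun h => V.baseLift_fg _ _ _ h
    antipode_simple := fun i => V.baseLift_simple _ _ _ i }

end Base

end DatumB3

/-! ### Iterated braided commutators -/

section BraidedAdjoint

variable {k S : Type*} [Field k] [Ring S] [Algebra k S]

/-- The iterated braided commutator of `a` with `b`, where `s` is the braiding of `a` with `b` and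
`p` the braiding of `a` with itself. -/
def braidedAdPow (s p : k) (a b : S) : ℕ → S
  | 0 => b
  | m + 1 => a * braidedAdPow s p a b m - (s * p ^ m) • (braidedAdPow s p a b m * a)

lemma map_braidedAdPow {S' : Type*} [Ring S'] [Algebra k S'] (f : S →ₐ[k] S') (s p : k) (a b : S)
    (m : ℕ) : f (braidedAdPow s p a b m) = braidedAdPow s p (f a) (f b) m := by
  induction m with
  | zero => rfl
  | succ m ih => simp only [braidedAdPow, map_sub, map_mul, map_smul, ih]

lemma braidedAdPow_tmul {S' : Type*} [Ring S'] [Algebra k S'] (s p : k) {g h : S'}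
    (hgh : g * h = h * g) (a b : S) (m : ℕ) :
    braidedAdPow s p (g ⊗ₜ[k] a) (h ⊗ₜ[k] b) m = (g ^ m * h) ⊗ₜ[k] braidedAdPow s p a b m := by
  induction m with
  | zero => simp [braidedAdPow]
  | succ m ih =>
    have h1 : g ^ m * h * g = g * (g ^ m * h) := by
      rw [mul_assoc, ← hgh, ← mul_assoc, ← pow_succ, ← mul_assoc, ← pow_succ']
    simp only [braidedAdPow, ih, Algebra.TensorProduct.tmul_mul_tmul, h1, TensorProduct.tmul_sub,
      TensorProduct.tmul_smul, pow_succ', mul_assoc]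

lemma braidedAdPow_tmul_one {S' : Type*} [Ring S'] [Algebra k S'] (s p : k) (a b : S) (m : ℕ) :
    braidedAdPow s p (a ⊗ₜ[k] (1 : S')) (b ⊗ₜ[k] (1 : S')) m =
      braidedAdPow s p a b m ⊗ₜ[k] (1 : S') :=
  (map_braidedAdPow (Algebra.TensorProduct.includeLeft : S →ₐ[k] S ⊗[k] S') s p a b m).symm

/-- The iterated braided commutator is additive at the step where the Cartan condition
`s * s' * p ^ m = 1` holds: this makes the quantum Serre elements skew-primitive. -/
lemma braidedAdPow_add {s s' p : k} {X Y b c : S} (hYX : Y * X = p • (X * Y))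
    (hYb : Y * b = s • (b * Y)) (hcX : c * X = s' • (X * c)) {m : ℕ} (hm : m < 3)
    (hs : s * s' * p ^ m = 1) :
    braidedAdPow s p (X + Y) (b + c) (m + 1) =
      braidedAdPow s p X b (m + 1) + braidedAdPow s p Y c (m + 1) := by
  have hYX' : ∀ w, Y * (X * w) = p • (X * (Y * w)) := fun w => by
    rw [← mul_assoc, hYX, smul_mul_assoc, mul_assoc]
  have hYb' : ∀ w, Y * (b * w) = s • (b * (Y * w)) := fun w => by
    rw [← mul_assoc, hYb, smul_mul_assoc, mul_assoc]
  have hcX' : ∀ w, c * (X * w) = s' • (X * (c * w)) := fun w => by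
    rw [← mul_assoc, hcX, smul_mul_assoc, mul_assoc]
  interval_cases m
  all_goals
    simp only [braidedAdPow, mul_add, add_mul, mul_sub, sub_mul, smul_mul_assoc, mul_smul_comm,
      mul_assoc, smul_add, smul_sub, smul_smul, hYX, hYX', hYb, hYb', hcX, hcX']
    match_scalars <;> grind

end BraidedAdjoint

/-! ### Root vectors in a Hopf quotient and its tensor square -/

section MapB3

open PosRoot

variable {k S S' : Type*} [Field k] [Ring S] [Algebra k S] [Ring S'] [Algebra k S']
  {q a b c : k} {x : PosRoot → S}

theorem IsB3.map (h : IsB3 q a b c x) (f : S →ₐ[k] S') : IsB3 q a b c (fun β => f (x β)) where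
  ne_zero := h.ne_zero
  r13 := by simp only [← map_mul, ← map_smul, h.r13]
  d21 := by simp only [← map_mul, ← map_smul, ← map_add, h.d21]
  d32 := by simp only [← map_mul, ← map_smul, ← map_add, h.d32]
  d31 := by simp only [← map_mul, ← map_smul, ← map_add, h.d31]
  d332 := by simp only [← map_mul, ← map_smul, ← map_add, h.d332]
  d3321 := by simp only [← map_mul, ← map_smul, ← map_add, h.d3321]
  d221 := by simp only [← map_mul, ← map_smul, ← map_add, h.d221]
  s221 := by simp only [← map_mul, ← map_smul, h.s221]
  s211 := by simp only [← map_mul, ← map_smul, h.s211]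
  s3332 := by simp only [← map_mul, ← map_smul, h.s3332]
  s322 := by simp only [← map_mul, ← map_smul, h.s322]

/-- Tensoring with commuting elements that multiply as their degrees preserves the relations of
type `B₃`. -/
theorem IsB3.tmul_left (h : IsB3 q a b c x) {Γ : Type*} [CommGroup Γ] (E : Γ →* S')
    (g : Fin 3 → Γ) :
    IsB3 q a b c (fun β => E (∏ i, g i ^ β.coeff i) ⊗ₜ[k] x β) :=
  have hG : ∀ α β γ : PosRoot, (∀ i, α.coeff i + β.coeff i = γ.coeff i) →
      E (∏ i, g i ^ α.coeff i) * E (∏ i, g i ^ β.coeff i) = E (∏ i, g i ^ γ.coeff i) := by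
    intro α β γ h
    simp only [← map_mul, ← Finset.prod_mul_distrib, ← pow_add, h]
  have hc : ∀ α β : PosRoot, E (∏ i, g i ^ α.coeff i) * E (∏ i, g i ^ β.coeff i) =
      E (∏ i, g i ^ β.coeff i) * E (∏ i, g i ^ α.coeff i) := by
    intro α β
    rw [← map_mul, mul_comm, map_mul]
  { ne_zero := h.ne_zero
    r13 := by
      simp only [Algebra.TensorProduct.tmul_mul_tmul, hc r3 r1, h.r13, TensorProduct.tmul_smul]
    d21 := by
      simp only [Algebra.TensorProduct.tmul_mul_tmul, hG r2 r1 r21 (by decide),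
        hG r1 r2 r21 (by decide), h.d21, TensorProduct.tmul_smul, TensorProduct.tmul_add]
    d32 := by
      simp only [Algebra.TensorProduct.tmul_mul_tmul, hG r3 r2 r32 (by decide),
        hG r2 r3 r32 (by decide), h.d32, TensorProduct.tmul_smul, TensorProduct.tmul_add]
    d31 := by
      simp only [Algebra.TensorProduct.tmul_mul_tmul, hG r3 r21 r31 (by decide),
        hG r21 r3 r31 (by decide), h.d31, TensorProduct.tmul_smul, TensorProduct.tmul_add]
    d332 := by
      simp only [Algebra.TensorProduct.tmul_mul_tmul, hG r3 r32 r3t2 (by decide),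
        hG r32 r3 r3t2 (by decide), h.d332, TensorProduct.tmul_smul, TensorProduct.tmul_add]
    d3321 := by
      simp only [Algebra.TensorProduct.tmul_mul_tmul, hG r3 r31 r3t1 (by decide),
        hG r31 r3 r3t1 (by decide), h.d3321, TensorProduct.tmul_smul, TensorProduct.tmul_add]
    d221 := by
      simp only [Algebra.TensorProduct.tmul_mul_tmul, hG r2 r3t1 r2t1 (by decide),
        hG r3t1 r2 r2t1 (by decide), h.d221, TensorProduct.tmul_smul, TensorProduct.tmul_add]
    s221 := by
      simp only [Algebra.TensorProduct.tmul_mul_tmul, hc r2 r21, h.s221, TensorProduct.tmul_smul]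
    s211 := by
      simp only [Algebra.TensorProduct.tmul_mul_tmul, hc r21 r1, h.s211, TensorProduct.tmul_smul]
    s3332 := by
      simp only [Algebra.TensorProduct.tmul_mul_tmul, hc r3 r3t2, h.s3332, TensorProduct.tmul_smul]
    s322 := by
      simp only [Algebra.TensorProduct.tmul_mul_tmul, hc r32 r2, h.s322, TensorProduct.tmul_smul] }

end MapB3

namespace DatumB3

open PosRoot MulOpposite

variable {k Γ : Type*} [Field k] [CommGroup Γ] (V : DatumB3 k Γ)

lemma q_ne_zero (i j : Fin 3) : V.q i j ≠ 0 := Units.ne_zero _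

lemma q_mul_q (i j : Fin 3) : V.q i j * V.q j i = V.q i i ^ cartanB3 i j := by
  have := congrArg (Units.val) (V.cartan i j)
  push_cast at this
  exact this

/-- The braiding matrix is determined by its diagonal entry `q₃₃` and the entries below the
diagonal. -/
lemma q_eq_braidMatrix (i j : Fin 3) :
    V.q i j = braidMatrix (V.q 2 2) (V.q 1 0) (V.q 2 1) (V.q 2 0) i j := by
  have h := V.q_ne_zero
  have h12 := V.q_mul_q 1 2
  have h21 := V.q_mul_q 2 1
  have h01 := V.q_mul_q 0 1
  have h10 := V.q_mul_q 1 0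
  have h02 := V.q_mul_q 0 2
  simp [cartanB3] at h12 h21 h01 h10 h02
  have e11 : V.q 1 1 = V.q 2 2 ^ 2 := by
    have : (V.q 1 1)⁻¹ = (V.q 2 2 ^ 2)⁻¹ := by
      rw [← h12, mul_comm, h21]
    exact inv_injective this
  have e00 : V.q 0 0 = V.q 1 1 := inv_injective (by rw [← h01, mul_comm, h10])
  have e12 : V.q 1 2 = (V.q 2 2 ^ 2 * V.q 2 1)⁻¹ := by
    rw [mul_inv, ← e11, ← h12, mul_inv_cancel_right₀ (h _ _)]
  have e01 : V.q 0 1 = (V.q 2 2 ^ 2 * V.q 1 0)⁻¹ := by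
    rw [mul_inv, ← e11, ← e00, ← h01, mul_inv_cancel_right₀ (h _ _)]
  have e02 : V.q 0 2 = (V.q 2 0)⁻¹ := eq_inv_of_mul_eq_one_left h02
  fin_cases i <;> fin_cases j <;> simp [braidMatrix, e11, e00, e12, e01, e02]

/-- The braiding of the root vectors of `β` and `γ` is given by the bicharacter of the braiding
matrix. -/
lemma χRoot_gRoot (β γ : PosRoot) : (V.χRoot γ (V.gRoot β) : k) =
    braidScalar (V.q 2 2) (V.q 1 0) (V.q 2 1) (V.q 2 0) β γ := by
  simp only [braidScalar, ← q_eq_braidMatrix]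
  simp only [χRoot, gRoot, map_prod, map_pow, q,
    MonoidHom.finsetProd_apply, MonoidHom.pow_apply, Units.coe_prod, Units.val_pow_eq_pow_val,
    Finset.prod_pow, ← Finset.prod_pow, ← pow_mul]
  refine Finset.prod_congr rfl fun i _ => Finset.prod_congr rfl fun j _ => ?_
  rw [mul_comm]

lemma isPrimitiveRoot : IsPrimitiveRoot (V.q 2 2) V.N := by
  have := IsPrimitiveRoot.orderOf (V.χ 2 (V.g 2))
  exact this.map_of_injective (f := Units.coeHom k) Units.val_injective

lemma N_odd : Odd V.N := V.odd_order

lemma one_lt_N : 1 < V.N := V.one_lt_order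

lemma χRoot_mul (α : PosRoot) (h : Γ) :
    (V.χRoot α h : k) = (V.χ 0 h : k) ^ α.coeff 0 * (V.χ 1 h : k) ^ α.coeff 1 *
      (V.χ 2 h : k) ^ α.coeff 2 := by
  simp [χRoot, Fin.prod_univ_three]

variable {V} {A : Type*} [Ring A] [Algebra k A] {π : Free k Γ →ₐ[k] A}

namespace IsRealization

/-- The root vector of `α` has character `χ_α`. -/
lemma fg_mul_fy (H : V.IsRealization π) (h : Γ) (α : PosRoot) :
    π (fg k h) * π (fy k Γ α) = (V.χRoot α h : k) • (π (fy k Γ α) * π (fg k h)) := by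
  have h1 : π (fg k h) * π (fy k Γ r1) = (V.χ 0 h : k) • (π (fy k Γ r1) * π (fg k h)) :=
    H.fg_mul_simple h 0
  have h2 : π (fg k h) * π (fy k Γ r2) = (V.χ 1 h : k) • (π (fy k Γ r2) * π (fg k h)) :=
    H.fg_mul_simple h 1
  have h3 : π (fg k h) * π (fy k Γ r3) = (V.χ 2 h : k) • (π (fy k Γ r3) * π (fg k h)) :=
    H.fg_mul_simple h 2
  have hb : ∀ {i β} {s t : k}, π (fg k h) * π (fy k Γ (simple i)) =
      s • (π (fy k Γ (simple i)) * π (fg k h)) →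
      π (fg k h) * π (fy k Γ β) = t • (π (fy k Γ β) * π (fg k h)) →
      π (fg k h) * π (V.bracket i β) = (s * t) • (π (V.bracket i β) * π (fg k h)) := by
    intro i β s t hi hβ
    rw [bracket, map_sub, map_smul, map_mul, map_mul, mul_sub, mul_smul_comm, ← mul_assoc,
      ← mul_assoc, hi, hβ, smul_mul_assoc, smul_mul_assoc, mul_assoc, mul_assoc, hi, hβ,
      mul_smul_comm, mul_smul_comm, sub_mul, smul_mul_assoc, mul_assoc, mul_assoc]
    module
  have h21 := hb (i := 1) h2 h1
  rw [← H.base _ _ .root21] at h21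
  have h32 := hb (i := 2) h3 h2
  rw [← H.base _ _ .root32] at h32
  have h31 := hb (i := 2) h3 h21
  rw [← H.base _ _ .root31] at h31
  have h3t2 := hb (i := 2) h3 h32
  rw [← H.base _ _ .root3t2] at h3t2
  have h3t1 := hb (i := 2) h3 h31
  rw [← H.base _ _ .root3t1] at h3t1
  have h2t1 := hb (i := 1) h2 h3t1
  rw [← H.base _ _ .root2t1] at h2t1
  rw [V.χRoot_mul]
  cases α <;> simp only [h1, h2, h3, h21, h32, h31, h3t2, h3t1, h2t1] <;> congr 1 <;>
    simp [coeff] <;> ring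

/-- The quantum Serre relations hold in the realization. -/
def SatisfiesSerre (V : DatumB3 k Γ) (π : Free k Γ →ₐ[k] A) : Prop :=
  ∀ i j : Fin 3, i ≠ j → π (V.adPow i j (1 - cartanB3 i j).toNat) = 0

/-- The defining relations of the root vectors and the Serre relations, in the form of `IsB3`. -/
lemma isB3 (H : V.IsRealization π) (hS : SatisfiesSerre V π) :
    IsB3 (V.q 2 2) (V.q 1 0) (V.q 2 1) (V.q 2 0) (fun α => π (fy k Γ α)) := by
  have hn := V.q_ne_zero
  have hm := V.q_eq_braidMatrix
  have hbr : ∀ {i β α} {s : k}, π (fy k Γ α) = π (V.bracket i β) → (V.χRoot β (V.g i) : k) = s →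
      π (fy k Γ (simple i)) * π (fy k Γ β) =
        s • (π (fy k Γ β) * π (fy k Γ (simple i))) + π (fy k Γ α) := by
    intro i β α s h1 h2
    rw [h1, bracket, map_sub, map_smul, map_mul, map_mul, h2, add_sub_cancel]
  have hχ : ∀ i β, (V.χRoot β (V.g i) : k) =
      V.q i 0 ^ β.coeff 0 * V.q i 1 ^ β.coeff 1 * V.q i 2 ^ β.coeff 2 :=
    fun i β => V.χRoot_mul β (V.g i)
  have d21 := hbr (s := V.q 1 0) (H.base _ _ .root21) (by rw [hχ]; simp [coeff])
  have d32 := hbr (s := V.q 2 1) (H.base _ _ .root32) (by rw [hχ]; simp [coeff])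
  have d31 := hbr (s := V.q 2 1 * V.q 2 0) (H.base _ _ .root31)
    (by rw [hχ]; simp [coeff, mul_comm])
  have d332 := hbr (s := V.q 2 2 * V.q 2 1) (H.base _ _ .root3t2)
    (by rw [hχ]; simp [coeff, mul_comm])
  have d3321 := hbr (s := V.q 2 2 * V.q 2 1 * V.q 2 0) (H.base _ _ .root3t1)
    (by rw [hχ]; simp [coeff]; ring)
  have d221 := hbr (s := V.q 1 0 / (V.q 2 2 ^ 2 * V.q 2 1 ^ 2)) (H.base _ _ .root2t1) (by
    rw [hχ, hm 1 1, hm 1 2]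
    simp [coeff, braidMatrix]
    field_simp [hn])
  simp only [simple, Matrix.cons_val] at d21 d32 d31 d332 d3321 d221
  have q11 : V.q 1 1 = V.q 2 2 ^ 2 := by rw [hm 1 1]; rfl
  have q00 : V.q 0 0 = V.q 2 2 ^ 2 := by rw [hm 0 0]; rfl
  have q01 : V.q 0 1 = (V.q 2 2 ^ 2 * V.q 1 0)⁻¹ := by rw [hm 0 1]; rfl
  have q12 : V.q 1 2 = (V.q 2 2 ^ 2 * V.q 2 1)⁻¹ := by rw [hm 1 2]; rfl
  have s20 := hS 2 0 (by decide)
  have s10 := hS 1 0 (by decide)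
  have s01 := hS 0 1 (by decide)
  have s21 := hS 2 1 (by decide)
  have s12 := hS 1 2 (by decide)
  simp [cartanB3, adPow, simple, q11, q00, q01, q12] at s20 s10 s01 s21 s12
  have e21 := eq_sub_of_add_eq' d21.symm
  have e32 := eq_sub_of_add_eq' d32.symm
  have e332 := eq_sub_of_add_eq' d332.symm
  have hq := hn 2 2
  have ha := hn 1 0
  have hb := hn 2 1
  refine ⟨⟨hq, ha, hb, hn 2 0, one_add_ne_zero_of_odd (V.isPrimitiveRoot.sq_of_odd V.N_odd)
    V.one_lt_N V.N_odd⟩, sub_eq_zero.1 s20, d21, d32, d31, d332, d3321, d221, ?_, ?_, ?_, ?_⟩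
  · rw [e21, ← sub_eq_zero, ← s10]
    module
  · rw [e21]
    linear_combination (norm := skip) (V.q 2 2 ^ 2 * V.q 1 0 ^ 2) • s01
    simp only [mul_sub, sub_mul, smul_mul_assoc, mul_smul_comm, mul_assoc, smul_sub, smul_smul]
    match_scalars <;> field_simp <;> ring
  · rw [e332, e32]
    linear_combination (norm := skip) s21
    simp only [mul_sub, sub_mul, smul_mul_assoc, mul_smul_comm, mul_assoc, smul_sub, smul_smul]
    match_scalars <;> ring
  · rw [e32]
    linear_combination (norm := skip) (V.q 2 2 ^ 2 * V.q 2 1 ^ 2) • s12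
    simp only [mul_sub, sub_mul, smul_mul_assoc, mul_smul_comm, mul_assoc, smul_sub, smul_smul]
    match_scalars <;> field_simp <;> ring

end IsRealization

namespace HopfData

lemma comul_fy_simple (D : V.HopfData π) :
    D.comul (π (fy k Γ r1)) = π (fy k Γ r1) ⊗ₜ[k] 1 + π (fg k (V.gRoot r1)) ⊗ₜ π (fy k Γ r1) ∧
    D.comul (π (fy k Γ r2)) = π (fy k Γ r2) ⊗ₜ[k] 1 + π (fg k (V.gRoot r2)) ⊗ₜ π (fy k Γ r2) ∧
    D.comul (π (fy k Γ r3)) = π (fy k Γ r3) ⊗ₜ[k] 1 + π (fg k (V.gRoot r3)) ⊗ₜ π (fy k Γ r3) := by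
  have e1 : V.gRoot r1 = V.g 0 := by simp [gRoot, coeff, Fin.prod_univ_three]
  have e2 : V.gRoot r2 = V.g 1 := by simp [gRoot, coeff, Fin.prod_univ_three]
  have e3 : V.gRoot r3 = V.g 2 := by simp [gRoot, coeff, Fin.prod_univ_three]
  rw [e1, e2, e3]
  exact ⟨D.comul_simple 0, D.comul_simple 1, D.comul_simple 2⟩

/-- The coproducts of the root vectors, as root vectors of a sum of two systems. -/
lemma b3Double (D : V.HopfData π) (hS : IsRealization.SatisfiesSerre V π) :
    B3Double (V.q 2 2) (V.q 1 0) (V.q 2 1) (V.q 2 0)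
      (fun α => π (fy k Γ α) ⊗ₜ[k] (1 : A)) (fun α => π (fg k (V.gRoot α)) ⊗ₜ[k] π (fy k Γ α))
      (fun α => D.comul (π (fy k Γ α))) where
  h := (D.toIsRealization.isB3 hS).map Algebra.TensorProduct.includeLeft
  h' := (D.toIsRealization.isB3 hS).tmul_left D.toIsRealization.grpHom V.g
  hz := (D.toIsRealization.isB3 hS).map D.comul
  braid β γ := by
    rw [Algebra.TensorProduct.tmul_mul_tmul, Algebra.TensorProduct.tmul_mul_tmul, mul_one, one_mul,
      D.fg_mul_fy, χRoot_gRoot, TensorProduct.smul_tmul']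
  z1 := D.comul_fy_simple.1
  z2 := D.comul_fy_simple.2.1
  z3 := D.comul_fy_simple.2.2

/-- The quantum Serre elements are skew-primitive. -/
lemma isSkewPrimitive_adPow (D : V.HopfData π) {i j : Fin 3} (hij : i ≠ j) :
    D.IsSkewPrimitive (π (V.adPow i j (1 - cartanB3 i j).toNat)) := by
  have hmap : ∀ m, π (V.adPow i j m) = braidedAdPow (V.q i j) (V.q i i) (π (fy k Γ (simple i)))
      (π (fy k Γ (simple j))) m := by
    intro m
    induction m with
    | zero => rfl
    | succ m ih => rw [adPow, braidedAdPow, map_sub, map_smul, map_mul, map_mul, ih]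
  obtain ⟨m, hm, hm3, hc⟩ : ∃ m : ℕ, (1 - cartanB3 i j).toNat = m + 1 ∧ m < 3 ∧
      cartanB3 i j = -m := by
    fin_cases i <;> fin_cases j <;> simp [cartanB3] at hij ⊢
  have hs : V.q i j * V.q j i * V.q i i ^ m = 1 := by
    rw [V.q_mul_q, hc, zpow_neg, zpow_natCast, inv_mul_cancel₀ (pow_ne_zero _ (V.q_ne_zero i i))]
  refine ⟨V.g i ^ (m + 1) * V.g j, ?_⟩
  rw [hm, hmap, map_braidedAdPow, D.comul_simple, D.comul_simple,
    braidedAdPow_add _ _ _ hm3 hs, braidedAdPow_tmul_one, braidedAdPow_tmul, D.fg_mul, ← hmap]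
  · have hpow : ∀ n : ℕ, π (fg k (V.g i)) ^ n = π (fg k (V.g i ^ n)) := fun n =>
      (map_pow D.grpHom (V.g i) n).symm
    rw [hpow]
  · rw [← D.fg_mul, mul_comm, D.fg_mul]
  · simp [D.fg_mul_simple, TensorProduct.smul_tmul', q]
  · simp [D.fg_mul_simple, TensorProduct.smul_tmul', q]
  · simp [D.fg_mul_simple, TensorProduct.smul_tmul', q]

end HopfData

end DatumB3

/-! ### The elements `u_α(μ)` -/

namespace DatumB3

open PosRoot MulOpposite

variable {k Γ : Type*} [Field k] [CommGroup Γ] (V : DatumB3 k Γ) {μ : PosRoot → k}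

section GroupPart

variable {B B' : Type*} [Ring B] [Algebra k B] [Ring B'] [Algebra k B']

/-- The element `u_α(μ)`, evaluated under a homomorphism from `Γ` to the units of an algebra. -/
def uVal (μ : PosRoot → k) (E : Γ →* B) (α : PosRoot) : B :=
  FreeAlgebra.lift k (Sum.elim E 0) (V.u μ α)

/-- The element `g_α ^ N - 1`, evaluated under a homomorphism from `Γ`. -/
def gpowVal (E : Γ →* B) (α : PosRoot) : B := E (V.gRoot α ^ V.N) - 1

lemma lift_gpow (E : Γ →* B) (α : PosRoot) :
    FreeAlgebra.lift k (Sum.elim E 0) (V.gpow α) = V.gpowVal E α := by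
  simp [gpow, gpowVal, fg]

lemma map_uVal (f : B →ₐ[k] B') (E : Γ →* B) (α : PosRoot) :
    f (V.uVal μ E α) = V.uVal μ ((f : B →* B').comp E) α := by
  rw [uVal, uVal, ← AlgHom.comp_apply]
  congr 1
  ext x
  rcases x with h | β <;> simp

/-- If the elements `g_β ^ N` with `μ_β ≠ 0` commute with `z`, then so does `u_α(μ)`. -/
lemma commute_uVal (E : Γ →* B) {z : B} (hz : ∀ β, μ β ≠ 0 → Commute (E (V.gRoot β ^ V.N)) z)
    (α : PosRoot) : Commute (V.uVal μ E α) z := by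
  have h0 : ∀ β (c : k), (c * μ β) • V.gpowVal E β ∈ Subalgebra.centralizer k {z} := by
    intro β c
    by_cases hβ : μ β = 0
    · rw [hβ, mul_zero, zero_smul]
      exact zero_mem _
    · refine Subalgebra.smul_mem _ ((Subalgebra.mem_centralizer_iff k).2 ?_) _
      intro w hw
      rw [Set.mem_singleton_iff.1 hw]
      exact ((hz β hβ).sub_left (Commute.one_left z)).symm
  have h1 : ∀ β, μ β • V.gpowVal E β ∈ Subalgebra.centralizer k {z} := by
    intro β
    simpa using h0 β 1
  have h : V.uVal μ E α ∈ Subalgebra.centralizer k {z} := by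
    cases α <;> simp only [uVal, u, map_sub, map_add, map_smul, lift_gpow] <;>
      repeat' first
        | exact h0 _ _
        | exact h1 _
        | apply sub_mem
        | apply add_mem
  exact ((Subalgebra.mem_centralizer_iff k).1 h z rfl).symm

end GroupPart

lemma χRoot_add {α β γ : PosRoot} (hγ : ∀ i, α.coeff i + β.coeff i = γ.coeff i) (h : Γ) :
    (V.χRoot γ h : k) = V.χRoot α h * V.χRoot β h := by
  simp only [χRoot_mul, ← hγ, pow_add]
  ring

lemma χRoot_pow_eq_one_iff (α : PosRoot) :
    V.χRoot α ^ V.N = 1 ↔ ∀ h, (V.χRoot α h : k) ^ V.N = 1 := by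
  rw [MonoidHom.ext_iff]
  refine forall_congr' fun h => ?_
  rw [Units.ext_iff, MonoidHom.pow_apply, Units.val_pow_eq_pow_val]
  rfl

variable {V} in
lemma Admissible.χRoot_pow (hμ : V.Admissible μ) {α : PosRoot} (h : μ α ≠ 0) :
    V.χRoot α ^ V.N = 1 := by
  by_contra h1
  exact h (hμ α (.inr h1))

variable {V} in
/-- For the roots `γ` below, `u_γ(μ)` vanishes unless `χ_γ ^ N` is trivial, as each monomial in the
parameters `μ` that occurs in `u_γ(μ)` has degree `γ`. -/
lemma Admissible.u_eq_zero_or (hμ : V.Admissible μ) {γ : PosRoot}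
    (hγ : γ = r2 ∨ γ = r3 ∨ γ = r32 ∨ γ = r3t2 ∨ γ = r3t1) :
    V.u μ γ = 0 ∨ V.χRoot γ ^ V.N = 1 := by
  rw [or_iff_not_imp_right]
  intro h
  have t : ∀ α, μ α ≠ 0 → V.χRoot α ^ V.N = 1 := fun α => hμ.χRoot_pow
  have hT : ∀ {c d : k} {α β : PosRoot} (γ : PosRoot), (c ≠ 0 → V.χRoot α ^ V.N = 1) →
      (d ≠ 0 → V.χRoot β ^ V.N = 1) → (∀ i, α.coeff i + β.coeff i = γ.coeff i) →
      c * d ≠ 0 → V.χRoot γ ^ V.N = 1 := by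
    intro c d α β γ hα hβ h hcd
    have hα := hα (left_ne_zero_of_mul hcd)
    have hβ := hβ (right_ne_zero_of_mul hcd)
    rw [χRoot_pow_eq_one_iff] at hα hβ ⊢
    intro g
    rw [V.χRoot_add h, mul_pow, hα, hβ, one_mul]
  have h0 : ∀ {c : k}, (c ≠ 0 → V.χRoot γ ^ V.N = 1) → c = 0 := fun hc => by
    by_contra h1
    exact h (hc h1)
  have e0 := h0 (t γ)
  rcases hγ with rfl | rfl | rfl | rfl | rfl
  · rw [u, e0, zero_smul]
  · rw [u, e0, zero_smul]
  · have e1 := h0 (hT r32 (t r3) (t r2) (by decide))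
    rw [u, e0, mul_assoc, e1]
    simp
  · have e1 := h0 (hT r3t2 (t r3) (t r32) (by decide))
    have e2 := h0 (hT r3t2 (t r3) (hT r32 (t r3) (t r2) (by decide)) (by decide))
    have c1 : 2 * V.ξ 1 ^ V.N * μ r3 * μ r32 = 0 := by linear_combination (2 * V.ξ 1 ^ V.N) * e1
    have c2 : V.ξ 1 ^ V.N * V.ξ 2 ^ V.N * μ r3 ^ 2 * μ r2 = 0 := by
      linear_combination (V.ξ 1 ^ V.N * V.ξ 2 ^ V.N) * e2
    rw [u, e0, c1, c2]
    simp
  · have e1 := h0 (hT r3t1 (t r3) (t r31) (by decide))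
    have e2 := h0 (hT r3t1 (t r3) (hT r31 (t r3) (t r21) (by decide)) (by decide))
    have e3 := h0 (hT r3t1 (hT r3t2 (t r3) (hT r32 (t r3) (t r2) (by decide)) (by decide)) (t r1)
      (by decide))
    have e4 := h0 (hT r3t1 (hT r3t2 (t r3) (t r32) (by decide)) (t r1) (by decide))
    have e5 := h0 (hT r3t1 (t r3t2) (t r1) (by decide))
    have c1 : 2 * V.ξ 1 ^ V.N * μ r3 * μ r31 = 0 := by linear_combination (2 * V.ξ 1 ^ V.N) * e1
    have c2 : V.ξ 1 ^ V.N * V.ξ 2 ^ V.N * μ r3 ^ 2 * μ r21 = 0 := by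
      linear_combination (V.ξ 1 ^ V.N * V.ξ 2 ^ V.N) * e2
    have c3 : V.ξ 2 ^ V.N * (V.ξ 1 ^ V.N * V.ξ 2 ^ V.N * μ r3 ^ 2 * μ r2
        - 2 * V.ξ 1 ^ V.N * μ r3 * μ r32 + μ r3t2) * μ r1 = 0 := by
      linear_combination (V.ξ 2 ^ V.N * V.ξ 1 ^ V.N * V.ξ 2 ^ V.N) * e3 -
        (V.ξ 2 ^ V.N * 2 * V.ξ 1 ^ V.N) * e4 + V.ξ 2 ^ V.N * e5
    rw [u, e0, c1, c2, c3]
    simp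

/-- If `χ_β ^ N` is trivial, then `g_β ^ N` acts trivially on all root vectors, as
`q_ij ^ N` and `q_ji ^ N` are inverse to each other. -/
lemma χRoot_gRoot_pow_symm {β γ : PosRoot} (h : V.χRoot β ^ V.N = 1) :
    (V.χRoot γ (V.gRoot β) : k) ^ V.N = 1 := by
  have h1 : (V.χRoot β (V.gRoot γ) : k) ^ V.N = 1 := by
    rw [← Units.val_pow_eq_pow_val, ← MonoidHom.pow_apply, h]
    rfl
  have hq := V.isPrimitiveRoot.pow_eq_one
  have hd : ∀ i, V.q i i ^ V.N = 1 := by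
    intro i
    rw [V.q_eq_braidMatrix]
    fin_cases i <;> simp [braidMatrix, pow_right_comm, hq]
  have h2 : ∀ i j, (V.q i j * V.q j i) ^ V.N = 1 := by
    intro i j
    rw [V.q_mul_q, ← zpow_natCast, ← zpow_mul, mul_comm, zpow_mul, zpow_natCast, hd, one_zpow]
  have h3 : ((V.χRoot γ (V.gRoot β) : k) * (V.χRoot β (V.gRoot γ) : k)) ^ V.N = 1 := by
    rw [V.χRoot_gRoot, V.χRoot_gRoot, braidScalar, braidScalar]
    simp only [← q_eq_braidMatrix]
    rw [Finset.prod_comm (f := fun i j => V.q i j ^ (γ.coeff i * β.coeff j)),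
      ← Finset.prod_mul_distrib]
    simp only [← Finset.prod_mul_distrib, mul_comm (γ.coeff _), ← mul_pow, ← Finset.prod_pow]
    refine Finset.prod_eq_one fun i _ => Finset.prod_eq_one fun j _ => ?_
    rw [pow_right_comm, h2, one_pow]
  rwa [mul_pow, h1, mul_one] at h3

variable {V} {A : Type*} [Ring A] [Algebra k A] {π : Free k Γ →ₐ[k] A}

namespace IsRealization

/-- In a realization `u_α(μ)` is its value at the homomorphism `grpHom`. -/
lemma map_u (H : V.IsRealization π) (α : PosRoot) : π (V.u μ α) = V.uVal μ H.grpHom α := by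
  have h : ∀ β, π (V.gpow β) = V.gpowVal H.grpHom β := fun β => by
    rw [gpow, map_sub, map_one]
    rfl
  cases α <;> simp only [uVal, u, map_sub, map_add, map_smul, lift_gpow, h]

lemma commute_fg_pow (H : V.IsRealization π) {β : PosRoot} (hβ : V.χRoot β ^ V.N = 1)
    (δ : PosRoot) : Commute (π (fg k (V.gRoot β ^ V.N))) (π (fy k Γ δ)) := by
  rw [commute_iff_eq, H.fg_mul_fy, map_pow, Units.val_pow_eq_pow_val,
    V.χRoot_gRoot_pow_symm hβ, one_smul]

/-- `u_α(μ)` commutes with all root vectors, as `χ_β ^ N` is trivial if `μ_β` is nonzero. -/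
lemma commute_u (H : V.IsRealization π) (hμ : V.Admissible μ) (α δ : PosRoot) :
    Commute (π (V.u μ α)) (π (fy k Γ δ)) := by
  rw [H.map_u]
  exact V.commute_uVal _ (fun β hβ => H.commute_fg_pow (hμ.χRoot_pow hβ) δ) α

lemma fy_mul_fg_inv (H : V.IsRealization π) (h : Γ) (i : Fin 3) :
    π (fy k Γ (simple i)) * π (fg k h⁻¹) =
      (V.χ i h : k) • (π (fg k h⁻¹) * π (fy k Γ (simple i))) := by
  rw [H.fg_mul_simple, smul_smul, map_inv, Units.mul_inv, one_smul]

end IsRealization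

end DatumB3

/-! ### Coproducts of the elements `u_α(μ)` -/

namespace DatumB3

open PosRoot MulOpposite

variable {k Γ : Type*} [Field k] [CommGroup Γ] (V : DatumB3 k Γ) (μ : PosRoot → k)

section CoproductIdentities

variable {C : Type*} [CommRing C] [Algebra k C] (L R : Γ →* C)

lemma map_gRoot_pow {B : Type*} [CommRing B] (E : Γ →* B) (α : PosRoot) :
    E (V.gRoot α ^ V.N) = (E (V.g 0) ^ V.N) ^ α.coeff 0 * (E (V.g 1) ^ V.N) ^ α.coeff 1 *
      (E (V.g 2) ^ V.N) ^ α.coeff 2 := by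
  simp only [gRoot, map_pow, map_prod, Fin.prod_univ_three, map_mul, mul_pow, pow_right_comm]

/-- The `N`-th power of the opposite root vector of `r32`, evaluated under a homomorphism
from `Γ`. -/
def oppositeVal32 {B : Type*} [Ring B] [Algebra k B] (E : Γ →* B) : B :=
  μ r32 • (1 - E (V.gRoot r32 ^ V.N)) -
    (V.ξ 2 ^ V.N * μ r3 * μ r2) • (E (V.gRoot r3 ^ V.N) - E (V.gRoot r32 ^ V.N))

/-- The `N`-th power of the opposite root vector of `r3t2`, evaluated under a homomorphism
from `Γ`. -/
def oppositeVal3t2 {B : Type*} [Ring B] [Algebra k B] (E : Γ →* B) : B :=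
  -(μ r3t2 • (1 - E (V.gRoot r3t2 ^ V.N)) -
    (2 * V.ξ 1 ^ V.N * μ r3 * μ r32) • (E (V.gRoot r3 ^ V.N) - E (V.gRoot r3t2 ^ V.N)) +
    (V.ξ 1 ^ V.N * V.ξ 2 ^ V.N * μ r3 ^ 2 * μ r2) •
      (E (V.gRoot r3 ^ V.N * V.gRoot r3 ^ V.N) - E (V.gRoot r3t2 ^ V.N)))

/-- The value of `u_α(μ)` at a product of two homomorphisms, for a simple root. If these are
`h ↦ h ⊗ 1` and `h ↦ 1 ⊗ h`, then this value is the coproduct of `u_α(μ)`. The following lemmas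
treat the other roots, and exhibit the mixed terms of the coproduct. -/
lemma uVal_mul_simple (i : Fin 3) : V.uVal μ (L * R) (simple i) = V.uVal μ L (simple i) +
    L (V.gRoot (simple i) ^ V.N) * V.uVal μ R (simple i) := by
  fin_cases i <;>
  simp [uVal, u, simple, lift_gpow, gpowVal, map_gRoot_pow, coeff, Algebra.smul_def,
    map_ofNat] <;>
  ring

lemma uVal_mul_r21 : V.uVal μ (L * R) r21 = V.uVal μ L r21 +
    V.ξ 2 ^ V.N • (V.uVal μ L r2 * (L (V.gRoot r1 ^ V.N) * V.uVal μ R r1)) +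
    L (V.gRoot r21 ^ V.N) * V.uVal μ R r21 := by
  simp [uVal, u, lift_gpow, gpowVal, map_gRoot_pow, coeff, Algebra.smul_def,
    map_ofNat]
  ring

lemma uVal_mul_r32 : V.uVal μ (L * R) r32 = V.uVal μ L r32 +
    V.ξ 2 ^ V.N • (V.uVal μ L r3 * (L (V.gRoot r2 ^ V.N) * V.uVal μ R r2)) +
    L (V.gRoot r32 ^ V.N) * V.uVal μ R r32 := by
  simp [uVal, u, lift_gpow, gpowVal, map_gRoot_pow, coeff, Algebra.smul_def,
    map_ofNat]
  ring

lemma uVal_mul_r31 : V.uVal μ (L * R) r31 = V.uVal μ L r31 +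
    V.ξ 2 ^ V.N • (V.uVal μ L r32 * (L (V.gRoot r1 ^ V.N) * V.uVal μ R r1)) +
    V.ξ 2 ^ V.N • (V.uVal μ L r3 * (L (V.gRoot r21 ^ V.N) * V.uVal μ R r21)) +
    L (V.gRoot r31 ^ V.N) * V.uVal μ R r31 := by
  simp [uVal, u, lift_gpow, gpowVal, map_gRoot_pow, coeff, Algebra.smul_def,
    map_ofNat]
  ring

lemma uVal_mul_r3t2 : V.uVal μ (L * R) r3t2 = V.uVal μ L r3t2 +
    (V.ξ 1 ^ V.N * V.ξ 2 ^ V.N) • (V.uVal μ L r3 * V.uVal μ L r3 *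
      (L (V.gRoot r2 ^ V.N) * V.uVal μ R r2)) +
    (2 * V.ξ 1 ^ V.N) • (V.uVal μ L r3 * (L (V.gRoot r32 ^ V.N) * V.uVal μ R r32)) +
    L (V.gRoot r3t2 ^ V.N) * V.uVal μ R r3t2 := by
  simp [uVal, u, lift_gpow, gpowVal, map_gRoot_pow, coeff, Algebra.smul_def,
    map_ofNat]
  ring

lemma uVal_mul_r3t1 : V.uVal μ (L * R) r3t1 = V.uVal μ L r3t1 +
    V.ξ 2 ^ V.N • (V.uVal μ L r3t2 * (L (V.gRoot r1 ^ V.N) * V.uVal μ R r1)) +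
    (V.ξ 1 ^ V.N * V.ξ 2 ^ V.N) • (V.uVal μ L r3 * V.uVal μ L r3 *
      (L (V.gRoot r21 ^ V.N) * V.uVal μ R r21)) +
    (2 * V.ξ 1 ^ V.N) • (V.uVal μ L r3 * (L (V.gRoot r31 ^ V.N) * V.uVal μ R r31)) +
    L (V.gRoot r3t1 ^ V.N) * V.uVal μ R r3t1 := by
  simp [uVal, u, lift_gpow, gpowVal, map_gRoot_pow, coeff, Algebra.smul_def,
    map_ofNat]
  ring

/-- The mixed terms involve the powers of the opposite root vectors here. -/
lemma uVal_mul_r2t1 : V.uVal μ (L * R) r2t1 = V.uVal μ L r2t1 +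
    (V.ξ 2 ^ V.N * V.ξ 2 ^ V.N) • (V.uVal μ L r2 * (V.uVal μ L r3t2 *
      (L (V.gRoot r1 ^ V.N) * V.uVal μ R r1))) -
    (V.ξ 1 ^ V.N * V.ξ 2 ^ V.N) • (V.uVal μ L r32 * V.uVal μ L r32 *
      (L (V.gRoot r1 ^ V.N) * V.uVal μ R r1)) +
    V.ξ 2 ^ V.N • (V.oppositeVal3t2 μ L * (L (V.gRoot r21 ^ V.N) * V.uVal μ R r21)) +
    (2 * V.ξ 1 ^ V.N) • (V.oppositeVal32 μ L * (L (V.gRoot r31 ^ V.N) * V.uVal μ R r31)) +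
    V.ξ 2 ^ V.N • (V.uVal μ L r2 * (L (V.gRoot r3t1 ^ V.N) * V.uVal μ R r3t1)) +
    L (V.gRoot r2t1 ^ V.N) * V.uVal μ R r2t1 := by
  simp [uVal, u, lift_gpow, gpowVal, map_gRoot_pow, coeff, Algebra.smul_def,
    map_ofNat, oppositeVal32,
    oppositeVal3t2]
  ring

end CoproductIdentities

end DatumB3

/-! ### Powers of root vectors in the tensor square -/

namespace DatumB3

open PosRoot MulOpposite

variable {k Γ : Type*} [Field k] [CommGroup Γ] {V : DatumB3 k Γ} {μ : PosRoot → k}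
  {A : Type*} [Ring A] [Algebra k A] {π : Free k Γ →ₐ[k] A}

namespace IsRealization

lemma map_fg_pow (H : V.IsRealization π) (h : Γ) (n : ℕ) : π (fg k h) ^ n = π (fg k (h ^ n)) :=
  (map_pow H.grpHom h n).symm

/-- The homomorphism from the group algebra of `Γ × Γ` to `A ⊗ A`. -/
def pairHom (H : V.IsRealization π) : MonoidAlgebra k (Γ × Γ) →ₐ[k] A ⊗[k] A :=
  MonoidAlgebra.lift k (A ⊗[k] A) (Γ × Γ)
    { toFun := fun p => π (fg k p.1) ⊗ₜ π (fg k p.2)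
      map_one' := by rw [Prod.fst_one, Prod.snd_one, H.fg_one]; rfl
      map_mul' := fun p p' => by
        rw [Prod.fst_mul, Prod.snd_mul, H.fg_mul, H.fg_mul, Algebra.TensorProduct.tmul_mul_tmul] }

variable (k Γ) in
/-- The embedding of `Γ` as the first factor. -/
def leftHom : Γ →* MonoidAlgebra k (Γ × Γ) := (MonoidAlgebra.of k (Γ × Γ)).comp (MonoidHom.inl Γ Γ)

variable (k Γ) in
/-- The embedding of `Γ` as the second factor. -/
def rightHom : Γ →* MonoidAlgebra k (Γ × Γ) := (MonoidAlgebra.of k (Γ × Γ)).comp (MonoidHom.inr Γ Γ)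

lemma pairHom_left (H : V.IsRealization π) (h : Γ) :
    H.pairHom (leftHom k Γ h) = π (fg k h) ⊗ₜ 1 := by
  simp [pairHom, leftHom, H.fg_one]

lemma pairHom_right (H : V.IsRealization π) (h : Γ) :
    H.pairHom (rightHom k Γ h) = 1 ⊗ₜ π (fg k h) := by
  simp [pairHom, rightHom, H.fg_one]

lemma pairHom_uVal_left (H : V.IsRealization π) (α : PosRoot) :
    H.pairHom (V.uVal μ (leftHom k Γ) α) = π (V.u μ α) ⊗ₜ 1 := by
  change _ = Algebra.TensorProduct.includeLeft (S := k) (B := A) (π (V.u μ α))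
  rw [H.map_u, map_uVal, map_uVal]
  congr 1
  ext h
  exact H.pairHom_left h

lemma pairHom_uVal_right (H : V.IsRealization π) (α : PosRoot) :
    H.pairHom (V.uVal μ (rightHom k Γ) α) = 1 ⊗ₜ π (V.u μ α) := by
  change _ = Algebra.TensorProduct.includeRight (A := A) (π (V.u μ α))
  rw [H.map_u, map_uVal, map_uVal]
  congr 1
  ext h
  exact H.pairHom_right h

/-- The `N`-th power of a root vector, placed on the left. -/
lemma tmul_one_pow (H : V.IsRealization π) {β : PosRoot}
    (hβ : π (fy k Γ β) ^ V.N = π (V.u μ β)) :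
    (π (fy k Γ β) ⊗ₜ[k] (1 : A)) ^ V.N = H.pairHom (V.uVal μ (leftHom k Γ) β) := by
  rw [Algebra.TensorProduct.tmul_pow, one_pow, hβ, pairHom_uVal_left]

/-- The `N`-th power of a root vector, placed on the right. -/
lemma fg_tmul_pow (H : V.IsRealization π) {β : PosRoot}
    (hβ : π (fy k Γ β) ^ V.N = π (V.u μ β)) :
    (π (fg k (V.gRoot β)) ⊗ₜ[k] π (fy k Γ β)) ^ V.N =
      H.pairHom (leftHom k Γ (V.gRoot β ^ V.N) * V.uVal μ (rightHom k Γ) β) := by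
  rw [Algebra.TensorProduct.tmul_pow, hβ, map_mul, pairHom_left, pairHom_uVal_right, H.map_fg_pow,
    Algebra.TensorProduct.tmul_mul_tmul, one_mul, mul_one]

lemma powerCentral_left (H : V.IsRealization π) (hμ : V.Admissible μ) {γ : PosRoot}
    (hγ : γ = r2 ∨ γ = r3 ∨ γ = r32 ∨ γ = r3t2 ∨ γ = r3t1)
    (hp : π (fy k Γ γ) ^ V.N = π (V.u μ γ)) :
    PowerCentral V.N (V.q 2 2) (V.q 1 0) (V.q 2 1) (V.q 2 0)
      (fun α => π (fy k Γ α) ⊗ₜ[k] (1 : A)) γ where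
  eq_zero_or := by
    refine (hμ.u_eq_zero_or hγ).imp (fun h => ?_) fun h δ => ?_
    · rw [Algebra.TensorProduct.tmul_pow, hp, h, map_zero, TensorProduct.zero_tmul]
    · rw [← χRoot_gRoot, (V.χRoot_pow_eq_one_iff γ).1 h]
  comm δ := by
    rw [Algebra.TensorProduct.tmul_pow, hp, one_pow, Algebra.TensorProduct.tmul_mul_tmul,
      Algebra.TensorProduct.tmul_mul_tmul, (H.commute_u hμ γ δ).eq]

lemma powerCentral_right (H : V.IsRealization π) (hμ : V.Admissible μ) {γ : PosRoot}
    (hγ : γ = r2 ∨ γ = r3 ∨ γ = r32 ∨ γ = r3t2 ∨ γ = r3t1)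
    (hp : π (fy k Γ γ) ^ V.N = π (V.u μ γ)) :
    PowerCentral V.N (V.q 2 2) (V.q 1 0) (V.q 2 1) (V.q 2 0)
      (fun α => π (fg k (V.gRoot α)) ⊗ₜ[k] π (fy k Γ α)) γ where
  eq_zero_or := by
    refine (hμ.u_eq_zero_or hγ).imp (fun h => ?_) fun h δ => ?_
    · rw [Algebra.TensorProduct.tmul_pow, hp, h, map_zero, TensorProduct.tmul_zero]
    · rw [← χRoot_gRoot, (V.χRoot_pow_eq_one_iff γ).1 h]
  comm δ := by
    rw [Algebra.TensorProduct.tmul_pow, hp, Algebra.TensorProduct.tmul_mul_tmul,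
      Algebra.TensorProduct.tmul_mul_tmul, (H.commute_u hμ γ δ).eq, H.map_fg_pow, ← H.fg_mul,
      ← H.fg_mul, mul_comm]

end IsRealization

namespace HopfData

/-- The coproduct of `u_α(μ)` is its value at the diagonal homomorphism. -/
lemma comul_u (D : V.HopfData π) (α : PosRoot) : D.comul (π (V.u μ α)) =
    D.pairHom (V.uVal μ (IsRealization.leftHom k Γ * IsRealization.rightHom k Γ) α) := by
  rw [D.map_u, map_uVal, map_uVal]
  congr 1
  ext h
  change D.comul (π (fg k h)) =
    D.pairHom (IsRealization.leftHom k Γ h * IsRealization.rightHom k Γ h)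
  rw [D.comul_grp, map_mul, D.pairHom_left, D.pairHom_right, Algebra.TensorProduct.tmul_mul_tmul,
    mul_one, one_mul]

/-- If the powers of `y_α` and `u_α(μ)` have the same mixed terms in their coproducts, then their
difference is skew-primitive. -/
lemma isSkewPrimitive_of_mixed (D : V.HopfData π) {α : PosRoot} {m : A ⊗[k] A}
    (hz : D.comul (π (fy k Γ α)) ^ V.N = (π (fy k Γ α) ⊗ₜ[k] (1 : A)) ^ V.N + m +
      (π (fg k (V.gRoot α)) ⊗ₜ[k] π (fy k Γ α)) ^ V.N)
    (hu : D.comul (π (V.u μ α)) = D.pairHom (V.uVal μ (IsRealization.leftHom k Γ) α) + m +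
      D.pairHom (IsRealization.leftHom k Γ (V.gRoot α ^ V.N) *
        V.uVal μ (IsRealization.rightHom k Γ) α)) :
    D.IsSkewPrimitive (π (fy k Γ α ^ V.N) - π (V.u μ α)) := by
  refine ⟨V.gRoot α ^ V.N, ?_⟩
  rw [map_sub, map_pow, map_pow, hz, hu, D.pairHom_uVal_left, map_mul, D.pairHom_left,
    D.pairHom_uVal_right, Algebra.TensorProduct.tmul_pow, Algebra.TensorProduct.tmul_pow,
    one_pow, Algebra.TensorProduct.tmul_mul_tmul, one_mul, mul_one, D.map_fg_pow,
    TensorProduct.sub_tmul, TensorProduct.tmul_sub]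
  abel

end HopfData

end DatumB3

/-! ### Powers of opposite root vectors via the antipode -/

namespace DatumB3

open PosRoot MulOpposite

variable {k Γ : Type*} [Field k] [CommGroup Γ] {V : DatumB3 k Γ} {μ : PosRoot → k}
  {A : Type*} [Ring A] [Algebra k A] {π : Free k Γ →ₐ[k] A}

lemma gRoot_add {α β γ : PosRoot} (hγ : ∀ i, α.coeff i + β.coeff i = γ.coeff i) :
    V.gRoot γ = V.gRoot α * V.gRoot β := by
  simp only [gRoot, ← hγ, pow_add, Finset.prod_mul_distrib]

variable (V π) in
/-- The opposite root vector of `r32` in a realization. -/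
abbrev opp32 : A := oppositeR32 (V.q 2 2) (V.q 2 1) (fun α => π (fy k Γ α))

variable (V π) in
/-- The opposite root vector of `r3t2` in a realization. -/
abbrev opp3t2 : A := oppositeR3t2 (V.q 2 2) (V.q 2 1) (fun α => π (fy k Γ α))

namespace HopfData

lemma antipodeLinear_fg (D : V.HopfData π) (h : Γ) :
    D.antipodeLinear (π (fg k h)) = π (fg k h⁻¹) := by
  rw [antipodeLinear_apply, D.antipode_grp, unop_op]

lemma antipodeLinear_simple (D : V.HopfData π) (i : Fin 3) :
    D.antipodeLinear (π (fy k Γ (simple i))) =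
      -(π (fg k (V.g i)⁻¹) * π (fy k Γ (simple i))) := by
  rw [antipodeLinear_apply, D.antipode_simple, unop_op]

lemma antipodeLinear_pow (D : V.HopfData π) (a : A) (n : ℕ) :
    D.antipodeLinear (a ^ n) = D.antipodeLinear a ^ n := by
  simp [antipodeLinear_apply]

lemma antipodeLinear_gpow (D : V.HopfData π) (β : PosRoot) :
    D.antipodeLinear (π (V.gpow β)) = π (fg k (V.gRoot β ^ V.N)⁻¹) - 1 := by
  rw [gpow, map_sub, map_sub, antipodeLinear_fg, map_one]
  simp [antipodeLinear_apply]

lemma antipodeLinear_u (D : V.HopfData π) (α : PosRoot) :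
    D.antipodeLinear (π (V.u μ α)) = V.uVal μ (D.grpHom.comp invMonoidHom) α := by
  have h : ∀ β, D.antipodeLinear (π (V.gpow β)) =
      V.gpowVal (D.grpHom.comp invMonoidHom) β := D.antipodeLinear_gpow
  cases α <;> simp only [uVal, u, map_sub, map_add, map_smul, lift_gpow, h]

lemma commute_antipodeLinear_u (D : V.HopfData π) (hμ : V.Admissible μ) (α δ : PosRoot) :
    Commute (D.antipodeLinear (π (V.u μ α))) (π (fy k Γ δ)) := by
  rw [antipodeLinear_u]
  refine V.commute_uVal _ (fun β hβ => ?_) α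
  have h := D.commute_fg_pow (hμ.χRoot_pow hβ) δ
  have h1 : Commute (π (fg k (V.gRoot β ^ V.N)⁻¹)) (π (fy k Γ δ)) := by
    rw [commute_iff_eq]
    calc _ = π (fg k (V.gRoot β ^ V.N)⁻¹) * (π (fy k Γ δ) * π (fg k (V.gRoot β ^ V.N))) *
          π (fg k (V.gRoot β ^ V.N)⁻¹) := by
            rw [mul_assoc, mul_assoc (π (fy k Γ δ)), D.fg_mul_inv, mul_one]
      _ = _ := by rw [← h.eq, ← mul_assoc, D.fg_inv_mul, one_mul]
  exact h1

/-- If the antipode maps `Y` to a multiple of `g⁻¹ * Z`, then it relates the `N`-th powers of `Y`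
and `Z`. -/
lemma smul_pow_of_antipode (D : V.HopfData π) {Y Z : A} {c p : k} {g : Γ} {v : A}
    (hY : D.antipodeLinear Y = c • (π (fg k g⁻¹) * Z))
    (hZ : Z * π (fg k g⁻¹) = p • (π (fg k g⁻¹) * Z)) (hp : p ^ V.N = 1) (hv : Y ^ V.N = v) :
    c ^ V.N • Z ^ V.N = π (fg k (g ^ V.N)) * D.antipodeLinear v := by
  rw [← hv, antipodeLinear_pow, hY, smul_pow, mul_pow_of_qcomm_of_trivial V.N_odd hZ (.inr hp),
    D.map_fg_pow, mul_smul_comm, ← mul_assoc, ← D.fg_mul, inv_pow, mul_inv_cancel, D.fg_one,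
    one_mul]

lemma fy_mul_fg_inv_r2 (D : V.HopfData π) (h : Γ) : π (fy k Γ r2) * π (fg k h⁻¹) =
    (V.χ 1 h : k) • (π (fg k h⁻¹) * π (fy k Γ r2)) := D.fy_mul_fg_inv h 1

lemma fy_mul_fg_inv_r3 (D : V.HopfData π) (h : Γ) : π (fy k Γ r3) * π (fg k h⁻¹) =
    (V.χ 2 h : k) • (π (fg k h⁻¹) * π (fy k Γ r3)) := D.fy_mul_fg_inv h 2

lemma opposite_r32_mul_fg_inv (D : V.HopfData π) (h : Γ) : V.opp32 π * π (fg k h⁻¹) =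
    (V.χRoot r32 h : k) • (π (fg k h⁻¹) * V.opp32 π) := by
  have h1 : (V.χRoot r32 h : k) = V.χ 1 h * V.χ 2 h := by simp [χRoot_mul, coeff]
  rw [opp32, oppositeR32, sub_mul, smul_mul_assoc, mul_assoc, mul_assoc, D.fy_mul_fg_inv_r2,
    D.fy_mul_fg_inv_r3, mul_smul_comm, mul_smul_comm, ← mul_assoc, ← mul_assoc,
    D.fy_mul_fg_inv_r2, D.fy_mul_fg_inv_r3, smul_mul_assoc, smul_mul_assoc, h1, mul_sub,
    mul_smul_comm, mul_assoc, mul_assoc]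
  module

lemma opposite_r3t2_mul_fg_inv (D : V.HopfData π) (h : Γ) : V.opp3t2 π * π (fg k h⁻¹) =
    (V.χRoot r3t2 h : k) • (π (fg k h⁻¹) * V.opp3t2 π) := by
  have h1 : (V.χRoot r3t2 h : k) = V.χRoot r32 h * V.χ 2 h := by
    simp [χRoot_mul, coeff]
    ring
  rw [opp3t2, oppositeR3t2, sub_mul, smul_mul_assoc, mul_assoc, mul_assoc,
    D.opposite_r32_mul_fg_inv,
    D.fy_mul_fg_inv_r3, mul_smul_comm, mul_smul_comm, ← mul_assoc, ← mul_assoc,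
    D.opposite_r32_mul_fg_inv, D.fy_mul_fg_inv_r3, smul_mul_assoc, smul_mul_assoc, h1, mul_sub,
    mul_smul_comm, mul_assoc, mul_assoc]
  module

/-- The antipode maps a root vector to a multiple of the opposite one times a group element. -/
lemma antipodeLinear_r32 (D : V.HopfData π) (hS : IsRealization.SatisfiesSerre V π) :
    D.antipodeLinear (π (fy k Γ r32)) = V.q 2 1 • (π (fg k (V.gRoot r32)⁻¹) * V.opp32 π) := by
  have hB := D.isB3 hS
  have hb := V.q_ne_zero 2 1
  have hg : (V.gRoot r32)⁻¹ = (V.g 1)⁻¹ * (V.g 2)⁻¹ := by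
    simp [gRoot, coeff, Fin.prod_univ_three, mul_comm]
  have hg' : (V.gRoot r32)⁻¹ = (V.g 2)⁻¹ * (V.g 1)⁻¹ := by rw [hg, mul_comm]
  have s2 : D.antipodeLinear (π (fy k Γ r2)) = -(π (fg k (V.g 1)⁻¹) * π (fy k Γ r2)) :=
    D.antipodeLinear_simple 1
  have s3 : D.antipodeLinear (π (fy k Γ r3)) = -(π (fg k (V.g 2)⁻¹) * π (fy k Γ r3)) :=
    D.antipodeLinear_simple 2
  have h12 : (V.χ 2 (V.g 1) : k) = (V.q 2 2 ^ 2 * V.q 2 1)⁻¹ := by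
    change V.q 1 2 = _
    rw [V.q_eq_braidMatrix]
    rfl
  have e : ∀ {g h : Γ} {a b : A} {s : k}, a * π (fg k h) = s • (π (fg k h) * a) →
      π (fg k g) * a * (π (fg k h) * b) = s • (π (fg k (g * h)) * (a * b)) := by
    intro g h a b s hs
    rw [mul_assoc, ← mul_assoc a, hs, smul_mul_assoc, mul_smul_comm, D.fg_mul]
    simp only [mul_assoc]
  rw [eq_sub_of_add_eq' hB.d32.symm, map_sub, map_smul, antipodeLinear_mul, antipodeLinear_mul,
    s2, s3, neg_mul_neg, neg_mul_neg, e (D.fy_mul_fg_inv_r2 _), e (D.fy_mul_fg_inv_r3 _), ← hg,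
    ← hg', h12, opp32, oppositeR32, mul_sub, mul_smul_comm, q]
  module

/-- The antipode maps a root vector to a multiple of the opposite one times a group element. -/
lemma antipodeLinear_r3t2 (D : V.HopfData π) (hS : IsRealization.SatisfiesSerre V π) :
    D.antipodeLinear (π (fy k Γ r3t2)) =
      (-(V.q 2 2 * V.q 2 1 ^ 2)) • (π (fg k (V.gRoot r3t2)⁻¹) * V.opp3t2 π) := by
  have hB := D.isB3 hS
  have hb := V.q_ne_zero 2 1
  have hq := V.q_ne_zero 2 2
  have hg : (V.gRoot r3t2)⁻¹ = (V.gRoot r32)⁻¹ * (V.g 2)⁻¹ := by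
    simp [gRoot, coeff, Fin.prod_univ_three, mul_comm, mul_left_comm, pow_two]
  have hg' : (V.gRoot r3t2)⁻¹ = (V.g 2)⁻¹ * (V.gRoot r32)⁻¹ := by rw [hg, mul_comm]
  have s3 : D.antipodeLinear (π (fy k Γ r3)) = -(π (fg k (V.g 2)⁻¹) * π (fy k Γ r3)) :=
    D.antipodeLinear_simple 2
  have h1 : (V.χ 2 (V.gRoot r32) : k) = (V.q 2 2 * V.q 2 1)⁻¹ := by
    have h2 : (V.χ 2 (V.gRoot r32) : k) = V.q 1 2 * V.q 2 2 := by
      simp [gRoot, coeff, Fin.prod_univ_three, q]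
    rw [h2, V.q_eq_braidMatrix 1 2]
    simp [braidMatrix]
    field_simp
  have h2 : (V.χRoot r32 (V.g 2) : k) = V.q 2 2 * V.q 2 1 := by
    simp [χRoot_mul, coeff, q, mul_comm]
  have e : ∀ {g h : Γ} {a b : A} {s : k}, a * π (fg k h) = s • (π (fg k h) * a) →
      π (fg k g) * a * (π (fg k h) * b) = s • (π (fg k (g * h)) * (a * b)) := by
    intro g h a b s hs
    rw [mul_assoc, ← mul_assoc a, hs, smul_mul_assoc, mul_smul_comm, D.fg_mul]
    simp only [mul_assoc]
  rw [eq_sub_of_add_eq' hB.d332.symm, map_sub, map_smul, antipodeLinear_mul, antipodeLinear_mul,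
    s3, D.antipodeLinear_r32 hS, mul_neg, neg_mul, smul_mul_assoc, mul_smul_comm,
    e (D.opposite_r32_mul_fg_inv _), e (D.fy_mul_fg_inv_r3 _), ← hg, ← hg', h1, h2,
    opp3t2, oppositeR3t2, mul_sub, mul_smul_comm]
  match_scalars <;> field_simp

/-- The power of the opposite root vector, from that of `y_α` by the antipode. The scalars that
arise have trivial `N`-th power unless `u_α(μ) = 0`. -/
lemma opposite_r32_pow (D : V.HopfData π) (hS : IsRealization.SatisfiesSerre V π)
    (hμ : V.Admissible μ) (hp : π (fy k Γ r32) ^ V.N = π (V.u μ r32)) :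
    V.opp32 π ^ V.N = V.oppositeVal32 μ D.grpHom ∧ (V.u μ r32 = 0 → V.opp32 π ^ V.N = 0) := by
  have hq := V.isPrimitiveRoot.pow_eq_one
  have h1 : (V.χRoot r32 (V.gRoot r32) : k) = V.q 2 2 := by
    have hb := V.q_ne_zero 2 1
    have hq0 := V.q_ne_zero 2 2
    simp [χRoot_gRoot, braidScalar, coeff, braidMatrix, Fin.prod_univ_three]
    field_simp
  have e := D.smul_pow_of_antipode (D.antipodeLinear_r32 hS)
    (D.opposite_r32_mul_fg_inv (V.gRoot r32)) (by rw [h1, hq]) hp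
  have hv : π (fg k (V.gRoot r32 ^ V.N)) * D.antipodeLinear (π (V.u μ r32)) =
      V.oppositeVal32 μ D.grpHom := by
    have hg : V.gRoot r32 ^ V.N * (V.gRoot r2 ^ V.N)⁻¹ = V.gRoot r3 ^ V.N := by
      rw [gRoot_add (V := V) (α := r3) (β := r2) (γ := r32) (by decide), mul_pow,
        mul_inv_cancel_right]
    simp only [u, map_sub, map_smul, antipodeLinear_gpow, mul_sub, mul_smul_comm, ← D.fg_mul,
      mul_inv_cancel, hg, D.fg_one, mul_one]
    rfl
  suffices h : V.opp32 π ^ V.N = V.oppositeVal32 μ D.grpHom from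
    ⟨h, fun h0 => by rw [h, ← hv, h0, map_zero, map_zero, mul_zero]⟩
  rw [hv] at e
  rcases hμ.u_eq_zero_or (γ := r32) (by simp) with h0 | h0
  · rw [h0, map_zero, map_zero, mul_zero] at hv
    rw [← hv] at e ⊢
    exact (smul_eq_zero.1 e).resolve_left (pow_ne_zero _ (V.q_ne_zero 2 1))
  · have h2 := (V.χRoot_pow_eq_one_iff r32).1 h0 (V.g 2)
    have h3 : (V.χRoot r32 (V.g 2) : k) = V.q 2 2 * V.q 2 1 := by
      simp [χRoot_mul, coeff, q, mul_comm]
    rw [h3, mul_pow, hq, one_mul] at h2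
    rwa [h2, one_smul] at e

/-- The power of the opposite root vector, from that of `y_α` by the antipode; see
`opposite_r32_pow`. -/
lemma opposite_r3t2_pow (D : V.HopfData π) (hS : IsRealization.SatisfiesSerre V π)
    (hμ : V.Admissible μ) (hp : π (fy k Γ r3t2) ^ V.N = π (V.u μ r3t2)) :
    V.opp3t2 π ^ V.N = V.oppositeVal3t2 μ D.grpHom ∧
      (V.u μ r3t2 = 0 → V.opp3t2 π ^ V.N = 0) ∧
      ∀ δ, Commute (V.opp3t2 π ^ V.N) (π (fy k Γ δ)) := by
  have hq := V.isPrimitiveRoot.pow_eq_one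
  have h1 : (V.χRoot r3t2 (V.gRoot r3t2) : k) = V.q 2 2 ^ 2 := by
    have hb := V.q_ne_zero 2 1
    have hq0 := V.q_ne_zero 2 2
    simp [χRoot_gRoot, braidScalar, coeff, braidMatrix, Fin.prod_univ_three]
    field_simp
  have e := D.smul_pow_of_antipode (D.antipodeLinear_r3t2 hS)
    (D.opposite_r3t2_mul_fg_inv (V.gRoot r3t2)) (by rw [h1, pow_right_comm, hq, one_pow]) hp
  have hv : π (fg k (V.gRoot r3t2 ^ V.N)) * D.antipodeLinear (π (V.u μ r3t2)) =
      -V.oppositeVal3t2 μ D.grpHom := by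
    have hg : V.gRoot r3t2 ^ V.N * (V.gRoot r32 ^ V.N)⁻¹ = V.gRoot r3 ^ V.N := by
      rw [gRoot_add (V := V) (α := r3) (β := r32) (γ := r3t2) (by decide), mul_pow,
        mul_inv_cancel_right]
    have hg' : V.gRoot r3t2 ^ V.N * (V.gRoot r2 ^ V.N)⁻¹ = V.gRoot r3 ^ V.N * V.gRoot r3 ^ V.N := by
      rw [gRoot_add (V := V) (α := r3) (β := r32) (γ := r3t2) (by decide),
        gRoot_add (V := V) (α := r3) (β := r2) (γ := r32) (by decide), mul_pow, mul_pow,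
        ← mul_assoc, mul_inv_cancel_right]
    simp only [u, map_sub, map_add, map_smul, antipodeLinear_gpow, mul_sub, mul_add, mul_smul_comm,
      ← D.fg_mul, mul_inv_cancel, hg, hg', D.fg_one, mul_one]
    rw [oppositeVal3t2, neg_neg]
    rfl
  suffices h : V.opp3t2 π ^ V.N = V.oppositeVal3t2 μ D.grpHom ∧
      ∀ δ, Commute (V.opp3t2 π ^ V.N) (π (fy k Γ δ)) from
    ⟨h.1, fun h0 => by
      rw [h.1, ← neg_eq_zero, ← hv, h0, map_zero, map_zero, mul_zero], h.2⟩
  rcases hμ.u_eq_zero_or (γ := r3t2) (by simp) with h0 | h0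
  · rw [hv] at e
    rw [h0, map_zero, map_zero, mul_zero] at hv
    rw [← hv] at e
    have h2 := (smul_eq_zero.1 e).resolve_left (pow_ne_zero _ (neg_ne_zero.2 (mul_ne_zero
      (V.q_ne_zero 2 2) (pow_ne_zero _ (V.q_ne_zero 2 1)))))
    refine ⟨by rw [h2, ← neg_eq_zero.1 hv.symm], fun δ => ?_⟩
    rw [h2]
    exact Commute.zero_left _
  · have h2 := (V.χRoot_pow_eq_one_iff r3t2).1 h0 (V.g 2)
    have h3 : (V.χRoot r3t2 (V.g 2) : k) = V.q 2 2 ^ 2 * V.q 2 1 := by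
      simp [χRoot_mul, coeff, q, mul_comm]
    have hb : V.q 2 1 ^ V.N = 1 := by
      rw [h3, mul_pow, pow_right_comm, hq, one_pow, one_mul] at h2
      exact h2
    have hc : (-(V.q 2 2 * V.q 2 1 ^ 2)) ^ V.N = -1 := by
      rw [V.N_odd.neg_pow, mul_pow, hq, pow_right_comm, hb, one_pow, one_mul]
    rw [hc, neg_one_smul] at e
    refine ⟨?_, fun δ => ?_⟩
    · rwa [hv, neg_inj] at e
    · rw [← neg_neg (V.opp3t2 π ^ V.N), e]
      exact ((D.commute_fg_pow h0 δ).mul_left (D.commute_antipodeLinear_u hμ r3t2 δ)).neg_left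

end HopfData

end DatumB3

/-! ### The root vector relations are skew-primitive -/

namespace DatumB3

open PosRoot MulOpposite

variable {k Γ : Type*} [Field k] [CommGroup Γ] {V : DatumB3 k Γ} {μ : PosRoot → k}
  {A : Type*} [Ring A] [Algebra k A] {π : Free k Γ →ₐ[k] A}

/-- The stage at which the relation `y_α ^ N = u_α(μ)` is imposed. -/
def level : PosRoot → ℕ
  | r1 | r2 | r3 => 1
  | r21 | r32 => 2
  | r31 | r3t2 => 3
  | r3t1 => 4
  | r2t1 => 5

lemma ξ_one : V.ξ 1 = 1 - (V.q 2 2)⁻¹ := by rw [ξ, pow_one]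

lemma ξ_two : V.ξ 2 = 1 - (V.q 2 2 ^ 2)⁻¹ := rfl

namespace HopfData

open IsRealization

variable (D : V.HopfData π) (hS : SatisfiesSerre V π) (hμ : V.Admissible μ)

include hS

lemma isSkewPrimitive_power_simple (i : Fin 3) :
    D.IsSkewPrimitive (π (fy k Γ (simple i) ^ V.N) - π (V.u μ (simple i))) := by
  have B := D.b3Double hS
  have hq := V.isPrimitiveRoot
  refine D.isSkewPrimitive_of_mixed (m := 0) ?_ ?_
  · fin_cases i
    · exact (congrArg (· ^ V.N) B.z1).trans
        ((add_pow_of_qcomm (hq.sq_of_odd V.N_odd) V.one_lt_N B.br_1_1).trans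
          (by rw [add_zero]; rfl))
    · exact (congrArg (· ^ V.N) B.z2).trans
        ((add_pow_of_qcomm (hq.sq_of_odd V.N_odd) V.one_lt_N B.br_2_2).trans
          (by rw [add_zero]; rfl))
    · exact (congrArg (· ^ V.N) B.z3).trans
        ((add_pow_of_qcomm hq V.one_lt_N B.br_3_3).trans (by rw [add_zero]; rfl))
  · rw [comul_u, uVal_mul_simple, map_add, add_zero]

include hμ

lemma isSkewPrimitive_power_r21
    (hp : ∀ β, level β < 2 → π (fy k Γ β) ^ V.N = π (V.u μ β)) :
    D.IsSkewPrimitive (π (fy k Γ r21 ^ V.N) - π (V.u μ r21)) := by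
  have h1 := hp r1 (by decide)
  have h2 := hp r2 (by decide)
  refine D.isSkewPrimitive_of_mixed (m := D.pairHom (V.ξ 2 ^ V.N • (V.uVal μ (leftHom k Γ) r2 *
    (leftHom k Γ (V.gRoot r1 ^ V.N) * V.uVal μ (rightHom k Γ) r1)))) ?_ ?_
  · have e := (D.b3Double hS).pow_z21 V.isPrimitiveRoot V.one_lt_N V.N_odd
      (D.powerCentral_left hμ (by simp) h2)
    simp only [D.tmul_one_pow h2, D.fg_tmul_pow h1] at e
    rw [e]
    simp only [map_add, map_smul, map_mul, ξ_one, ξ_two, add_assoc]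
  · rw [comul_u, uVal_mul_r21, map_add, map_add]

lemma isSkewPrimitive_power_r32
    (hp : ∀ β, level β < 2 → π (fy k Γ β) ^ V.N = π (V.u μ β)) :
    D.IsSkewPrimitive (π (fy k Γ r32 ^ V.N) - π (V.u μ r32)) := by
  have h3 := hp r3 (by decide)
  have h2 := hp r2 (by decide)
  refine D.isSkewPrimitive_of_mixed (m := D.pairHom (V.ξ 2 ^ V.N • (V.uVal μ (leftHom k Γ) r3 *
    (leftHom k Γ (V.gRoot r2 ^ V.N) * V.uVal μ (rightHom k Γ) r2)))) ?_ ?_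
  · have e := (D.b3Double hS).pow_z32 V.isPrimitiveRoot V.one_lt_N V.N_odd
      (D.powerCentral_left hμ (by simp) h3)
    simp only [D.tmul_one_pow h3, D.fg_tmul_pow h2] at e
    rw [e]
    simp only [map_add, map_smul, map_mul, ξ_one, ξ_two, add_assoc]
  · rw [comul_u, uVal_mul_r32, map_add, map_add]

lemma isSkewPrimitive_power_r31
    (hp : ∀ β, level β < 3 → π (fy k Γ β) ^ V.N = π (V.u μ β)) :
    D.IsSkewPrimitive (π (fy k Γ r31 ^ V.N) - π (V.u μ r31)) := by
  have h1 := hp r1 (by decide)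
  have h3 := hp r3 (by decide)
  have h21 := hp r21 (by decide)
  have h32 := hp r32 (by decide)
  refine D.isSkewPrimitive_of_mixed (m := D.pairHom (
    V.ξ 2 ^ V.N • (V.uVal μ (leftHom k Γ) r32 *
      (leftHom k Γ (V.gRoot r1 ^ V.N) * V.uVal μ (rightHom k Γ) r1)) +
    V.ξ 2 ^ V.N • (V.uVal μ (leftHom k Γ) r3 *
      (leftHom k Γ (V.gRoot r21 ^ V.N) * V.uVal μ (rightHom k Γ) r21)))) ?_ ?_
  · have e := (D.b3Double hS).pow_z31 V.isPrimitiveRoot V.one_lt_N V.N_odd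
      (D.powerCentral_left hμ (by simp) h3) (D.powerCentral_left hμ (by simp) h32)
    simp only [D.tmul_one_pow h3, D.tmul_one_pow h32, D.fg_tmul_pow h1, D.fg_tmul_pow h21] at e
    rw [e]
    simp only [map_add, map_smul, map_mul, ξ_one, ξ_two, add_assoc]
  · rw [comul_u, uVal_mul_r31]
    simp only [map_add, add_assoc]

lemma isSkewPrimitive_power_r3t2
    (hp : ∀ β, level β < 3 → π (fy k Γ β) ^ V.N = π (V.u μ β)) :
    D.IsSkewPrimitive (π (fy k Γ r3t2 ^ V.N) - π (V.u μ r3t2)) := by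
  have h2 := hp r2 (by decide)
  have h3 := hp r3 (by decide)
  have h32 := hp r32 (by decide)
  refine D.isSkewPrimitive_of_mixed (m := D.pairHom (
    (V.ξ 1 ^ V.N * V.ξ 2 ^ V.N) • (V.uVal μ (leftHom k Γ) r3 * V.uVal μ (leftHom k Γ) r3 *
      (leftHom k Γ (V.gRoot r2 ^ V.N) * V.uVal μ (rightHom k Γ) r2)) +
    (2 * V.ξ 1 ^ V.N) • (V.uVal μ (leftHom k Γ) r3 *
      (leftHom k Γ (V.gRoot r32 ^ V.N) * V.uVal μ (rightHom k Γ) r32)))) ?_ ?_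
  · have e := (D.b3Double hS).pow_z3t2 V.isPrimitiveRoot V.one_lt_N V.N_odd
      (D.powerCentral_left hμ (by simp) h3)
    simp only [D.tmul_one_pow h3, D.fg_tmul_pow h2, D.fg_tmul_pow h32] at e
    rw [e]
    simp only [map_add, map_smul, map_mul, ξ_one, ξ_two, add_assoc]
  · rw [comul_u, uVal_mul_r3t2]
    simp only [map_add, add_assoc]

lemma isSkewPrimitive_power_r3t1
    (hp : ∀ β, level β < 4 → π (fy k Γ β) ^ V.N = π (V.u μ β)) :
    D.IsSkewPrimitive (π (fy k Γ r3t1 ^ V.N) - π (V.u μ r3t1)) := by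
  have h1 := hp r1 (by decide)
  have h3 := hp r3 (by decide)
  have h21 := hp r21 (by decide)
  have h31 := hp r31 (by decide)
  have h3t2 := hp r3t2 (by decide)
  refine D.isSkewPrimitive_of_mixed (m := D.pairHom (
    V.ξ 2 ^ V.N • (V.uVal μ (leftHom k Γ) r3t2 *
      (leftHom k Γ (V.gRoot r1 ^ V.N) * V.uVal μ (rightHom k Γ) r1)) +
    (V.ξ 1 ^ V.N * V.ξ 2 ^ V.N) • (V.uVal μ (leftHom k Γ) r3 * V.uVal μ (leftHom k Γ) r3 *
      (leftHom k Γ (V.gRoot r21 ^ V.N) * V.uVal μ (rightHom k Γ) r21)) +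
    (2 * V.ξ 1 ^ V.N) • (V.uVal μ (leftHom k Γ) r3 *
      (leftHom k Γ (V.gRoot r31 ^ V.N) * V.uVal μ (rightHom k Γ) r31)))) ?_ ?_
  · have e := (D.b3Double hS).pow_z3t1 V.isPrimitiveRoot V.one_lt_N V.N_odd
      (D.powerCentral_left hμ (by simp) h3) (D.powerCentral_left hμ (by simp) h3t2)
    simp only [D.tmul_one_pow h3, D.tmul_one_pow h3t2, D.fg_tmul_pow h1, D.fg_tmul_pow h21,
      D.fg_tmul_pow h31] at e
    rw [e]
    simp only [map_add, map_smul, map_mul, ξ_one, ξ_two, add_assoc]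
  · rw [comul_u, uVal_mul_r3t1]
    simp only [map_add, add_assoc]

lemma isSkewPrimitive_power_r2t1
    (hp : ∀ β, level β < 5 → π (fy k Γ β) ^ V.N = π (V.u μ β)) :
    D.IsSkewPrimitive (π (fy k Γ r2t1 ^ V.N) - π (V.u μ r2t1)) := by
  have h1 := hp r1 (by decide)
  have h2 := hp r2 (by decide)
  have h21 := hp r21 (by decide)
  have h32 := hp r32 (by decide)
  have h31 := hp r31 (by decide)
  have h3t2 := hp r3t2 (by decide)
  have h3t1 := hp r3t1 (by decide)
  have hZ : oppositeR32 (V.q 2 2) (V.q 2 1) (fun α => π (fy k Γ α) ⊗ₜ[k] (1 : A)) =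
      Algebra.TensorProduct.includeLeft (S := k) (B := A) (V.opp32 π) := by
    simp [oppositeR32, opp32, TensorProduct.sub_tmul, TensorProduct.smul_tmul']
  have hW : oppositeR3t2 (V.q 2 2) (V.q 2 1) (fun α => π (fy k Γ α) ⊗ₜ[k] (1 : A)) =
      Algebra.TensorProduct.includeLeft (S := k) (B := A) (V.opp3t2 π) := by
    rw [oppositeR3t2, hZ]
    simp [oppositeR3t2, TensorProduct.sub_tmul, TensorProduct.smul_tmul']
  have hZN : oppositeR32 (V.q 2 2) (V.q 2 1) (fun α => π (fy k Γ α) ⊗ₜ[k] (1 : A)) ^ V.N =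
      D.pairHom (V.oppositeVal32 μ (leftHom k Γ)) := by
    rw [hZ, ← map_pow, (D.opposite_r32_pow hS hμ h32).1]
    simp only [oppositeVal32, map_sub, map_smul, map_one, D.pairHom_left]
    rfl
  have hWN : oppositeR3t2 (V.q 2 2) (V.q 2 1) (fun α => π (fy k Γ α) ⊗ₜ[k] (1 : A)) ^ V.N =
      D.pairHom (V.oppositeVal3t2 μ (leftHom k Γ)) := by
    rw [hW, ← map_pow, (D.opposite_r3t2_pow hS hμ h3t2).1]
    simp only [oppositeVal3t2, map_neg, map_add, map_sub, map_smul, map_one, D.pairHom_left]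
    rfl
  refine D.isSkewPrimitive_of_mixed (m := D.pairHom (
    (V.ξ 2 ^ V.N * V.ξ 2 ^ V.N) • (V.uVal μ (leftHom k Γ) r2 * (V.uVal μ (leftHom k Γ) r3t2 *
      (leftHom k Γ (V.gRoot r1 ^ V.N) * V.uVal μ (rightHom k Γ) r1))) -
    (V.ξ 1 ^ V.N * V.ξ 2 ^ V.N) • (V.uVal μ (leftHom k Γ) r32 * V.uVal μ (leftHom k Γ) r32 *
      (leftHom k Γ (V.gRoot r1 ^ V.N) * V.uVal μ (rightHom k Γ) r1)) +
    V.ξ 2 ^ V.N • (V.oppositeVal3t2 μ (leftHom k Γ) *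
      (leftHom k Γ (V.gRoot r21 ^ V.N) * V.uVal μ (rightHom k Γ) r21)) +
    (2 * V.ξ 1 ^ V.N) • (V.oppositeVal32 μ (leftHom k Γ) *
      (leftHom k Γ (V.gRoot r31 ^ V.N) * V.uVal μ (rightHom k Γ) r31)) +
    V.ξ 2 ^ V.N • (V.uVal μ (leftHom k Γ) r2 *
      (leftHom k Γ (V.gRoot r3t1 ^ V.N) * V.uVal μ (rightHom k Γ) r3t1)))) ?_ ?_
  · have hbr : ∀ {γ}, V.χRoot γ ^ V.N = 1 → ∀ δ,
        braidScalar (V.q 2 2) (V.q 1 0) (V.q 2 1) (V.q 2 0) δ γ ^ V.N = 1 := fun h δ => by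
      rw [← χRoot_gRoot, (V.χRoot_pow_eq_one_iff _).1 h]
    have hZ0 : oppositeR32 (V.q 2 2) (V.q 2 1) (fun α => π (fy k Γ α) ⊗ₜ[k] (1 : A)) ^ V.N = 0 ∨
        ∀ δ, braidScalar (V.q 2 2) (V.q 1 0) (V.q 2 1) (V.q 2 0) δ r32 ^ V.N = 1 := by
      refine (hμ.u_eq_zero_or (γ := r32) (by simp)).imp (fun h => ?_) hbr
      rw [hZ, ← map_pow, (D.opposite_r32_pow hS hμ h32).2 h, map_zero]
    have hW0 : oppositeR3t2 (V.q 2 2) (V.q 2 1) (fun α => π (fy k Γ α) ⊗ₜ[k] (1 : A)) ^ V.N = 0 ∨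
        ∀ δ, braidScalar (V.q 2 2) (V.q 1 0) (V.q 2 1) (V.q 2 0) δ r3t2 ^ V.N = 1 := by
      refine (hμ.u_eq_zero_or (γ := r3t2) (by simp)).imp (fun h => ?_) hbr
      rw [hW, ← map_pow, (D.opposite_r3t2_pow hS hμ h3t2).2.1 h, map_zero]
    have hWc : ∀ δ, oppositeR3t2 (V.q 2 2) (V.q 2 1) (fun α => π (fy k Γ α) ⊗ₜ[k] (1 : A)) ^ V.N *
        (π (fy k Γ δ) ⊗ₜ[k] (1 : A)) = (π (fy k Γ δ) ⊗ₜ[k] (1 : A)) *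
        oppositeR3t2 (V.q 2 2) (V.q 2 1) (fun α => π (fy k Γ α) ⊗ₜ[k] (1 : A)) ^ V.N := by
      intro δ
      rw [hW, ← map_pow]
      exact (((D.opposite_r3t2_pow hS hμ h3t2).2.2 δ).map
        (Algebra.TensorProduct.includeLeft (S := k) (B := A))).eq
    have e := (D.b3Double hS).pow_z2t1 V.isPrimitiveRoot V.one_lt_N V.N_odd
      (D.powerCentral_left hμ (by simp) h2) (D.powerCentral_left hμ (by simp) h32)
      (D.powerCentral_left hμ (by simp) h3t2) (D.powerCentral_left hμ (by simp) h3t1)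
      (D.powerCentral_right hμ (by simp) h3t1) hZ0 hW0 hWc
    simp only [hZN, hWN, D.tmul_one_pow h2, D.tmul_one_pow h32, D.tmul_one_pow h3t2,
      D.fg_tmul_pow h1, D.fg_tmul_pow h21, D.fg_tmul_pow h31, D.fg_tmul_pow h3t1] at e
    rw [e]
    simp only [map_add, map_sub, map_smul, map_mul, ξ_one, ξ_two]
    abel
  · rw [comul_u, uVal_mul_r2t1]
    simp only [map_add, map_sub]
    abel

/-- In a realization with Hopf structure maps, the relation `y_α ^ N = u_α(μ)` is skew-primitive as
soon as the corresponding relations for the roots of lower level hold. -/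
lemma isSkewPrimitive_power (α : PosRoot)
    (hp : ∀ β, level β < level α → π (fy k Γ β) ^ V.N = π (V.u μ β)) :
    D.IsSkewPrimitive (π (fy k Γ α ^ V.N) - π (V.u μ α)) := by
  cases α
  · exact D.isSkewPrimitive_power_simple hS 0
  · exact D.isSkewPrimitive_power_simple hS 1
  · exact D.isSkewPrimitive_power_simple hS 2
  · exact D.isSkewPrimitive_power_r21 hS hμ hp
  · exact D.isSkewPrimitive_power_r32 hS hμ hp
  · exact D.isSkewPrimitive_power_r31 hS hμ hp
  · exact D.isSkewPrimitive_power_r3t2 hS hμ hp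
  · exact D.isSkewPrimitive_power_r3t1 hS hμ hp
  · exact D.isSkewPrimitive_power_r2t1 hS hμ hp

end HopfData

/-- The relations imposed up to stage `n`: the power relations of level at most `n`. -/
inductive StageRel (V : DatumB3 k Γ) (μ : PosRoot → k) (n : ℕ) : Free k Γ → Free k Γ → Prop
  | base (a b : Free k Γ) (h : V.BaseRel a b) : StageRel V μ n a b
  | serre (i j : Fin 3) (hij : i ≠ j) : StageRel V μ n (V.adPow i j (1 - cartanB3 i j).toNat) 0
  | power (α : PosRoot) (hα : level α ≤ n) : StageRel V μ n (fy k Γ α ^ V.N) (V.u μ α)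

lemma satisfiesSerre_stageRel (n : ℕ) :
    IsRealization.SatisfiesSerre V (RingQuot.mkAlgHom k (V.StageRel μ n)) := fun i j hij => by
  rw [RingQuot.mkAlgHom_rel k (StageRel.serre i j hij), map_zero]

/-- After the last stage all relations are imposed. -/
lemma stageRel_five : V.StageRel μ 5 = V.Rel μ := by
  ext a b
  constructor
  · rintro (⟨_, _, h⟩ | ⟨i, j, hij⟩ | ⟨α, -⟩)
    · cases h <;> constructor
    · exact .serre i j hij
    · exact .power α
  · intro h
    cases h
    case serre i j hij => exact .serre i j hij
    case power α => exact .power α (by cases α <;> decide)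
    all_goals exact .base _ _ (by constructor)

lemma nonempty_hopfData_stageRel (hμ : V.Admissible μ) (n : ℕ) :
    Nonempty (V.HopfData (RingQuot.mkAlgHom k (V.StageRel μ n))) := by
  induction n with
  | zero =>
    refine ⟨V.baseHopfData.extend (fun a b h => .base a b h) fun a b h => ?_⟩
    rcases h with ⟨_, _, h⟩ | ⟨i, j, hij⟩ | ⟨α, hα⟩
    · exact .inl h
    · right
      rw [map_zero, sub_zero]
      exact V.baseHopfData.isSkewPrimitive_adPow hij
    · cases α <;> simp [level] at hα
  | succ n ih =>
    obtain ⟨D⟩ := ih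
    refine ⟨D.extend ?_ fun a b h => ?_⟩
    · rintro a b (⟨_, _, h⟩ | ⟨i, j, hij⟩ | ⟨α, hα⟩)
      · exact .base _ _ h
      · exact .serre i j hij
      · exact .power α (hα.trans n.le_succ)
    rcases h with ⟨_, _, h⟩ | ⟨i, j, hij⟩ | ⟨α, hα⟩
    · exact .inl (.base _ _ h)
    · exact .inl (.serre i j hij)
    · right
      refine D.isSkewPrimitive_power (satisfiesSerre_stageRel n) hμ α fun β hβ => ?_
      rw [← map_pow]
      exact RingQuot.mkAlgHom_rel k (.power β (by omega))

/-- The Hopf structure maps on `A(Γ, V, μ)`. -/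
lemma nonempty_hopfData (hμ : V.Admissible μ) :
    Nonempty (V.HopfData (RingQuot.mkAlgHom k (V.Rel μ))) := by
  rw [← stageRel_five]
  exact nonempty_hopfData_stageRel hμ 5

end DatumB3

/-! ### Pointedness -/

section Pointed

variable {k : Type*} [Field k]

section Coalgebra

variable {C : Type*} [AddCommGroup C] [Module k C] [Coalgebra k C]

/-- The left contraction of the comultiplication by a linear form. -/
def comulContract (f : C →ₗ[k] k) : C →ₗ[k] C :=
  (TensorProduct.lid k C).toLinearMap ∘ₗ f.rTensor C ∘ₗ Coalgebra.comul

lemma comulContract_mem {D : Submodule k C} (hD : IsSubcoalgebra k D) (f : C →ₗ[k] k) {d : C}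
    (hd : d ∈ D) : comulContract f d ∈ D := by
  obtain ⟨t, ht⟩ := hD d hd
  rw [comulContract, LinearMap.comp_apply, LinearMap.comp_apply, ← ht]
  clear ht
  induction t with
  | zero => simp
  | tmul a b => simpa using D.smul_mem _ b.2
  | add s t hs ht =>
    rw [map_add, map_add, map_add]
    exact D.add_mem hs ht

lemma counit_comulContract (f : C →ₗ[k] k) (d : C) :
    Coalgebra.counit (R := k) (comulContract f d) = f d := by
  have h1 : ∀ t : C ⊗[k] C, Coalgebra.counit (R := k)
      ((TensorProduct.lid k C) (f.rTensor C t)) =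
      f ((TensorProduct.rid k C) ((Coalgebra.counit (R := k)).lTensor C t)) := by
    intro t
    induction t with
    | zero => simp
    | tmul a b => simp [mul_comm]
    | add s t hs ht => simp only [map_add, hs, ht]
  change Coalgebra.counit (R := k)
      ((TensorProduct.lid k C) (f.rTensor C (Coalgebra.comul d))) = _
  rw [h1, Coalgebra.lTensor_counit_comul]
  simp

lemma comulContract_of_isGroupLikeElem (f : C →ₗ[k] k) {g : C} (hg : IsGroupLikeElem k g) :
    comulContract f g = f g • g := by
  simp [comulContract, hg.comul_eq_tmul_self]

/-- A subcoalgebra that meets the span of the group-like elements contains a group-like element. -/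
lemma exists_isGroupLikeElem_mem {D : Submodule k C} (hD : IsSubcoalgebra k D) {d : C}
    (hd : d ∈ D) (hd0 : d ≠ 0) (hdM : d ∈ Submodule.span k {g : C | IsGroupLikeElem k g}) :
    ∃ g ∈ D, IsGroupLikeElem k g := by
  have hli : LinearIndependent k (Subtype.val : {g : C | IsGroupLikeElem k g} → C) :=
    linearIndepOn_isGroupLikeElem
  rw [← Subtype.range_coe (s := {g : C | IsGroupLikeElem k g}),
    Finsupp.mem_span_range_iff_exists_finsupp] at hdM
  obtain ⟨l, hl⟩ := hdM
  obtain ⟨i, hi⟩ : ∃ i, l i ≠ 0 := by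
    by_contra! h
    exact hd0 (by rw [← hl, Finsupp.ext (g := 0) h, Finsupp.sum_zero_index])
  obtain ⟨f, hf⟩ := LinearMap.exists_extend ((Finsupp.lapply i).comp hli.repr)
  have hf' : ∀ j, f j.1 = Finsupp.single j (1 : k) i := by
    intro j
    have h1 := LinearMap.congr_fun hf ⟨j.1, Submodule.subset_span ⟨j, rfl⟩⟩
    rw [LinearMap.comp_apply, Submodule.subtype_apply] at h1
    rw [h1, LinearMap.comp_apply]
    exact DFunLike.congr_fun (hli.repr_eq_single j _ rfl) i
  have h2 : comulContract f d = l i • i.1 := by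
    rw [← hl, Finsupp.sum, map_sum, Finset.sum_eq_single i]
    · rw [map_smul, comulContract_of_isGroupLikeElem f i.2, hf', Finsupp.single_eq_same, one_smul]
    · intro j _ hj
      rw [map_smul, comulContract_of_isGroupLikeElem f j.2, hf', Finsupp.single_eq_of_ne hj.symm,
        zero_smul, smul_zero]
    · intro h
      rw [Finsupp.notMem_support_iff.1 h, zero_smul, map_zero]
  have h3 := comulContract_mem hD f hd
  rw [h2] at h3
  exact ⟨i.1, (D.smul_mem_iff hi).1 h3, i.2⟩

lemma IsSimpleSubcoalgebra.finrank_eq_one {D : Submodule k C} (hD : IsSimpleSubcoalgebra k D)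
    {g : C} (hg : IsGroupLikeElem k g) (hgD : g ∈ D) : Module.finrank k D = 1 := by
  have h1 : IsSubcoalgebra k (Submodule.span k {g}) := by
    intro d hd
    obtain ⟨c, rfl⟩ := Submodule.mem_span_singleton.1 hd
    refine ⟨c • (⟨g, Submodule.mem_span_singleton_self g⟩ ⊗ₜ
      ⟨g, Submodule.mem_span_singleton_self g⟩), ?_⟩
    simp [hg.comul_eq_tmul_self]
  rcases hD.2.2 _ h1 (by simpa using hgD) with h | h
  · exact absurd (Submodule.span_singleton_eq_bot.1 h) hg.ne_zero
  · rw [← h, finrank_span_singleton hg.ne_zero]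

end Coalgebra

section Bialgebra

variable {H : Type*} [Ring H] [Bialgebra k H]

/-- The tensor product of two subspaces, as a subspace. -/
def tensorSubmodule (P Q : Submodule k H) : Submodule k (H ⊗[k] H) :=
  Submodule.span k (Set.image2 (fun a b => a ⊗ₜ[k] b) P Q)

lemma tmul_mem_tensorSubmodule {P Q : Submodule k H} {a b : H} (ha : a ∈ P) (hb : b ∈ Q) :
    a ⊗ₜ[k] b ∈ tensorSubmodule P Q :=
  Submodule.subset_span ⟨a, ha, b, hb, rfl⟩

lemma tensorSubmodule_mul_le {P Q P' Q' P'' Q'' : Submodule k H} (hP : P * P' ≤ P'')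
    (hQ : Q * Q' ≤ Q'') :
    tensorSubmodule P Q * tensorSubmodule P' Q' ≤ tensorSubmodule P'' Q'' := by
  rw [tensorSubmodule, tensorSubmodule, Submodule.span_mul_span, Submodule.span_le]
  rintro _ ⟨_, ⟨a, ha, b, hb, rfl⟩, _, ⟨c, hc, d, hd, rfl⟩, rfl⟩
  change a ⊗ₜ[k] b * c ⊗ₜ[k] d ∈ tensorSubmodule P'' Q''
  rw [Algebra.TensorProduct.tmul_mul_tmul]
  exact tmul_mem_tensorSubmodule (hP (Submodule.mul_mem_mul ha hc))
    (hQ (Submodule.mul_mem_mul hb hd))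

variable (k H) in
/-- The span of the group-like elements. -/
def groupLikeSpan : Submodule k H := Submodule.span k {g : H | IsGroupLikeElem k g}

lemma groupLikeSpan_mul_le : groupLikeSpan k H * groupLikeSpan k H ≤ groupLikeSpan k H := by
  rw [groupLikeSpan, Submodule.span_mul_span, Submodule.span_le]
  rintro _ ⟨a, ha, b, hb, rfl⟩
  exact Submodule.subset_span (IsGroupLikeElem.mul ha hb)

/-- The powers of a space `Q` spanned by group-likes and skew-primitives behave as the coradical
filtration under the comultiplication. -/
lemma comul_mem_of_mem_pow {Q : Submodule k H} (h1 : 1 ∈ Q)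
    (hQ : ∀ a ∈ Q, Coalgebra.comul (R := k) a ∈
      tensorSubmodule (groupLikeSpan k H) Q ⊔ tensorSubmodule ⊤ 1) (n : ℕ) :
    ∀ a ∈ Q ^ (n + 1), Coalgebra.comul (R := k) a ∈
      tensorSubmodule (groupLikeSpan k H) (Q ^ (n + 1)) ⊔ tensorSubmodule ⊤ (Q ^ n) := by
  have hQ1 : (1 : Submodule k H) ≤ Q := Submodule.one_le.2 h1
  induction n with
  | zero => simpa using hQ
  | succ n ih =>
    intro a ha
    rw [pow_succ] at ha
    induction ha using Submodule.mul_induction_on' with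
    | mem_mul_mem a ha b hb =>
      rw [Bialgebra.comul_mul]
      have h2 := Submodule.mul_mem_mul (ih a ha) (hQ b hb)
      refine SetLike.le_def.1 ?_ h2
      rw [Submodule.sup_mul, Submodule.mul_sup, Submodule.mul_sup]
      refine sup_le (sup_le ?_ ?_) (sup_le ?_ ?_)
      · exact (tensorSubmodule_mul_le groupLikeSpan_mul_le (pow_succ Q (n + 1)).ge).trans
          le_sup_left
      · exact (tensorSubmodule_mul_le le_top (mul_one _).le).trans le_sup_right
      · exact (tensorSubmodule_mul_le le_top (pow_succ Q n).ge).trans le_sup_right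
      · refine (tensorSubmodule_mul_le le_top ?_).trans le_sup_right
        rw [pow_succ]
        exact mul_le_mul' le_rfl hQ1
    | add a _ b _ ha hb =>
      rw [map_add]
      exact Submodule.add_mem _ ha hb

/-- A bialgebra generated by group-like and skew-primitive elements is pointed. -/
theorem isPointedCoalgebra_of_adjoin_eq_top {P : Set H}
    (hP : ∀ p ∈ P, ∃ g, IsGroupLikeElem k g ∧
      Coalgebra.comul (R := k) p = p ⊗ₜ[k] 1 + g ⊗ₜ[k] p)
    (hgen : Algebra.adjoin k ({g : H | IsGroupLikeElem k g} ∪ P) = ⊤) :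
    IsPointedCoalgebra k H := by
  set G := {g : H | IsGroupLikeElem k g} with hG
  set Q := Submodule.span k (G ∪ P) with hQdef
  have h1 : (1 : H) ∈ Q := Submodule.subset_span (.inl IsGroupLikeElem.one)
  have hQ1 : (1 : Submodule k H) ≤ Q := Submodule.one_le.2 h1
  have hQ : ∀ a ∈ Q, Coalgebra.comul (R := k) a ∈
      tensorSubmodule (groupLikeSpan k H) Q ⊔ tensorSubmodule ⊤ 1 := by
    intro a ha
    have : Q ≤ (tensorSubmodule (groupLikeSpan k H) Q ⊔ tensorSubmodule ⊤ 1).comap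
        (Coalgebra.comul (R := k)) := by
      refine Submodule.span_le.2 ?_
      rintro a (ha | ha)
      · rw [SetLike.mem_coe, Submodule.mem_comap, IsGroupLikeElem.comul_eq_tmul_self ha]
        exact Submodule.mem_sup_left (tmul_mem_tensorSubmodule (Submodule.subset_span ha)
          (Submodule.subset_span (.inl ha)))
      · obtain ⟨g, hg, h⟩ := hP a ha
        rw [SetLike.mem_coe, Submodule.mem_comap, h, add_comm]
        exact Submodule.add_mem_sup (tmul_mem_tensorSubmodule (Submodule.subset_span hg)
          (Submodule.subset_span (.inr ha))) (tmul_mem_tensorSubmodule trivial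
            (Submodule.one_le.1 le_rfl))
    exact this ha
  have hmono : Monotone fun n : ℕ => Q ^ n :=
    monotone_nat_of_le_succ fun n => by
      rw [pow_succ]
      exact le_mul_of_one_le_right' hQ1
  have hex : ∀ a : H, ∃ n : ℕ, a ∈ Q ^ n := by
    intro a
    have ha : a ∈ Algebra.adjoin k (G ∪ P) := hgen ▸ Algebra.mem_top
    induction ha using Algebra.adjoin_induction with
    | mem x hx => exact ⟨1, by rw [pow_one]; exact Submodule.subset_span hx⟩
    | algebraMap r => exact ⟨0, by rw [pow_zero]; exact Submodule.algebraMap_mem r⟩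
    | add x y _ _ hx hy =>
      obtain ⟨m, hm⟩ := hx
      obtain ⟨n, hn⟩ := hy
      exact ⟨max m n, Submodule.add_mem _ (hmono (le_max_left m n) hm)
        (hmono (le_max_right m n) hn)⟩
    | mul x y _ _ hx hy =>
      obtain ⟨m, hm⟩ := hx
      obtain ⟨n, hn⟩ := hy
      exact ⟨m + n, by rw [pow_add]; exact Submodule.mul_mem_mul hm hn⟩
  intro D hD
  -- A nonzero element of `D` of least degree is a combination of group-like elements.
  have hne : ∃ n : ℕ, ∃ d ∈ D, d ≠ 0 ∧ d ∈ Q ^ n := by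
    obtain ⟨d, hd, hd0⟩ := (Submodule.ne_bot_iff D).1 hD.2.1
    obtain ⟨n, hn⟩ := hex d
    exact ⟨n, d, hd, hd0, hn⟩
  classical
  obtain ⟨d, hd, hd0, hdn⟩ := Nat.find_spec hne
  have hmin : ∀ m < Nat.find hne, ∀ d ∈ D, d ∈ Q ^ m → d = 0 := by
    intro m hm d hd hdm
    by_contra h0
    exact Nat.find_min hne hm ⟨d, hd, h0, hdm⟩
  generalize Nat.find hne = n at hdn hmin
  have hdM : d ∈ groupLikeSpan k H := by
    rcases n with _ | n
    · rw [pow_zero, Submodule.mem_one] at hdn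
      obtain ⟨r, rfl⟩ := hdn
      rw [Algebra.algebraMap_eq_smul_one]
      exact Submodule.smul_mem _ _ (Submodule.subset_span IsGroupLikeElem.one)
    · by_contra hdM
      obtain ⟨f, hfd, hf⟩ := Submodule.exists_le_ker_of_notMem hdM
      -- A linear form that vanishes on the group-likes lowers the filtration degree.
      have h2 : comulContract f d ∈ Q ^ n := by
        have h3 : tensorSubmodule (groupLikeSpan k H) (Q ^ (n + 1)) ⊔ tensorSubmodule ⊤ (Q ^ n) ≤
            (Q ^ n).comap ((TensorProduct.lid k H).toLinearMap ∘ₗ f.rTensor H) := by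
          refine sup_le (Submodule.span_le.2 ?_) (Submodule.span_le.2 ?_)
          · rintro _ ⟨a, ha, b, -, rfl⟩
            have : f a = 0 := hf ha
            simp [this]
          · rintro _ ⟨a, -, b, hb, rfl⟩
            simpa using Submodule.smul_mem _ (f a) hb
        exact h3 (comul_mem_of_mem_pow h1 hQ n d hdn)
      have h4 := hmin n n.lt_succ_self _ (comulContract_mem hD.1 f hd) h2
      have h5 := counit_comulContract f d
      rw [h4, map_zero] at h5
      exact hfd h5.symm
  obtain ⟨g, hgD, hg⟩ := exists_isGroupLikeElem_mem hD.1 hd hd0 hdM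
  exact hD.finrank_eq_one hg hgD

end Bialgebra

end Pointed

/-! ### Uniqueness of the Hopf structure and conclusion -/

section Uniqueness

variable {k A : Type*} [CommSemiring k] [Semiring A]

/-- The counit of a coalgebra is determined by the comultiplication. -/
lemma Coalgebra.counit_eq_of_comul_eq {C : Type*} [AddCommMonoid C] [Module k C]
    (c c' : Coalgebra k C) (h : c.comul = c'.comul) : c.counit = c'.counit := by
  ext x
  have e1 : ∀ t : C ⊗[k] C, c.counit ((_root_.TensorProduct.rid k C) (c'.counit.lTensor C t)) =
      c'.counit ((_root_.TensorProduct.lid k C) (c.counit.rTensor C t)) := by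
    intro t
    induction t with
    | zero => simp
    | tmul a b => simp [mul_comm]
    | add s t hs ht => simp only [map_add, hs, ht]
  have h1 := LinearMap.congr_fun c.rTensor_counit_comp_comul x
  have h2 := LinearMap.congr_fun c'.lTensor_counit_comp_comul x
  have e2 := e1 (c.comul x)
  rw [LinearMap.comp_apply] at h1 h2
  rw [h1, h, h2] at e2
  simpa using e2

open WithConv LinearMap in
/-- A left and a right antipode coincide, as inverses of the identity under convolution. -/
lemma antipode_unique [Bialgebra k A] {S S' : A →ₗ[k] A}
    (h : LinearMap.mul' k A ∘ₗ S.rTensor A ∘ₗ Coalgebra.comul =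
      Algebra.linearMap k A ∘ₗ Coalgebra.counit)
    (h' : LinearMap.mul' k A ∘ₗ S'.lTensor A ∘ₗ Coalgebra.comul =
      Algebra.linearMap k A ∘ₗ Coalgebra.counit) : S = S' := by
  have e : toConv S * toConv LinearMap.id = 1 := by
    ext x
    exact LinearMap.congr_fun h x
  have e' : toConv LinearMap.id * toConv S' = 1 := by
    ext x
    exact LinearMap.congr_fun h' x
  exact toConv_injective (left_inv_eq_right_inv e e')

/-- A Hopf algebra structure is determined by the underlying algebra and the comultiplication. -/
lemma HopfAlgebra.eq_of_comul_eq (H H' : HopfAlgebra k A) (halg : H.toAlgebra = H'.toAlgebra)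
    (hcomul : HEq H.comul H'.comul) : H = H' := by
  rcases H with @⟨@⟨@⟨alg, coalg, h1, h2, h3, h4⟩, S⟩, hl, hr⟩
  rcases H' with @⟨@⟨@⟨alg', coalg', h1', h2', h3', h4'⟩, S'⟩, hl', hr'⟩
  cases halg
  have hε := Coalgebra.counit_eq_of_comul_eq coalg coalg' (eq_of_heq hcomul)
  rcases coalg with @⟨⟨Δ, ε⟩, c1, c2, c3⟩
  rcases coalg' with @⟨⟨Δ', ε'⟩, _, _, _⟩
  obtain rfl : Δ = Δ' := eq_of_heq hcomul
  obtain rfl : ε = ε' := hε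
  obtain rfl : S = S' :=
    letI : Bialgebra k A :=
      { toAlgebra := alg, comul := Δ, counit := ε, coassoc := c1, rTensor_counit_comp_comul := c2,
        lTensor_counit_comp_comul := c3, counit_one := h1,
        mul_compr₂_counit := h2, comul_one := h3, mul_compr₂_comul := h4 }
    antipode_unique hl hr'
  rfl

end Uniqueness

namespace DatumB3

open PosRoot

variable {k Γ : Type*} [Field k] [CommGroup Γ] {V : DatumB3 k Γ} {μ : PosRoot → k}

/-- A Hopf structure with the prescribed coproducts of the generators has the comultiplication of
`D`, as both are algebra homomorphisms. -/
lemma HopfData.toHopfAlgebra_unique (D : V.HopfData (RingQuot.mkAlgHom k (V.Rel μ)))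
    (H' : HopfAlgebra k (V.A μ)) (h : V.IsHopfStructure μ H') : H' = D.toHopfAlgebra := by
  obtain ⟨halg, hΔ⟩ := h
  refine HopfAlgebra.eq_of_comul_eq _ _ halg ?_
  rcases H' with @⟨@⟨@⟨alg, coalg, h1, h2, h3, h4⟩, S⟩, h5, h6⟩
  cases halg
  apply heq_of_eq
  letI : Bialgebra k (V.A μ) :=
    { toCoalgebra := coalg, counit_one := h1, mul_compr₂_counit := h2, comul_one := h3,
      mul_compr₂_comul := h4 }
  have := D.algHom_ext (f := Bialgebra.comulAlgHom k (V.A μ)) (f' := D.comul)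
    (fun h => (hΔ.1 h).trans (D.comul_grp h).symm)
    (fun i => (hΔ.2 i).trans (D.comul_simple i).symm)
  exact congrArg AlgHom.toLinearMap this

end DatumB3

theorem proposition4 {k Γ : Type*} [Field k] [IsAlgClosed k] [CharZero k] [CommGroup Γ] [Finite Γ]
    (V : DatumB3 k Γ) (μ : PosRoot → k) (hμ : V.Admissible μ) :
    ∃ H : HopfAlgebra k (V.A μ),
      V.IsHopfStructure μ H ∧
      IsPointedHopfAlgebra k (V.A μ) ∧
      DatumB3.AreGroupLike k (V.grp μ) ∧
      ∀ H' : HopfAlgebra k (V.A μ), V.IsHopfStructure μ H' → H' = H := by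
  obtain ⟨D⟩ := DatumB3.nonempty_hopfData hμ
  have hg : ∀ h, @IsGroupLikeElem k (V.A μ) _ _ _ D.toHopfAlgebra.toCoalgebra (V.grp μ h) :=
    fun h => @IsGroupLikeElem.mk k (V.A μ) _ _ _ D.toHopfAlgebra.toCoalgebra _
      (D.counit_grp h) (D.comul_grp h)
  refine ⟨D.toHopfAlgebra, ⟨rfl, D.comul_grp, D.comul_simple⟩, ?_, hg, D.toHopfAlgebra_unique⟩
  letI := D.toHopfAlgebra
  refine isPointedCoalgebra_of_adjoin_eq_top
    (P := Set.range fun i => V.y μ (PosRoot.simple i)) ?_ ?_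
  · rintro _ ⟨i, rfl⟩
    exact ⟨V.grp μ (V.g i), hg _, D.comul_simple i⟩
  · rw [Algebra.eq_top_iff]
    exact D.mem_of_generators _ (fun h => Algebra.subset_adjoin (.inl (hg h)))
      (fun i => Algebra.subset_adjoin (.inr ⟨i, rfl⟩))

end
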